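/- **Corollary (Smoothness of the $H^s$ metric and its spray).** Let $S^1=\mathbb R/\mathbb Z$, $e_k(x)=e^{2\pi i kx}$, $\hat u(k)=\int_{S^1}u\,e_{-k}\,dx$, and for $q>1/2$ let $H^q(S^1)$ be the Hilbert space of real (continuous) functions $u$ on $S^1$ with $\|u\|_{H^q}^2=\sum_{k\in\mathbb Z}(1+k^2)^q|\hat u(k)|^2<\infty$. For $q>3/2$ let $\mathcal D^q$ be the set of orientation preserving $C^1$ diffeomorphisms of $S^1$ of Sobolev class $H^q$, i.e. the maps $\varphi(x)=x+u(x)$ with $u\in H^q(S^1)$ and $\varphi_x=1+u_x>0$; it is a Hilbert manifold modelled on $H^q(S^1)$, with the displacements $u$ (which are unique up to an integer constant) as local coordinates, and $T\mathcal D^q\cong\mathcal D^q\times H^q(S^1)$. Let $\mathrm{Diff}^\infty(S^1)\subset\mathcal D^q$ be the group of smooth orientation preserving diffeomorphisms of $S^1$. For $s\in\mathbb R$ let $\Lambda^{2s}u=\sum_{k}(1+k^2)^s\,\hat u(k)\,e_k$, and consider on $\mathrm{Diff}^\infty(S^1)$ the right-invariant metric with inertia operator $\Lambda^{2s}$, $$\langle\eta,\xi\rangle_\varphi=\int_{S^1}\Lambda^{2s}(\eta\circ\varphi^{-1})\;(\xi\circ\varphi^{-1})\,dx,\qquad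 \varphi\in\mathrm{Diff}^\infty(S^1),\ \eta,\xi\in C^\infty(S^1).$$ Let $s\ge 1/2$ and $q>\tfrac32+2s$. Then $\varphi^{-1}\in\mathcal D^q$ for every $\varphi\in\mathcal D^q$, and there is a smooth weak Riemannian metric $g$ on $\mathcal D^q$ (a smooth field of bounded, symmetric, positive definite bilinear forms on the tangent spaces) such that: 1. $g$ extends the metric above: $g_\varphi(\eta,\xi)=\langle\eta,\xi\rangle_\varphi$ for all $\varphi\in\mathrm{Diff}^\infty(S^1)$ and $\eta,\xi\in C^\infty(S^1)$; moreover, $g_\varphi(\eta,\xi)$ is given by the same formula for all $\varphi\in\mathcal D^q$ and $\eta,\xi\in H^q(S^1)$. 2. $g$ has a smooth geodesic spray: there is a smooth vector field $F$ on $T\mathcal D^q$ which in each chart reads $F(y,v)=(v,-\Gamma_y(v,v))$, where $\Gamma_y:H^q(S^1)\times H^q(S^1)\to H^q(S^1)$ is a bounded bilinear map with $$2\,g(y)(\Gamma_y(u,v),w)=d_yg\cdot u\,(v,w)+d_yg\cdot v\,(u,w)-d_yg\cdot w\,(u,v)\qquad\text{for all }u,v,w\in H^q(S^1).$$ -/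

import Mathlib

open scoped Manifold ContDiff

/-- The `k`-th Fourier coefficient `∫_{S¹} u(x) exp(-2πikx) dx` of a real function on the circle
`S¹ = ℝ / ℤ`. -/
noncomputable def fourierHat (u : UnitAddCircle → ℝ) (k : ℤ) : ℂ :=
  fourierCoeff (fun x ↦ (u x : ℂ)) k

/-- `(1 + k²)^q`. -/
noncomputable def sobolevWeight (q : ℝ) (k : ℤ) : ℝ := (1 + (k : ℝ) ^ 2) ^ q

theorem sobolevWeight_pos (q : ℝ) (k : ℤ) : 0 < sobolevWeight q k := by
  unfold sobolevWeight; positivity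

theorem coeff_eq_C (u : C(UnitAddCircle, ℝ)) (k : ℤ) :
    fourierHat u k = fourierCoeff (⇑(ContinuousMap.mk (fun x ↦ (u x : ℂ)) (by fun_prop) : C(UnitAddCircle, ℂ))) k := rfl

theorem integrable_ofReal (u : C(UnitAddCircle, ℝ)) :
    MeasureTheory.Integrable (fun x ↦ (u x : ℂ)) AddCircle.haarAddCircle :=
  (ContinuousMap.mk (fun x ↦ (u x : ℂ)) (by fun_prop) : C(UnitAddCircle, ℂ)).continuous.integrable_of_hasCompactSupport
    (HasCompactSupport.of_compactSpace _)

theorem coeff_add (u v : C(UnitAddCircle, ℝ)) (k : ℤ) :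
    fourierHat (u + v : C(UnitAddCircle, ℝ)) k = fourierHat u k + fourierHat v k := by
  have := fourierCoeff.add (integrable_ofReal u) (integrable_ofReal v)
  have h2 := congrFun this k
  simp only [Pi.add_apply] at h2
  rw [fourierHat, fourierHat, fourierHat, ← h2]
  congr 1; ext x; simp

theorem coeff_smul (c : ℝ) (u : C(UnitAddCircle, ℝ)) (k : ℤ) :
    fourierHat (c • u : C(UnitAddCircle, ℝ)) k = c * fourierHat u k := by
  rw [fourierHat, fourierHat, ← fourierCoeff.const_mul]
  congr 1; ext x; simp

theorem coeff_zero (k : ℤ) : fourierHat (0 : C(UnitAddCircle, ℝ)) k = 0 := by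
  have := coeff_smul 0 0 k
  simpa using this

/-- The continuous real functions on the circle with `∑ₖ (1 + k²)^q |û(k)|² < ∞`. -/
noncomputable def hqSubmodule (q : ℝ) : Submodule ℝ C(UnitAddCircle, ℝ) where
  carrier := {u | Summable fun k : ℤ ↦ sobolevWeight q k * ‖fourierHat u k‖ ^ 2}
  zero_mem' := by
    simp only [Set.mem_ofPred_eq, coeff_zero]
    simp
  add_mem' := by
    intro u v hu hv
    simp only [Set.mem_ofPred_eq] at hu hv ⊢
    refine Summable.of_nonneg_of_le (fun k ↦ by have := sobolevWeight_pos q k; positivity) (fun k ↦ ?_)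
      ((hu.add hv).mul_left 2)
    rw [coeff_add]
    have h1 : ‖fourierHat u k + fourierHat v k‖ ^ 2 ≤ 2 * (‖fourierHat u k‖ ^ 2 + ‖fourierHat v k‖ ^ 2) := by
      have := norm_add_le (fourierHat u k) (fourierHat v k)
      nlinarith [sq_nonneg (‖fourierHat u k‖ - ‖fourierHat v k‖), norm_nonneg (fourierHat u k + fourierHat v k)]
    have := mul_le_mul_of_nonneg_left h1 (sobolevWeight_pos q k).le
    linarith
  smul_mem' := by
    intro c u hu
    simp only [Set.mem_ofPred_eq] at hu ⊢
    refine (hu.mul_left (c ^ 2)).congr fun k ↦ ?_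
    rw [coeff_smul, norm_mul, mul_pow]
    simp
    ring

/-- The Sobolev space `H^q(S¹)` of real functions, for `q > 1/2`, where all its elements are
(represented by) continuous functions. Its norm is `(∑ₖ (1 + k²)^q |û(k)|²)^{1/2}`, see
`Hq.norm_sq_eq`, and it is a Hilbert space, see `Hq.completeSpace`. It is given as a type of its own,
so that it does not inherit the supremum norm. -/
def Hq (q : ℝ) : Type := hqSubmodule q

namespace Hq
variable {q : ℝ}

noncomputable instance : AddCommGroup (Hq q) := inferInstanceAs (AddCommGroup (hqSubmodule q))
noncomputable instance : Module ℝ (Hq q) := inferInstanceAs (Module ℝ (hqSubmodule q))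

/-- The underlying continuous function. -/
noncomputable def toC : Hq q →ₗ[ℝ] C(UnitAddCircle, ℝ) := (hqSubmodule q).subtype

noncomputable instance : CoeFun (Hq q) (fun _ ↦ UnitAddCircle → ℝ) := ⟨fun u ↦ ⇑(toC u)⟩

/-- A continuous function of finite `H^q` norm, as an element of `H^q`. -/
def mk (u : C(UnitAddCircle, ℝ)) (hu : u ∈ hqSubmodule q) : Hq q := ⟨u, hu⟩

@[simp] theorem toC_mk (u : C(UnitAddCircle, ℝ)) (hu : u ∈ hqSubmodule q) : toC (mk u hu) = u := rfl

theorem toC_injective : Function.Injective (toC (q := q)) := Subtype.val_injective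

theorem ext {u v : Hq q} (h : ∀ x, u x = v x) : u = v := toC_injective (ContinuousMap.ext h)

theorem continuous (u : Hq q) : Continuous (u : UnitAddCircle → ℝ) := (toC u).continuous
@[simp] theorem add_apply (u v : Hq q) (x : UnitAddCircle) : (u + v) x = u x + v x := rfl
@[simp] theorem sub_apply (u v : Hq q) (x : UnitAddCircle) : (u - v) x = u x - v x := rfl
@[simp] theorem smul_apply (c : ℝ) (u : Hq q) (x : UnitAddCircle) : (c • u) x = c * u x := rfl

theorem summable (u : Hq q) : Summable fun k : ℤ ↦ sobolevWeight q k * ‖fourierHat u k‖ ^ 2 := u.2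

theorem weight_half_sq (q : ℝ) (k : ℤ) : sobolevWeight (q / 2) k ^ 2 = sobolevWeight q k := by
  unfold sobolevWeight
  rw [← Real.rpow_natCast, ← Real.rpow_mul (by positivity)]
  congr 1; push_cast; ring

/-- The weighted Fourier coefficients `(1 + k²)^{q/2} û(k)`, which define the norm of `H^q`. -/
noncomputable def toL2 (q : ℝ) : Hq q →ₗ[ℝ] lp (fun _ : ℤ ↦ ℂ) 2 where
  toFun u := ⟨fun k ↦ sobolevWeight (q / 2) k * fourierHat u k, by
    refine memℓp_gen ?_
    refine u.summable.congr fun k ↦ ?_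
    simp only [norm_mul, ENNReal.toReal_ofNat, Real.rpow_ofNat, mul_pow, Complex.norm_real,
      Real.norm_eq_abs, sq_abs, weight_half_sq]⟩
  map_add' u v := by
    ext k
    simp only [lp.coeFn_add, Pi.add_apply, ← mul_add]
    congr 1
    exact coeff_add (toC u) (toC v) k
  map_smul' c u := by
    ext k
    simp only [lp.coeFn_smul, Pi.smul_apply, RingHom.id_apply, Complex.real_smul]
    rw [mul_left_comm]
    congr 1
    exact coeff_smul c (toC u) k

theorem toL2_apply (u : Hq q) (k : ℤ) : toL2 q u k = sobolevWeight (q / 2) k * fourierHat u k := rfl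

theorem _root_.eq_of_coeff_eq {u v : C(UnitAddCircle, ℝ)} (h : ∀ k, fourierHat u k = fourierHat v k) : u = v := by
  let w : C(UnitAddCircle, ℂ) := ⟨fun x ↦ ((u - v) x : ℂ), by fun_prop⟩
  have hw : ∀ k, fourierCoeff w k = 0 := by
    intro k
    have : fourierCoeff w k = fourierHat (u - v : C(UnitAddCircle, ℝ)) k := rfl
    rw [this, sub_eq_add_neg, coeff_add, ← neg_one_smul ℝ v, coeff_smul, h]
    simp
  have hs := has_pointwise_sum_fourier_series_of_summable (f := w)
    (by rw [show fourierCoeff w = 0 from funext hw]; exact summable_zero)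
  ext x
  have := hs x
  simp only [hw, zero_smul] at this
  have h0 := this.unique hasSum_zero
  have h1 : ((u x - v x : ℝ) : ℂ) = 0 := h0
  exact sub_eq_zero.mp (by exact_mod_cast h1)

theorem toL2_injective : Function.Injective (toL2 q) := by
  intro u v h
  refine toC_injective (eq_of_coeff_eq fun k ↦ ?_)
  have := congrArg (fun f : lp (fun _ : ℤ ↦ ℂ) 2 ↦ f k) h
  simp only [toL2_apply] at this
  exact mul_left_cancel₀ (by exact_mod_cast (sobolevWeight_pos (q/2) k).ne') this

noncomputable instance : NormedAddCommGroup (Hq q) :=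
  NormedAddCommGroup.induced (Hq q) (lp (fun _ : ℤ ↦ ℂ) 2) (toL2 q) toL2_injective

noncomputable instance : InnerProductSpace ℝ (Hq q) where
  norm_smul_le c u := by
    change ‖toL2 q (c • u)‖ ≤ _ * ‖toL2 q u‖
    rw [map_smul, norm_smul]
  inner u v := (inner ℂ (toL2 q u) (toL2 q v)).re
  norm_sq_eq_re_inner u := by
    change ‖toL2 q u‖ ^ 2 = _
    exact norm_sq_eq_re_inner (𝕜 := ℂ) (toL2 q u)
  conj_inner_symm u v := by
    rw [conj_trivial, ← inner_conj_symm, Complex.conj_re]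
  add_left u v w := by simp
  smul_left u v r := by
    have h : toL2 q (r • u) = (r : ℂ) • toL2 q u := by
      ext k
      rw [map_smul]
      exact (Complex.real_smul (x := r) (z := toL2 q u k))
    rw [h, inner_smul_left]; simp

theorem norm_eq_toL2 (u : Hq q) : ‖u‖ = ‖toL2 q u‖ := rfl

theorem norm_sq_eq (u : Hq q) : ‖u‖ ^ 2 = ∑' k : ℤ, sobolevWeight q k * ‖fourierHat u k‖ ^ 2 := by
  have := lp.norm_rpow_eq_tsum (p := 2) (by norm_num) (toL2 q u)
  simp only [ENNReal.toReal_ofNat, Real.rpow_ofNat] at this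
  rw [norm_eq_toL2, this]
  refine tsum_congr fun k ↦ ?_
  rw [toL2_apply]
  simp only [norm_mul, mul_pow, Complex.norm_real,
      Real.norm_eq_abs, sq_abs, weight_half_sq]

theorem norm_toL2_apply_le (u : Hq q) (k : ℤ) : sobolevWeight (q / 2) k * ‖fourierHat u k‖ ≤ ‖u‖ := by
  have := lp.norm_apply_le_norm (p := 2) (by norm_num) (toL2 q u) k
  rw [toL2_apply] at this
  rwa [norm_mul, Complex.norm_real, Real.norm_eq_abs, abs_of_pos (sobolevWeight_pos (q/2) k)] at this

end Hq

theorem summable_sobolevWeight {r : ℝ} (hr : r < -(1 / 2)) : Summable (sobolevWeight r) := by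
  have h1 : Summable fun n : ℕ ↦ (1 + (n : ℝ) ^ 2) ^ r := by
    have h0 : Summable fun n : ℕ ↦ (n : ℝ) ^ (2 * r) :=
      Real.summable_nat_rpow.mpr (by linarith)
    rw [← summable_nat_add_iff 1] at h0 ⊢
    refine Summable.of_nonneg_of_le (fun n ↦ by positivity) (fun n ↦ ?_) h0
    rw [Real.rpow_mul (by positivity)]
    refine Real.rpow_le_rpow_of_nonpos (by positivity) ?_ (by linarith)
    simp
  refine Summable.of_nat_of_neg (h1.congr fun n ↦ ?_) (h1.congr fun n ↦ ?_) <;>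
    simp [sobolevWeight]

theorem sobolevWeight_add (a b : ℝ) (k : ℤ) :
    sobolevWeight (a + b) k = sobolevWeight a k * sobolevWeight b k :=
  Real.rpow_add (by positivity) _ _

namespace Hq
variable {q : ℝ}

theorem summable_weight_mul (u : Hq q) {t : ℝ} (ht : t < q / 2 - 1 / 4) :
    Summable (fun k ↦ sobolevWeight t k * ‖fourierHat u k‖) ∧
    ∑' k, sobolevWeight t k * ‖fourierHat u k‖ ≤ √(∑' k, sobolevWeight (2 * t - q) k) * ‖u‖ := by
  have hs := summable_sobolevWeight (r := 2 * t - q) (by linarith)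
  have h := Real.summable_and_inner_le_Lp_mul_Lq_tsum_of_nonneg Real.HolderConjugate.two_two
    (f := fun k ↦ sobolevWeight (t - q / 2) k) (g := fun k ↦ sobolevWeight (q / 2) k * ‖fourierHat u k‖)
    (fun k ↦ (sobolevWeight_pos _ _).le)
    (fun k ↦ mul_nonneg (sobolevWeight_pos _ _).le (norm_nonneg _))
    (hs.congr fun k ↦ by
      rw [Real.rpow_ofNat, ← weight_half_sq]; congr 2; ring)
    (u.summable.congr fun k ↦ by
      rw [Real.rpow_ofNat, mul_pow, weight_half_sq])
  have e1 : ∀ k, sobolevWeight (t - q / 2) k * (sobolevWeight (q / 2) k * ‖fourierHat u k‖) =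
      sobolevWeight t k * ‖fourierHat u k‖ := fun k ↦ by
    rw [← mul_assoc, ← sobolevWeight_add]; congr 2; ring
  have e2 : ∀ k, sobolevWeight (t - q / 2) k ^ (2 : ℝ) = sobolevWeight (2 * t - q) k := fun k ↦ by
    rw [Real.rpow_ofNat, ← weight_half_sq (2 * t - q)]; congr 2; ring
  have e3 : ∀ k, (sobolevWeight (q / 2) k * ‖fourierHat u k‖) ^ (2 : ℝ) =
      sobolevWeight q k * ‖fourierHat u k‖ ^ 2 := fun k ↦ by
    rw [Real.rpow_ofNat, mul_pow, weight_half_sq]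
  simp only [e1, e2, e3, ← norm_sq_eq, ← Real.sqrt_eq_rpow] at h
  rw [Real.sqrt_sq (norm_nonneg _)] at h
  exact h

theorem hasSum_coeff (u : Hq q) (hq : 1 / 2 < q) (x : UnitAddCircle) :
    HasSum (fun k ↦ fourierHat u k * fourier k x) (u x : ℂ) := by
  have h := (u.summable_weight_mul (t := 0) (by linarith)).1
  simp only [sobolevWeight, Real.rpow_zero, one_mul] at h
  have := has_pointwise_sum_fourier_series_of_summable
    (f := (ContinuousMap.mk (fun x ↦ (u x : ℂ)) (by have := u.continuous; fun_prop) : C(UnitAddCircle, ℂ)))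
    h.of_norm x
  exact this

theorem abs_apply_le (u : Hq q) (hq : 1 / 2 < q) (x : UnitAddCircle) :
    |u x| ≤ √(∑' k, sobolevWeight (-q) k) * ‖u‖ := by
  have h := u.summable_weight_mul (t := 0) (by linarith)
  simp only [sobolevWeight, Real.rpow_zero, one_mul] at h
  have h1 := tsum_of_norm_bounded (f := fun k ↦ fourierHat u k * fourier k x) h.1.hasSum
    (fun k ↦ by rw [norm_mul, fourier_apply, Circle.norm_coe, mul_one])
  rw [(u.hasSum_coeff hq x).tsum_eq, Complex.norm_real] at h1
  refine h1.trans (h.2.trans ?_)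
  simp [sobolevWeight]

/-- The termwise derivative of the Fourier series. -/
noncomputable def derivSeries (u : Hq q) (x : ℝ) : ℂ :=
  ∑' k : ℤ, fourierHat u k * (2 * Real.pi * Complex.I * k * fourier k (x : UnitAddCircle))

theorem norm_derivTerm_le (u : Hq q) (x : ℝ) (k : ℤ) :
    ‖fourierHat u k * (2 * Real.pi * Complex.I * k * fourier k (x : UnitAddCircle))‖ ≤
      2 * Real.pi * (sobolevWeight (1 / 2) k * ‖fourierHat u k‖) := by
  rw [fourier_apply]
  simp only [norm_mul, Circle.norm_coe, mul_one, Complex.norm_I, Complex.norm_ofNat,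
    Complex.norm_real, Real.norm_eq_abs, abs_of_pos Real.pi_pos, Complex.norm_intCast]
  have : |(k : ℝ)| ≤ sobolevWeight (1 / 2) k := by
    unfold sobolevWeight
    rw [← Real.sqrt_eq_rpow]
    exact Real.abs_le_sqrt (by linarith)
  have h2 : 0 ≤ 2 * Real.pi * ‖fourierHat u k‖ := by positivity
  nlinarith [mul_le_mul_of_nonneg_left this h2]

theorem summable_derivBound (u : Hq q) (hq : 3 / 2 < q) :
    Summable fun k ↦ 2 * Real.pi * (sobolevWeight (1 / 2) k * ‖fourierHat u k‖) :=
  ((u.summable_weight_mul (t := 1 / 2) (by linarith)).1).mul_left _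

theorem hasDerivAt_ofReal (u : Hq q) (hq : 3 / 2 < q) (x : ℝ) :
    HasDerivAt (fun y : ℝ ↦ ((u (y : UnitAddCircle) : ℝ) : ℂ)) (u.derivSeries x) x := by
  have h := hasDerivAt_tsum (u.summable_derivBound hq)
    (g := fun k (y : ℝ) ↦ fourierHat u k * fourier k (y : UnitAddCircle))
    (g' := fun k (y : ℝ) ↦ fourierHat u k * (2 * Real.pi * Complex.I * k * fourier k (y : UnitAddCircle)))
    (fun k y ↦ by
      have := (hasDerivAt_fourier 1 k y).const_mul (fourierHat u k)
      simpa using this)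
    (fun k y ↦ u.norm_derivTerm_le y k) (y₀ := 0)
    ((u.hasSum_coeff (by linarith) _).summable) x
  refine h.congr_of_eventuallyEq (Filter.Eventually.of_forall fun y ↦ ?_)
  exact ((u.hasSum_coeff (by linarith) _).tsum_eq).symm

theorem continuous_derivSeries (u : Hq q) (hq : 3 / 2 < q) : Continuous u.derivSeries := by
  refine continuous_tsum (fun k ↦ ?_) (u.summable_derivBound hq) (fun k y ↦ u.norm_derivTerm_le y k)
  have : Continuous fun y : ℝ ↦ fourier k (y : UnitAddCircle) :=
    (fourier k).continuous.comp (AddCircle.continuous_mk' 1)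
  fun_prop

/-- The derivative `u_x`, of `u` as a `1`-periodic function on the line (for `q > 3/2` such a
function is `C¹`, see `Hq.hasDerivAt` and `Hq.continuous_deriv`). -/
noncomputable def deriv (u : Hq q) (x : ℝ) : ℝ := _root_.deriv (fun y : ℝ ↦ u (y : UnitAddCircle)) x

theorem hasDerivAt' (u : Hq q) (hq : 3 / 2 < q) (x : ℝ) :
    HasDerivAt (fun y : ℝ ↦ u (y : UnitAddCircle)) (u.derivSeries x).re x :=
  Complex.reCLM.hasFDerivAt.comp_hasDerivAt x (u.hasDerivAt_ofReal hq x)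

theorem deriv_eq (u : Hq q) (hq : 3 / 2 < q) (x : ℝ) : u.deriv x = (u.derivSeries x).re :=
  (u.hasDerivAt' hq x).deriv

theorem hasDerivAt (u : Hq q) (hq : 3 / 2 < q) (x : ℝ) :
    HasDerivAt (fun y : ℝ ↦ u (y : UnitAddCircle)) (u.deriv x) x := by
  rw [u.deriv_eq hq]; exact u.hasDerivAt' hq x

theorem continuous_deriv (u : Hq q) (hq : 3 / 2 < q) : Continuous u.deriv := by
  rw [show u.deriv = fun x ↦ (u.derivSeries x).re from funext (u.deriv_eq hq)]
  exact Complex.continuous_re.comp (u.continuous_derivSeries hq)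

theorem deriv_periodic (u : Hq q) : Function.Periodic u.deriv 1 := by
  intro x
  rw [deriv, ← deriv_comp_add_const, deriv]
  congr 1
  ext y
  rw [AddCircle.coe_add_period]

theorem deriv_sub (u v : Hq q) (hq : 3 / 2 < q) (x : ℝ) :
    (u - v).deriv x = u.deriv x - v.deriv x :=
  ((u.hasDerivAt hq x).sub (v.hasDerivAt hq x)).deriv

theorem abs_deriv_le (u : Hq q) (hq : 3 / 2 < q) (x : ℝ) :
    |u.deriv x| ≤ 2 * Real.pi * √(∑' k, sobolevWeight (1 - q) k) * ‖u‖ := by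
  have h := u.summable_weight_mul (t := 1 / 2) (by linarith)
  have h1 := tsum_of_norm_bounded (u.summable_derivBound hq).hasSum (u.norm_derivTerm_le x)
  rw [u.deriv_eq hq]
  refine (Complex.abs_re_le_norm _).trans (h1.trans ?_)
  rw [tsum_mul_left, mul_assoc]
  have h2 := h.2
  rw [show 2 * (1 / 2 : ℝ) - q = 1 - q by ring] at h2
  calc 2 * (Real.pi * ∑' k, sobolevWeight (1 / 2) k * ‖fourierHat u k‖)
      = 2 * Real.pi * ∑' k, sobolevWeight (1 / 2) k * ‖fourierHat u k‖ := by ring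
    _ ≤ 2 * Real.pi * (√(∑' k, sobolevWeight (1 - q) k) * ‖u‖) :=
        mul_le_mul_of_nonneg_left h2 (by positivity)
    _ = _ := by ring

/-- `1 + u_x > 0`, i.e. `x ↦ x + u(x)` is an orientation preserving `C¹` diffeomorphism. -/
def IsDisplacement (u : Hq q) : Prop := ∀ x : ℝ, 0 < 1 + u.deriv x

theorem isOpen_isDisplacement (hq : 3 / 2 < q) : IsOpen {u : Hq q | u.IsDisplacement} := by
  rw [Metric.isOpen_iff]
  intro u hu
  obtain ⟨x₀, -, hx₀⟩ := (isCompact_Icc (a := (0 : ℝ)) (b := 1)).exists_isMinOn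
    (Set.nonempty_Icc.mpr (zero_le_one (α := ℝ))) (u.continuous_deriv hq).continuousOn
  have hmin : ∀ x, u.deriv x₀ ≤ u.deriv x := by
    intro x
    obtain ⟨y, hy, hxy⟩ := u.deriv_periodic.exists_mem_Ico₀ (zero_lt_one (α := ℝ)) x
    rw [hxy]
    exact hx₀ (Set.Ico_subset_Icc_self hy)
  set C := 2 * Real.pi * √(∑' k, sobolevWeight (1 - q) k)
  have hC : 0 ≤ C := by positivity
  refine ⟨(1 + u.deriv x₀) / (C + 1), div_pos (hu x₀) (by linarith), fun v hv x ↦ ?_⟩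
  rw [Metric.mem_ball, dist_eq_norm, lt_div_iff₀ (by linarith)] at hv
  have h1 := (v - u).abs_deriv_le hq x
  rw [deriv_sub _ _ hq] at h1
  have h2 := (abs_le.mp h1).1
  have h3 := hmin x
  have h4 := norm_nonneg (v - u)
  have : C * ‖v - u‖ < 1 + u.deriv x₀ := by nlinarith
  change _ ≤ C * _ at h1
  change -(C * _) ≤ _ at h2
  linarith

/-- The map `x ↦ x + u(x)` of the circle to itself. -/
noncomputable def toMap (u : Hq q) (x : UnitAddCircle) : UnitAddCircle :=
  x + ((u x : ℝ) : UnitAddCircle)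

theorem toMap_coe (u : Hq q) (x : ℝ) : u.toMap x = ((x + u x : ℝ) : UnitAddCircle) := rfl

theorem continuous_toMap (u : Hq q) : Continuous u.toMap :=
  continuous_id.add ((AddCircle.continuous_mk' 1).comp u.continuous)

theorem IsDisplacement.strictMono {u : Hq q} (hu : u.IsDisplacement) (hq : 3 / 2 < q) :
    StrictMono fun x : ℝ ↦ x + u (x : UnitAddCircle) := by
  refine strictMono_of_deriv_pos fun x ↦ ?_
  exact ((hasDerivAt_id x).add (u.hasDerivAt hq x)).deriv ▸ hu x

theorem IsDisplacement.injective {u : Hq q} (hu : u.IsDisplacement) (hq : 3 / 2 < q) :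
    Function.Injective u.toMap := by
  intro x y
  induction x using QuotientAddGroup.induction_on with | H a => ?_
  induction y using QuotientAddGroup.induction_on with | H b => ?_
  intro h
  change u.toMap (a : UnitAddCircle) = u.toMap (b : UnitAddCircle) at h
  rw [toMap_coe, toMap_coe, ← sub_eq_zero, ← AddCircle.coe_sub, AddCircle.coe_eq_zero_iff] at h
  obtain ⟨n, hn⟩ := h
  simp only [zsmul_eq_mul, mul_one] at hn
  have hb : ((b + n : ℝ) : UnitAddCircle) = b := by
    have := AddCircle.coe_eq_zero_iff (p := (1 : ℝ)) (x := (n : ℝ)) |>.mpr ⟨n, by simp⟩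
    rw [AddCircle.coe_add, this, add_zero]
  have : a = b + n := (hu.strictMono hq).injective (by
    simp only [hb]; linarith)
  change (a : UnitAddCircle) = b
  rw [this, hb]

theorem surjective_toMap (u : Hq q) : Function.Surjective u.toMap := by
  intro y
  induction y using QuotientAddGroup.induction_on with | H b => ?_
  have hc : Continuous fun x : ℝ ↦ x + u (x : UnitAddCircle) :=
    continuous_id.add (u.continuous.comp (AddCircle.continuous_mk' 1))
  obtain ⟨B, hB⟩ := (isCompact_univ (X := UnitAddCircle)).exists_bound_of_continuousOn u.continuous.continuousOn
  have hB' : ∀ x, |u x| ≤ B := fun x ↦ hB x trivial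
  have h1 := abs_le.mp (hB' ((b - B : ℝ) : UnitAddCircle))
  have h2 := abs_le.mp (hB' ((b + B : ℝ) : UnitAddCircle))
  obtain ⟨x, hx⟩ := mem_range_of_exists_le_of_exists_ge hc (c := b)
    ⟨b - B, by linarith⟩ ⟨b + B, by linarith⟩
  exact ⟨x, by rw [toMap_coe]; exact congrArg _ hx⟩

theorem sub_const_of_toMap_eq {u v : Hq q} (h : u.toMap = v.toMap) :
    ∃ n : ℤ, ∀ x, v x = u x + n := by
  have h1 : ∀ x, ∃ n : ℤ, v x - u x = n := by
    intro x
    have := congrFun h x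
    simp only [toMap, add_right_inj] at this
    rw [eq_comm, ← sub_eq_zero, ← AddCircle.coe_sub, AddCircle.coe_eq_zero_iff] at this
    obtain ⟨n, hn⟩ := this
    exact ⟨n, by simpa using hn.symm⟩
  choose n hn using h1
  have hcont : Continuous n := by
    have : Continuous fun x ↦ ((n x : ℤ) : ℝ) := by
      simp only [← hn]; exact v.continuous.sub u.continuous
    exact Int.isClosedEmbedding_coe_real.isInducing.continuous_iff.mpr this
  have hconst : ∀ x, n x = n 0 := fun x ↦
    PreconnectedSpace.constant (inferInstance : PreconnectedSpace UnitAddCircle) hcont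
  exact ⟨n 0, fun x ↦ by have := hn x; rw [hconst x] at this; linarith⟩

end Hq

theorem coeff_hasDerivAt (u v : C(UnitAddCircle, ℝ))
    (h : ∀ x : ℝ, HasDerivAt (fun y : ℝ ↦ u (y : UnitAddCircle)) (v (x : UnitAddCircle)) x) (k : ℤ) :
    fourierHat v k = 2 * Real.pi * Complex.I * k * fourierHat u k := by
  have cmk : Continuous fun x : ℝ ↦ (x : UnitAddCircle) := AddCircle.continuous_mk' 1
  have cu : Continuous fun x : ℝ ↦ ((u (x : UnitAddCircle) : ℝ) : ℂ) := by fun_prop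
  have cv : Continuous fun x : ℝ ↦ ((v (x : UnitAddCircle) : ℝ) : ℂ) := by fun_prop
  have cf : Continuous fun x : ℝ ↦ (fourier (-k) (x : UnitAddCircle)) := by fun_prop
  have hd : ∀ x : ℝ, HasDerivAt
      (fun y : ℝ ↦ fourier (-k) (y : UnitAddCircle) * ((u (y : UnitAddCircle) : ℝ) : ℂ))
      (-(2 * Real.pi * Complex.I * k) * (fourier (-k) (x : UnitAddCircle) * ((u (x : UnitAddCircle) : ℝ) : ℂ))
        + fourier (-k) (x : UnitAddCircle) * ((v (x : UnitAddCircle) : ℝ) : ℂ)) x := by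
    intro x
    refine ((hasDerivAt_fourier_neg 1 k x).mul (h x).ofReal_comp).congr_deriv ?_
    push_cast
    ring
  have hi := intervalIntegral.integral_eq_sub_of_hasDerivAt (a := 0) (b := 1) (fun x _ ↦ hd x)
    (Continuous.intervalIntegrable (by fun_prop) _ _)
  rw [intervalIntegral.integral_add (Continuous.intervalIntegrable (by fun_prop) _ _)
    (Continuous.intervalIntegrable (by fun_prop) _ _), intervalIntegral.integral_const_mul] at hi
  have e : ((1 : ℝ) : UnitAddCircle) = ((0 : ℝ) : UnitAddCircle) := by
    rw [AddCircle.coe_zero]; exact AddCircle.coe_period 1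
  rw [e, sub_self] at hi
  rw [fourierHat, fourierHat, fourierCoeff_eq_intervalIntegral _ _ 0, fourierCoeff_eq_intervalIntegral _ _ 0]
  simp only [zero_add, div_one, one_smul, smul_eq_mul]
  linear_combination hi

theorem norm_coeff_le (u : C(UnitAddCircle, ℝ)) (k : ℤ) : ‖fourierHat u k‖ ≤ ‖u‖ := by
  unfold fourierHat fourierCoeff
  refine (MeasureTheory.norm_integral_le_of_norm_le_const (C := ‖u‖)
    (Filter.Eventually.of_forall fun x ↦ ?_)).trans (by simp)
  rw [norm_smul, fourier_apply, Circle.norm_coe, one_mul, Complex.norm_real]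
  exact u.norm_coe_le_norm x

theorem coeff_decay (n : ℕ) : ∀ u : C(UnitAddCircle, ℝ),
    ContDiff ℝ n (fun x : ℝ ↦ u (x : UnitAddCircle)) → ∃ C, ∀ k : ℤ, |(k : ℝ)| ^ n * ‖fourierHat u k‖ ≤ C := by
  induction n with
  | zero => exact fun u _ ↦ ⟨‖u‖, fun k ↦ by simpa using norm_coeff_le u k⟩
  | succ n ih =>
    intro u hu
    have hu' : ContDiff ℝ (n + 1) (fun x : ℝ ↦ u (x : UnitAddCircle)) := by exact_mod_cast hu
    rw [contDiff_succ_iff_deriv] at hu'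
    obtain ⟨hd, -, hc⟩ := hu'
    have hper : Function.Periodic (deriv fun x : ℝ ↦ u (x : UnitAddCircle)) 1 := by
      intro x
      rw [← deriv_comp_add_const]
      congr 1
      ext y
      rw [AddCircle.coe_add_period]
    let v : C(UnitAddCircle, ℝ) := ⟨hper.lift, continuous_coinduced_dom.mpr hc.continuous⟩
    have hv : ∀ x : ℝ, v (x : UnitAddCircle) = deriv (fun x : ℝ ↦ u (x : UnitAddCircle)) x :=
      fun x ↦ rfl
    obtain ⟨C, hC⟩ := ih v hc
    refine ⟨C, fun k ↦ le_trans ?_ (hC k)⟩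
    rw [coeff_hasDerivAt u v (fun x ↦ by rw [hv]; exact (hd x).hasDerivAt)]
    simp only [norm_mul, Complex.norm_I, Complex.norm_ofNat,
      Complex.norm_real, Real.norm_eq_abs, abs_of_pos Real.pi_pos, Complex.norm_intCast, pow_succ, mul_one]
    have h1 : 0 ≤ |(k : ℝ)| ^ n * |(k : ℝ)| * ‖fourierHat u k‖ := by positivity
    nlinarith [Real.pi_gt_three]

/-- The space `C^∞(S¹)` of smooth real functions on the circle. -/
def SmoothFn : Type := {u : C(UnitAddCircle, ℝ) // ContDiff ℝ ∞ (fun x : ℝ ↦ u (x : UnitAddCircle))}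

theorem mem_hqSubmodule_of_contDiff (q : ℝ) (u : C(UnitAddCircle, ℝ))
    (hu : ContDiff ℝ ∞ (fun x : ℝ ↦ u (x : UnitAddCircle))) : u ∈ hqSubmodule q := by
  obtain ⟨n, hn⟩ := exists_nat_gt (q + 1)
  obtain ⟨C, hC⟩ := coeff_decay n u (hu.of_le (by exact_mod_cast le_top))
  obtain ⟨C₀, hC₀⟩ := coeff_decay 0 u (hu.of_le (by exact_mod_cast le_top))
  have hC0 : 0 ≤ C := le_trans (by positivity) (hC 0)
  have hC0' : 0 ≤ C₀ := le_trans (by positivity) (hC₀ 0)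
  have hs := (summable_sobolevWeight (r := q - n) (by linarith)).mul_left (2 ^ n * (C + C₀) ^ 2)
  refine Summable.of_nonneg_of_le (fun k ↦ by have := sobolevWeight_pos q k; positivity) (fun k ↦ ?_) hs
  have hb : sobolevWeight n k * ‖fourierHat u k‖ ^ 2 ≤ 2 ^ n * (C + C₀) ^ 2 := by
    have e : sobolevWeight n k = (1 + (k : ℝ) ^ 2) ^ n := by simp [sobolevWeight]
    rw [e]
    rcases eq_or_ne k 0 with rfl | hk
    · have h0 := hC₀ 0
      rw [pow_zero, one_mul] at h0
      have : ‖fourierHat u 0‖ ^ 2 ≤ (C + C₀) ^ 2 := pow_le_pow_left₀ (norm_nonneg _) (by linarith) 2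
      have h2 : (1 : ℝ) ≤ 2 ^ n := one_le_pow₀ (by norm_num)
      simp only [Int.cast_zero, ne_eq, OfNat.ofNat_ne_zero, not_false_eq_true, zero_pow, add_zero,
        one_pow, one_mul]
      nlinarith [sq_nonneg (C + C₀)]
    · have hk1 : (1 : ℝ) ≤ (k : ℝ) ^ 2 := by
        have := Int.one_le_abs hk
        have h3 : (1 : ℝ) ≤ |(k : ℝ)| := by exact_mod_cast this
        nlinarith [sq_abs (k : ℝ)]
      have h1 : (1 + (k : ℝ) ^ 2) ^ n ≤ 2 ^ n * (|(k : ℝ)| ^ n) ^ 2 := by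
        rw [← pow_mul, mul_comm n 2, pow_mul, sq_abs, ← mul_pow]
        exact pow_le_pow_left₀ (by positivity) (by linarith) n
      have h2 : (|(k : ℝ)| ^ n * ‖fourierHat u k‖) ^ 2 ≤ (C + C₀) ^ 2 :=
        pow_le_pow_left₀ (by positivity) (by linarith [hC k]) 2
      calc _ ≤ 2 ^ n * (|(k : ℝ)| ^ n) ^ 2 * ‖fourierHat u k‖ ^ 2 := by gcongr
        _ = 2 ^ n * (|(k : ℝ)| ^ n * ‖fourierHat u k‖) ^ 2 := by ring
        _ ≤ _ := by gcongr
  have e2 : sobolevWeight q k = sobolevWeight (q - n) k * sobolevWeight n k := by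
    rw [← sobolevWeight_add]; congr 1; ring
  rw [e2]
  have := mul_le_mul_of_nonneg_left hb (sobolevWeight_pos (q - n) k).le
  linarith

namespace SmoothFn
instance : CoeFun SmoothFn (fun _ ↦ UnitAddCircle → ℝ) := ⟨fun u ↦ ⇑(Subtype.val u)⟩

/-- The inclusion of `C^∞(S¹)` in `H^q(S¹)`. -/
def toHq (q : ℝ) (u : SmoothFn) : Hq q := Hq.mk u.1 (mem_hqSubmodule_of_contDiff q u.1 u.2)

theorem toHq_apply (q : ℝ) (u : SmoothFn) (x : UnitAddCircle) : u.toHq q x = u x := rfl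

/-- The constant function `c`. -/
def const (c : ℝ) : SmoothFn := ⟨ContinuousMap.const _ c, contDiff_const⟩
end SmoothFn

namespace Hq
variable {q : ℝ}
/-- The constant function `c`. -/
def const (c : ℝ) : Hq q := (SmoothFn.const c).toHq q
@[simp] theorem const_apply (c : ℝ) (x : UnitAddCircle) : (const c : Hq q) x = c := rfl

theorem exists_of_symm (hq : 1 / 2 < q) (a : lp (fun _ : ℤ ↦ ℂ) 2)
    (ha : ∀ k, a (-k) = starRingEnd ℂ (a k)) : ∃ u : Hq q, toL2 q u = a := by
  set b : ℤ → ℂ := fun k ↦ sobolevWeight (-(q / 2)) k * a k with hb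
  have ha2 : Summable fun k ↦ ‖a k‖ ^ (2 : ℝ) := by
    simpa using (lp.memℓp a).summable (by norm_num)
  have hbs : Summable fun k ↦ ‖b k‖ := by
    refine (Real.summable_mul_of_Lp_Lq_of_nonneg Real.HolderConjugate.two_two
      (f := fun k ↦ sobolevWeight (-(q / 2)) k) (g := fun k ↦ ‖a k‖)
      (fun k ↦ (sobolevWeight_pos _ _).le) (fun k ↦ norm_nonneg _) ?_ ha2).congr fun k ↦ ?_
    · refine (summable_sobolevWeight (r := -q) (by linarith)).congr fun k ↦ ?_
      rw [Real.rpow_ofNat, ← weight_half_sq (-q)]; congr 2; ring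
    · rw [hb]
      simp [abs_of_pos (sobolevWeight_pos _ _)]
  have hbsymm : ∀ k, b (-k) = starRingEnd ℂ (b k) := by
    intro k
    simp only [hb, ha, map_mul, Complex.conj_ofReal]
    simp [sobolevWeight]
  have hnorm : ∀ k (x : UnitAddCircle), ‖b k * fourier k x‖ = ‖b k‖ := fun k x ↦ by
    rw [norm_mul, fourier_apply, Circle.norm_coe, mul_one]
  let v : UnitAddCircle → ℂ := fun x ↦ ∑' k, b k * fourier k x
  have hvc : Continuous v := continuous_tsum (fun k ↦ by fun_prop) hbs (fun k x ↦ (hnorm k x).le)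
  have hreal : ∀ x, (((v x).re : ℝ) : ℂ) = v x := by
    intro x
    rw [← Complex.conj_eq_iff_re]
    simp only [v]
    rw [Complex.conj_tsum, ← (Equiv.neg ℤ).tsum_eq]
    refine tsum_congr fun k ↦ ?_
    simp only [Equiv.neg_apply, map_mul, fourier_neg, hbsymm, Complex.conj_conj]
  let u : C(UnitAddCircle, ℝ) := ⟨fun x ↦ (v x).re, Complex.continuous_re.comp hvc⟩
  have hcoeff : ∀ k, fourierHat u k = b k := by
    intro k
    have e1 : fourierHat u k = ∫ x : UnitAddCircle, ∑' j, fourier (-k) x • (b j * fourier j x) ∂AddCircle.haarAddCircle := by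
      unfold fourierHat fourierCoeff
      refine MeasureTheory.integral_congr_ae (Filter.Eventually.of_forall fun x ↦ ?_)
      simp only [smul_eq_mul]
      rw [tsum_mul_left]
      congr 1
      exact hreal x
    have hn2 : ∀ j (x : UnitAddCircle), ‖fourier (-k) x • (b j * fourier j x)‖ = ‖b j‖ := fun j x ↦ by
      rw [norm_smul, hnorm, fourier_apply, Circle.norm_coe, one_mul]
    rw [e1, ← MeasureTheory.integral_tsum_of_summable_integral_norm]
    · rw [tsum_eq_single k]
      · have : fourierCoeff (fun x : UnitAddCircle ↦ b k * fourier k x) k = b k := by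
          rw [fourierCoeff.const_mul, fourierCoeff_fourier]; simp
        exact this
      · intro j hj
        have : fourierCoeff (fun x : UnitAddCircle ↦ b j * fourier j x) k = 0 := by
          rw [fourierCoeff.const_mul, fourierCoeff_fourier]; simp [hj.symm]
        exact this
    · intro j
      have : Continuous fun x : UnitAddCircle ↦ fourier (-k) x • (b j * fourier j x) := by fun_prop
      exact this.integrable_of_hasCompactSupport (HasCompactSupport.of_compactSpace _)
    · simpa only [hn2, MeasureTheory.integral_const, MeasureTheory.probReal_univ, one_smul] using hbs
  have hw : ∀ k, (sobolevWeight (q / 2) k : ℂ) * b k = a k := by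
    intro k
    rw [hb]
    simp only
    rw [← mul_assoc, ← Complex.ofReal_mul, ← sobolevWeight_add]
    simp [sobolevWeight]
  have hmem : u ∈ hqSubmodule q := by
    refine ha2.congr fun k ↦ ?_
    rw [← hw, hcoeff, Real.rpow_ofNat, norm_mul, mul_pow, ← weight_half_sq q, Complex.norm_real,
      Real.norm_eq_abs, sq_abs]
  refine ⟨mk u hmem, lp.ext (funext fun k ↦ ?_)⟩
  rw [toL2_apply, toC_mk, ← hw k, ← hcoeff k]

theorem toL2_symm (u : Hq q) (k : ℤ) : toL2 q u (-k) = starRingEnd ℂ (toL2 q u k) := by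
  rw [toL2_apply, toL2_apply, map_mul, Complex.conj_ofReal]
  congr 1
  · simp [sobolevWeight]
  · unfold fourierHat fourierCoeff
    rw [← integral_conj]
    refine MeasureTheory.integral_congr_ae (Filter.Eventually.of_forall fun x ↦ ?_)
    simp

theorem completeSpace (hq : 1 / 2 < q) : CompleteSpace (Hq q) := by
  have hiso : Isometry (toL2 q) :=
    AddMonoidHomClass.isometry_of_norm (toL2 q) fun u ↦ (norm_eq_toL2 u).symm
  refine (completeSpace_iff_isComplete_range hiso.isUniformInducing).mpr ?_
  have : Set.range (toL2 q) = {a | ∀ k, a (-k) = starRingEnd ℂ (a k)} := by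
    ext a
    exact ⟨fun ⟨u, hu⟩ k ↦ hu ▸ toL2_symm u k, fun h ↦ exists_of_symm hq a h⟩
  rw [this]
  refine IsClosed.isComplete ?_
  have hev : ∀ k, Continuous fun a : lp (fun _ : ℤ ↦ ℂ) 2 ↦ a k := fun k ↦
    (lp.evalCLM ℂ (fun _ : ℤ ↦ ℂ) 2 k).continuous
  simp only [Set.ofPred_forall]
  exact isClosed_iInter fun k ↦ isClosed_eq (hev _) (Complex.continuous_conj.comp (hev _))
end Hq
/-- For `q > 3/2`: `φ` is an orientation preserving `C¹` diffeomorphism of the circle of Sobolev class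
`H^q`, that is `φ(x) = x + u(x)` with `u ∈ H^q(S¹)` and `φ_x = 1 + u_x > 0`. -/
def IsHqDiffeo (q : ℝ) (φ : UnitAddCircle ≃ₜ UnitAddCircle) : Prop :=
  ∃ u : Hq q, u.IsDisplacement ∧ ∀ x, φ x = u.toMap x

/-- The set `D^q` (`q > 3/2`) of the orientation preserving diffeomorphisms of the circle of Sobolev
class `H^q`. -/
def Dq (q : ℝ) : Type :=
  {φ : UnitAddCircle ≃ₜ UnitAddCircle // IsHqDiffeo q φ}

namespace Dq
variable {q : ℝ}

/-- The underlying homeomorphism of the circle. -/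
def toHomeo (φ : Dq q) : UnitAddCircle ≃ₜ UnitAddCircle := φ.1

theorem ext {φ ψ : Dq q} (h : ∀ x, φ.toHomeo x = ψ.toHomeo x) : φ = ψ :=
  Subtype.ext (Homeomorph.ext h)

/-- A choice of `u` with `φ(x) = x + u(x)` (it is unique up to an integer constant). -/
noncomputable def disp (φ : Dq q) : Hq q := φ.2.choose

theorem isDisplacement_disp (φ : Dq q) : φ.disp.IsDisplacement := φ.2.choose_spec.1

theorem toMap_disp (φ : Dq q) (x : UnitAddCircle) : φ.disp.toMap x = φ.toHomeo x :=
  (φ.2.choose_spec.2 x).symm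

theorem hqInstFact [h : Fact (3 / 2 < q)] : 3 / 2 < q := h.out

variable [Fact (3 / 2 < q)]

instance : CompleteSpace (Hq q) := Hq.completeSpace (by have := hqInstFact (q := q); linarith)

/-- The diffeomorphism `x ↦ x + u(x)`. -/
noncomputable def ofDisp (u : Hq q) (hu : u.IsDisplacement) : Dq q :=
  ⟨Continuous.homeoOfEquivCompactToT2
    (f := Equiv.ofBijective u.toMap ⟨hu.injective hqInstFact, u.surjective_toMap⟩) u.continuous_toMap,
    u, hu, fun _ ↦ rfl⟩

theorem toHomeo_ofDisp (u : Hq q) (hu : u.IsDisplacement) (x : UnitAddCircle) :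
    (ofDisp u hu).toHomeo x = u.toMap x := rfl

theorem ofDisp_disp (φ : Dq q) : ofDisp φ.disp φ.isDisplacement_disp = φ :=
  ext fun x ↦ by rw [toHomeo_ofDisp, toMap_disp]

theorem isDisplacement_sub_const {u : Hq q} (hu : u.IsDisplacement) (c : ℝ) :
    (u - Hq.const c).IsDisplacement := by
  intro x
  rw [Hq.deriv_sub _ _ hqInstFact]
  have : (Hq.const c : Hq q).deriv x = 0 := by
    simp [Hq.deriv]
  rw [this, sub_zero]
  exact hu x

theorem toMap_sub_int (u : Hq q) (n : ℤ) : (u - Hq.const (n : ℝ)).toMap = u.toMap := by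
  funext x
  have : ((n : ℝ) : UnitAddCircle) = 0 := AddCircle.coe_eq_zero_iff (1 : ℝ) |>.mpr ⟨n, by simp⟩
  simp [Hq.toMap, this]

/-- Translate `u` by an integer so that `u(0) ∈ [c, c+1)`. -/
noncomputable def normalize (c : ℝ) (u : Hq q) : Hq q := u - Hq.const ((⌊u 0 - c⌋ : ℤ) : ℝ)

theorem isDisplacement_normalize {u : Hq q} (hu : u.IsDisplacement) (c : ℝ) :
    (normalize c u).IsDisplacement := isDisplacement_sub_const hu _

theorem normalize_zero_mem (c : ℝ) (u : Hq q) : normalize c u 0 ∈ Set.Ico c (c + 1) := by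
  simp only [normalize, Hq.sub_apply, Hq.const_apply, Set.mem_Ico]
  have h1 := Int.floor_le (u 0 - c)
  have h2 := Int.lt_floor_add_one (u 0 - c)
  constructor <;> linarith

theorem toMap_normalize (c : ℝ) (u : Hq q) : (normalize c u).toMap = u.toMap := toMap_sub_int u _

theorem normalize_eq_of_toMap_eq (c : ℝ) {u v : Hq q} (h : u.toMap = v.toMap) :
    normalize c u = normalize c v := by
  obtain ⟨n, hn⟩ := Hq.sub_const_of_toMap_eq h
  refine Hq.ext fun x ↦ ?_
  simp only [normalize, Hq.sub_apply, Hq.const_apply, hn]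
  rw [show u 0 + n - c = (u 0 - c) + n by ring, Int.floor_add_intCast]
  push_cast
  ring

theorem normalize_disp_ofDisp (c : ℝ) (u : Hq q) (hu : u.IsDisplacement) :
    normalize c (ofDisp u hu).disp = normalize c u :=
  normalize_eq_of_toMap_eq c (funext fun x ↦ by rw [toMap_disp, toHomeo_ofDisp])

theorem coe_eq_coe_iff {a c : ℝ} : (a : UnitAddCircle) = (c : UnitAddCircle) ↔ a - c = (⌊a - c⌋ : ℤ) := by
  rw [← sub_eq_zero, ← AddCircle.coe_sub, AddCircle.coe_eq_zero_iff]
  constructor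
  · rintro ⟨n, hn⟩
    rw [← hn]; simp
  · intro h
    exact ⟨⌊a - c⌋, by simpa using h.symm⟩

theorem toMap_zero (u : Hq q) : u.toMap 0 = ((u 0 : ℝ) : UnitAddCircle) := by simp [Hq.toMap]

open Classical in
/-- The diffeomorphism `x ↦ x + u(x)`, with junk value the identity if `1 + u_x > 0` fails. -/
noncomputable def ofDisp' (u : Hq q) : Dq q :=
  if hu : u.IsDisplacement then ofDisp u hu
  else ofDisp 0 (by intro x; simp [Hq.deriv, map_zero])

theorem ofDisp'_eq {u : Hq q} (hu : u.IsDisplacement) : ofDisp' u = ofDisp u hu := dif_pos hu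

theorem coe_ne_iff_normalize {c : ℝ} {u : Hq q} :
    u.toMap 0 ≠ (c : UnitAddCircle) ↔ normalize c u 0 ∈ Set.Ioo c (c + 1) := by
  have h := normalize_zero_mem c u
  rw [toMap_zero, Ne, coe_eq_coe_iff]
  have e : normalize c u 0 = u 0 - (⌊u 0 - c⌋ : ℤ) := by simp [normalize]
  constructor
  · intro hne
    refine ⟨lt_of_le_of_ne h.1 fun heq ↦ hne ?_, h.2⟩
    linarith
  · rintro ⟨h1, -⟩ heq
    linarith

theorem normalize_of_mem {c : ℝ} {u : Hq q} (h : u 0 ∈ Set.Ioo c (c + 1)) : normalize c u = u := by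
  have : ⌊u 0 - c⌋ = 0 := Int.floor_eq_zero_iff.mpr ⟨by linarith [h.1], by linarith [h.2]⟩
  refine Hq.ext fun x ↦ ?_
  simp [normalize, this]

/-- The chart of `D^q` whose domain is the set of `φ` with `φ(0) ≠ c`: it sends `φ` to the
displacement `u ∈ H^q` with `φ(x) = x + u(x)` and `c < u(0) < c + 1`. -/
noncomputable def chart (c : ℝ) : PartialEquiv (Dq q) (Hq q) where
  toFun φ := normalize c φ.disp
  invFun := ofDisp'
  source := {φ | φ.toHomeo 0 ≠ (c : UnitAddCircle)}
  target := {u | u.IsDisplacement ∧ u 0 ∈ Set.Ioo c (c + 1)}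
  map_source' φ hφ := by
    refine ⟨isDisplacement_normalize φ.isDisplacement_disp c, coe_ne_iff_normalize.mp ?_⟩
    rw [toMap_disp]; exact hφ
  map_target' u hu := by
    change (ofDisp' u).toHomeo 0 ≠ _
    rw [ofDisp'_eq hu.1, toHomeo_ofDisp, coe_ne_iff_normalize, normalize_of_mem hu.2]
    exact hu.2
  left_inv' φ hφ := by
    rw [ofDisp'_eq (isDisplacement_normalize φ.isDisplacement_disp c)]
    refine ext fun x ↦ ?_
    rw [toHomeo_ofDisp, ← toMap_disp, toMap_normalize]
  right_inv' u hu := by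
    rw [ofDisp'_eq hu.1, normalize_disp_ofDisp, normalize_of_mem hu.2]

theorem continuous_eval (x : UnitAddCircle) : Continuous fun u : Hq q ↦ u x := by
  let L : Hq q →ₗ[ℝ] ℝ :=
    { toFun := fun u ↦ u x, map_add' := fun _ _ ↦ rfl, map_smul' := fun _ _ ↦ rfl }
  exact AddMonoidHomClass.continuous_of_bound L _
    fun u ↦ Hq.abs_apply_le u (by have := hqInstFact (q := q); linarith) x

theorem trans_source (c c' : ℝ) : ((chart c).symm.trans (chart c') : PartialEquiv (Hq q) (Hq q)).source =
    {u | u.IsDisplacement ∧ u 0 ∈ Set.Ioo c (c + 1) ∧ ((u 0 : ℝ) : UnitAddCircle) ≠ c'} := by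
  ext u
  simp only [PartialEquiv.trans_source, PartialEquiv.symm_source, Set.mem_inter_iff,
    Set.mem_preimage, Set.mem_ofPred_eq]
  rw [← and_assoc]
  refine and_congr_right fun hu ↦ ?_
  change (ofDisp' u).toHomeo 0 ≠ _ ↔ _
  rw [ofDisp'_eq hu.1, toHomeo_ofDisp, toMap_zero]

theorem isOpen_trans_source (c c' : ℝ) :
    IsOpen ((chart c).symm.trans (chart c') : PartialEquiv (Hq q) (Hq q)).source := by
  rw [trans_source]
  refine (Hq.isOpen_isDisplacement hqInstFact).inter ((isOpen_Ioo.preimage (continuous_eval 0)).inter ?_)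
  exact isOpen_ne.preimage ((AddCircle.continuous_mk' 1).comp (continuous_eval 0))

theorem trans_apply (c c' : ℝ) {u : Hq q} (hu : u ∈ ((chart c).symm.trans (chart c') : PartialEquiv (Hq q) (Hq q)).source) :
    ((chart c).symm.trans (chart c') : PartialEquiv (Hq q) (Hq q)) u = normalize c' u := by
  rw [trans_source] at hu
  change normalize c' (ofDisp' u).disp = _
  rw [ofDisp'_eq hu.1, normalize_disp_ofDisp]

/-- On overlaps the transition maps are locally translations by an integer constant. -/
theorem trans_eventuallyEq (c c' : ℝ) {u : Hq q}
    (hu : u ∈ ((chart c).symm.trans (chart c') : PartialEquiv (Hq q) (Hq q)).source) :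
    ((chart c).symm.trans (chart c') : PartialEquiv (Hq q) (Hq q)) =ᶠ[nhds u]
      fun v ↦ v - Hq.const ((⌊u 0 - c'⌋ : ℤ) : ℝ) := by
  have h1 : ∀ᶠ v in nhds u, v ∈ ((chart c).symm.trans (chart c') : PartialEquiv (Hq q) (Hq q)).source :=
    (isOpen_trans_source c c').mem_nhds hu
  have hu2 := hu
  rw [trans_source] at hu2
  have hne : u 0 - c' ≠ (⌊u 0 - c'⌋ : ℤ) := fun h ↦ hu2.2.2 (coe_eq_coe_iff.mpr h)
  have hlt : (⌊u 0 - c'⌋ : ℝ) < u 0 - c' := lt_of_le_of_ne (Int.floor_le _) hne.symm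
  have hcont : Continuous fun v : Hq q ↦ v 0 - c' := (continuous_eval 0).sub continuous_const
  have h2 : ∀ᶠ v : Hq q in nhds u, v 0 - c' ∈ Set.Ioo (⌊u 0 - c'⌋ : ℝ) (⌊u 0 - c'⌋ + 1) :=
    hcont.continuousAt.eventually (isOpen_Ioo.mem_nhds ⟨hlt, Int.lt_floor_add_one _⟩)
  filter_upwards [h1, h2] with v hv1 hv2
  rw [trans_apply c c' hv1, normalize]
  rw [Int.floor_eq_iff.mpr ⟨hv2.1.le, hv2.2⟩]

theorem contDiffOn_trans (c c' : ℝ) {n : ℕ∞ω} :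
    ContDiffOn ℝ n ((chart c).symm.trans (chart c') : PartialEquiv (Hq q) (Hq q))
      ((chart c).symm.trans (chart c') : PartialEquiv (Hq q) (Hq q)).source := fun u hu ↦
  (ContDiffAt.congr_of_eventuallyEq (by fun_prop) (trans_eventuallyEq c c' hu)).contDiffWithinAt

theorem mem_chart_source (φ : Dq q) : φ ∈ (chart (φ.disp 0 - 1 / 2)).source := by
  change φ.toHomeo 0 ≠ _
  rw [← toMap_disp, toMap_zero, Ne, coe_eq_coe_iff]
  have : ⌊φ.disp 0 - (φ.disp 0 - 1 / 2)⌋ = 0 := by rw [Int.floor_eq_zero_iff]; constructor <;> linarith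
  rw [this]
  norm_num

/-- The Hilbert manifold structure of `D^q`: the open set `{u ∈ H^q | 1 + u_x > 0}` of `H^q`
modulo the translations by integers. -/
noncomputable def chartedSpaceCore (q : ℝ) [Fact (3 / 2 < q)] : ChartedSpaceCore (Hq q) (Dq q) where
  atlas := Set.range chart
  chartAt φ := chart (φ.disp 0 - 1 / 2)
  mem_chart_source := mem_chart_source
  chart_mem_atlas φ := ⟨_, rfl⟩
  open_source := by
    rintro _ _ ⟨c, rfl⟩ ⟨c', rfl⟩
    exact isOpen_trans_source c c'
  continuousOn_toFun := by
    rintro _ _ ⟨c, rfl⟩ ⟨c', rfl⟩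
    exact (contDiffOn_trans c c' (n := 0)).continuousOn

noncomputable instance : TopologicalSpace (Dq q) := (chartedSpaceCore q).toTopologicalSpace

noncomputable instance : ChartedSpace (Hq q) (Dq q) := (chartedSpaceCore q).toChartedSpace

theorem mem_atlas {e : OpenPartialHomeomorph (Dq q) (Hq q)} (he : e ∈ atlas (Hq q) (Dq q)) :
    ∃ c, e.toPartialEquiv = chart c := by
  change e ∈ ⋃ (e' : PartialEquiv (Dq q) (Hq q)) (he' : e' ∈ (chartedSpaceCore q).atlas),
    {(chartedSpaceCore q).openPartialHomeomorph e' he'} at he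
  simp only [Set.mem_iUnion, Set.mem_singleton_iff] at he
  obtain ⟨e', ⟨c, rfl⟩, rfl⟩ := he
  exact ⟨c, rfl⟩

instance : IsManifold 𝓘(ℝ, Hq q) ∞ (Dq q) := by
  refine isManifold_of_contDiffOn _ _ _ fun e e' he he' ↦ ?_
  obtain ⟨c, hc⟩ := mem_atlas he
  obtain ⟨c', hc'⟩ := mem_atlas he'
  have := contDiffOn_trans (q := q) c c' (n := ∞)
  rw [← hc, ← hc'] at this
  simpa using this

instance : T2Space (Dq q) := by
  refine ⟨fun φ ψ hne ↦ ?_⟩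
  obtain ⟨c, hc⟩ : ∃ c : UnitAddCircle, c ∉ ({φ.toHomeo 0, ψ.toHomeo 0} : Set UnitAddCircle) := by
    by_contra! h
    have h4 : (Set.univ : Set UnitAddCircle).Finite :=
      (Set.toFinite {φ.toHomeo 0, ψ.toHomeo 0}).subset fun c _ ↦ h c
    have h3 : (Set.Ico (0 : ℝ) (0 + 1)).Finite :=
      Set.Finite.of_finite_image (f := fun x : ℝ ↦ (x : UnitAddCircle)) (h4.subset (Set.subset_univ _))
        (fun a ha b hb hab ↦ (AddCircle.coe_eq_coe_iff_of_mem_Ico ha hb).mp hab)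
    exact (Set.Ico_infinite (by norm_num)) h3
  induction c using QuotientAddGroup.induction_on with | H c => ?_
  simp only [Set.mem_insert_iff, Set.mem_singleton_iff, not_or] at hc
  let e := (chartedSpaceCore q).openPartialHomeomorph (chart c) ⟨c, rfl⟩
  have hφ : φ ∈ e.source := fun h ↦ hc.1 h.symm
  have hψ : ψ ∈ e.source := fun h ↦ hc.2 h.symm
  obtain ⟨U, V, hU, hV, h1, h2, hUV⟩ := t2_separation fun h ↦ hne (e.injOn hφ hψ h)
  refine ⟨e.source ∩ e ⁻¹' U, e.source ∩ e ⁻¹' V, e.isOpen_inter_preimage hU,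
    e.isOpen_inter_preimage hV, ⟨hφ, h1⟩, ⟨hψ, h2⟩, ?_⟩
  exact (hUV.preimage e).mono Set.inter_subset_right Set.inter_subset_right

theorem eventually_isDisplacement (u η : Hq q) (hu : u.IsDisplacement) :
    ∀ᶠ t : ℝ in nhds 0, (u + t • η).IsDisplacement := by
  have hc : ContinuousAt (fun t : ℝ ↦ u + t • η) 0 := by fun_prop
  exact hc.eventually ((Hq.isOpen_isDisplacement hqInstFact).mem_nhds (by simpa using hu))

/-- In the preferred chart at `φ`, the curve `t ↦ (x ↦ φ(x) + t η(x))` has velocity `η` at `t = 0`. -/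
theorem hasDerivAt_curve (φ : Dq q) (η : Hq q) :
    HasDerivAt (fun t : ℝ ↦ chartAt (Hq q) φ (ofDisp' (φ.disp + t • η))) η 0 := by
  have h : HasDerivAt (fun t : ℝ ↦ φ.disp + t • η) η 0 := by
    simpa using ((hasDerivAt_id (0 : ℝ)).smul_const η).const_add φ.disp
  refine h.congr_of_eventuallyEq ?_
  have hc : Continuous fun t : ℝ ↦ (φ.disp + t • η) 0 :=
    (continuous_eval 0).comp (by fun_prop : Continuous fun t : ℝ ↦ φ.disp + t • η)
  have h2 : ∀ᶠ t : ℝ in nhds 0, (φ.disp + t • η) 0 ∈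
      Set.Ioo (φ.disp 0 - 1 / 2) (φ.disp 0 - 1 / 2 + 1) :=
    hc.continuousAt.eventually (isOpen_Ioo.mem_nhds (by
      simp only [zero_smul, add_zero]; constructor <;> linarith))
  filter_upwards [eventually_isDisplacement φ.disp η φ.isDisplacement_disp, h2] with t h1 h2
  change normalize (φ.disp 0 - 1 / 2) (ofDisp' _).disp = _
  rw [ofDisp'_eq h1, normalize_disp_ofDisp, normalize_of_mem h2]

/-- The tangent vector at `φ` given by `η ∈ H^q`, under the parallelization
`T D^q ≅ D^q × H^q`: the velocity at `t = 0` of the curve `t ↦ (x ↦ φ(x) + t η(x))`.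
Mathlib's tangent space at `φ` is a copy of the model space, through the preferred chart at `φ`;
by `hasDerivAt_curve` this velocity is then `η` itself. -/
def tangentVector (φ : Dq q) (η : Hq q) : TangentSpace 𝓘(ℝ, Hq q) φ := η

end Dq

/-- The group `Diff^∞(S¹)` of smooth orientation preserving diffeomorphisms of the circle:
the homeomorphisms `x ↦ x + u(x)` with `u ∈ C^∞(S¹)` and `1 + u' > 0`. -/
def DiffS1 : Type :=
  {φ : UnitAddCircle ≃ₜ UnitAddCircle // ∃ u : SmoothFn,
    (∀ x : ℝ, 0 < 1 + deriv (fun y : ℝ ↦ u (y : UnitAddCircle)) x) ∧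
    ∀ x, φ x = x + ((u x : ℝ) : UnitAddCircle)}

namespace DiffS1

/-- The underlying homeomorphism of the circle. -/
def toHomeo (φ : DiffS1) : UnitAddCircle ≃ₜ UnitAddCircle := φ.1

theorem isHqDiffeo (q : ℝ) (φ : DiffS1) : IsHqDiffeo q φ.toHomeo := by
  obtain ⟨u, hu, hφ⟩ := φ.2
  exact ⟨u.toHq q, hu, hφ⟩

/-- The inclusion of `Diff^∞(S¹)` in `D^q`. -/
def toDq (q : ℝ) (φ : DiffS1) : Dq q := ⟨φ.toHomeo, φ.isHqDiffeo q⟩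

end DiffS1

/-- The Fourier multiplier `Λ^{2s} = op((1 + k²)^s)`: `(Λ^{2s} f)(x) = ∑ₖ (1 + k²)^s f̂(k) e_k(x)`. -/
noncomputable def lambdaOp (s : ℝ) (f : UnitAddCircle → ℝ) (x : UnitAddCircle) : ℂ :=
  ∑' k : ℤ, (sobolevWeight s k : ℂ) * fourierHat f k * fourier k x

/-- The right-invariant inner product
`⟨η, ξ⟩_φ = ∫_{S¹} (Λ^{2s} (η ∘ φ⁻¹)) (ξ ∘ φ⁻¹) dx` (as a complex number, since the Fourier series
defining `Λ^{2s}` is a complex series; its value is real). -/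
noncomputable def rightInvariantHs (s : ℝ) (φ : UnitAddCircle ≃ₜ UnitAddCircle)
    (η ξ : UnitAddCircle → ℝ) : ℂ :=
  ∫ x : UnitAddCircle, lambdaOp s (fun y ↦ η (φ.symm y)) x * ((ξ (φ.symm x) : ℝ) : ℂ)

/-- A smooth weak Riemannian metric on a manifold `M` modelled on a normed space `E`: a smooth field
of bounded, symmetric, positive definite bilinear forms on the tangent spaces. (That the forms define
the topology of the tangent spaces is not required, in contrast to a strong metric.) -/
structure WeakRiemannianMetric (E : Type*) [NormedAddCommGroup E] [NormedSpace ℝ E]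
    (M : Type*) [TopologicalSpace M] [ChartedSpace E M] [IsManifold 𝓘(ℝ, E) ∞ M] where
  /-- The bilinear form on the tangent space at `x`. -/
  inner (x : M) : TangentSpace 𝓘(ℝ, E) x →L[ℝ] TangentSpace 𝓘(ℝ, E) x →L[ℝ] ℝ
  symm (x : M) (v w : TangentSpace 𝓘(ℝ, E) x) : inner x v w = inner x w v
  pos (x : M) (v : TangentSpace 𝓘(ℝ, E) x) (hv : v ≠ 0) : 0 < inner x v v
  contMDiff : ContMDiff 𝓘(ℝ, E) (𝓘(ℝ, E).prod 𝓘(ℝ, E →L[ℝ] E →L[ℝ] ℝ)) ∞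
    (fun x : M ↦ Bundle.TotalSpace.mk' (E →L[ℝ] E →L[ℝ] ℝ)
      (E := fun x : M ↦ TangentSpace 𝓘(ℝ, E) x →L[ℝ] TangentSpace 𝓘(ℝ, E) x →L[ℝ] ℝ)
      x (inner x))

section
variable {E : Type*} [NormedAddCommGroup E] [NormedSpace ℝ E]
  {M : Type*} [TopologicalSpace M] [ChartedSpace E M] [IsManifold 𝓘(ℝ, E) ∞ M]

/-- The local expression `y ↦ g(y) ∈ L²(E; ℝ)` of the metric in the preferred chart at `x₀`. -/
noncomputable def WeakRiemannianMetric.inChart (g : WeakRiemannianMetric E M) (x₀ : M) (y : E) :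
    E →L[ℝ] E →L[ℝ] ℝ :=
  let T : E →L[ℝ] E := mfderiv 𝓘(ℝ, E) 𝓘(ℝ, E) (chartAt E x₀).symm y
  let G : E →L[ℝ] E →L[ℝ] ℝ := g.inner ((chartAt E x₀).symm y)
  G.bilinearComp T T

/-- A vector field on the tangent bundle `TM` is smooth, as a section of `T(TM)`. -/
def IsSmoothVectorField
    (F : (p : TangentBundle 𝓘(ℝ, E) M) → TangentSpace 𝓘(ℝ, E).tangent p) : Prop :=
  ContMDiff 𝓘(ℝ, E).tangent 𝓘(ℝ, E).tangent.tangent ∞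
    (fun p ↦ (⟨p, F p⟩ : TangentBundle 𝓘(ℝ, E).tangent (TangentBundle 𝓘(ℝ, E) M)))

/-- The vector field `F` on `TM` is the geodesic spray of `g`: in each chart it reads
`F(y, v) = (v, -Γ_y(v, v))`, where the bounded bilinear map `Γ_y` is the Christoffel map,
`2 g(y)(Γ_y(u, v), w) = d_y g·u (v, w) + d_y g·v (u, w) - d_y g·w (u, v)`.
The chart of `TM` used here is the one induced by the preferred chart of `M` at `x₀`. -/
def WeakRiemannianMetric.IsGeodesicSpray (g : WeakRiemannianMetric E M)
    (F : (p : TangentBundle 𝓘(ℝ, E) M) → TangentSpace 𝓘(ℝ, E).tangent p) : Prop :=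
  ∀ (x₀ : M) (y : E), y ∈ (chartAt E x₀).target →
    ∃ Γ : E →L[ℝ] E →L[ℝ] E, 
      (∀ u v w : E, 2 * g.inChart x₀ y (Γ u v) w =
        fderiv ℝ (g.inChart x₀) y u v w + fderiv ℝ (g.inChart x₀) y v u w
          - fderiv ℝ (g.inChart x₀) y w u v) ∧
      ∀ p : TangentBundle 𝓘(ℝ, E) M, ∀ v : E,
        p.proj ∈ (chartAt E x₀).source → 
        extChartAt 𝓘(ℝ, E).tangent (⟨x₀, 0⟩ : TangentBundle 𝓘(ℝ, E) M) p = (y, v) →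
        mfderiv 𝓘(ℝ, E).tangent 𝓘(ℝ, E × E)
          (extChartAt 𝓘(ℝ, E).tangent (⟨x₀, 0⟩ : TangentBundle 𝓘(ℝ, E) M)) p (F p)
          = ((v, - Γ v v) : E × E)
end

/-! Write `φ = id + y` and `R_φ v = v ∘ φ`. A change of variables gives `g_φ(η, ξ) = ∫ (1 + y_x)
(A_φ η) ξ dx` with `A_φ = R_φ Λ^{2s} R_φ⁻¹` (`metricForm`, `inertia`). The heart of the matter is
that `φ ↦ A_φ` is smooth into the bounded operators `H^q → H^{q-2s}`, although `φ ↦ R_φ` is not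
smooth into operators.

Near the identity `A_φ` is a convergent power series (`exists_expansion`). Write `Λ^{2s} - 1` as the
multiplier `b(k) = ((1 + k²)^s - 1) / (2πik)` applied to the derivative. Conjugation by `φ = id + u`
inserts `exp(2πik(u(x) - u(y)))` into its kernel; the `n`-th Taylor term is `1/n!` times a Fourier
operator, multilinear in `u, …, u, v_x`, whose symbol is the `n`-fold finite difference of
`b(k)(2πik)^n` (`kernelSum_eq_multiSum`, `hasSum_conjugation`). Cauchy's estimate on discs of radius
proportional to `1 + |ξ|`, followed by the mean value inequality, bounds this symbol by `n! C^n ∏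
|jᵢ|` times the power `2s - 1` of the total frequency (`symbolBound_fdiff`). Each `u` thus loses a
single derivative, the `n!` cancels, and Young's inequality gives a geometric bound
(`exists_multiOp`). A Gaussian cutoff justifies the interchanges and is removed by dominated
convergence.

At another point `φ₀` one conjugates by the fixed operator `R_{φ₀}` (`contDiffAt_inertia`). This
needs `R_{φ₀}` to be an isomorphism of `H^σ`, `1/2 < σ ≤ q`: interpolation between `L²` and `H²`,
then induction on derivatives (`Hq.comp_mem`), and a bootstrap for `φ₀⁻¹`
(`Hq.exists_inverse_displacement`).

The metric is weak, so the existence of the Christoffel map is not automatic. Varying the metric in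
direction `w` gives an expression in which `w` is not differentiated, `D_w g(u, v) = -∫ (v_x A u +
u_x A v) w` (`fderiv_metricForm`). The Koszul formula then becomes `A Γ(u, v) = ½ (DA[u] v + DA[v]
u) + (u_x A v + v_x A u) / (1 + y_x)`. Both `A` and multiplication by `1 + y_x` are isomorphisms
depending smoothly on `y`, hence `Γ` is smooth with values in `H^q`.

All these objects are invariant under integer translations of the displacement, and the charts of
`D^q` differ locally by such translations, so the formulas descend to `D^q` and its tangent bundle.
-/

section
open scoped Manifold ContDiff
attribute [-instance] Hq.instModuleReal Hq.instAddCommGroup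

open MeasureTheory Filter Topology
open scoped ENNReal NNReal

/-! ### Convolution of nonnegative sequences on `ℤ` -/

section Sequences

theorem ENNReal.mul_le_sq_add_sq (x y : ℝ≥0∞) : x * y ≤ x ^ 2 + y ^ 2 := by
  rcases le_total x y with h | h
  · exact (mul_le_mul_left h y).trans (by rw [sq y]; exact le_add_self)
  · exact (mul_le_mul_right h x).trans (by rw [sq x]; exact le_self_add)

theorem ENNReal.add_sq_le (x y : ℝ≥0∞) : (x + y) ^ 2 ≤ 4 * (x ^ 2 + y ^ 2) := by
  have : (x + y) ^ 2 = x ^ 2 + y ^ 2 + 2 * (x * y) := by ring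
  rw [this]
  calc x ^ 2 + y ^ 2 + 2 * (x * y) ≤ x ^ 2 + y ^ 2 + 2 * (x ^ 2 + y ^ 2) := by
        gcongr; exact ENNReal.mul_le_sq_add_sq x y
    _ = 3 * (x ^ 2 + y ^ 2) := by ring
    _ ≤ 4 * (x ^ 2 + y ^ 2) := by gcongr; norm_num

/-- Cauchy–Schwarz with respect to the weights `a`, with a lossy factor `2`: expand the square into
a double sum and bound each `xᵢ xⱼ` by `xᵢ² + xⱼ²`. Working in `ℝ≥0∞` avoids all summability
hypotheses. -/
theorem ENNReal.tsum_mul_sq_le {ι : Type*} (a x : ι → ℝ≥0∞) :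
    (∑' j, a j * x j) ^ 2 ≤ 2 * ((∑' j, a j) * ∑' j, a j * x j ^ 2) := by
  calc (∑' j, a j * x j) ^ 2 = ∑' i, ∑' j, a i * a j * (x i * x j) := by
        rw [sq, ← ENNReal.tsum_mul_right]
        refine tsum_congr fun i ↦ ?_
        rw [← ENNReal.tsum_mul_left]
        exact tsum_congr fun j ↦ by ring
    _ ≤ ∑' i, ∑' j, a i * a j * (x i ^ 2 + x j ^ 2) := by
        gcongr with i j
        exact ENNReal.mul_le_sq_add_sq _ _
    _ = ∑' i, ∑' j, (a i * x i ^ 2 * a j + a i * (a j * x j ^ 2)) := by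
        refine tsum_congr fun i ↦ tsum_congr fun j ↦ by ring
    _ = 2 * ((∑' j, a j) * ∑' j, a j * x j ^ 2) := by
        simp_rw [ENNReal.tsum_add, ENNReal.tsum_mul_left, ENNReal.tsum_mul_right]
        ring

/-- The convolution of nonnegative sequences on `ℤ`. -/
noncomputable def econv (a b : ℤ → ℝ≥0∞) (k : ℤ) : ℝ≥0∞ := ∑' j, a j * b (k - j)

theorem econv_comm (a b : ℤ → ℝ≥0∞) : econv a b = econv b a := by
  funext k
  unfold econv
  rw [← (Equiv.subLeft k).tsum_eq]
  refine tsum_congr fun j ↦ ?_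
  simp [mul_comm]

theorem tsum_econv (a b : ℤ → ℝ≥0∞) : ∑' k, econv a b k = (∑' k, a k) * ∑' k, b k := by
  unfold econv
  rw [ENNReal.tsum_comm, ← ENNReal.tsum_mul_right]
  refine tsum_congr fun j ↦ ?_
  rw [ENNReal.tsum_mul_left]
  exact congrArg _ ((Equiv.subRight j).tsum_eq b)

/-- Young's inequality `ℓ¹ * ℓ² ⊆ ℓ²`: Cauchy–Schwarz in the weights `a j` for each `k`, then
summation over `k` of the convolution of `a` with `b²`. -/
theorem tsum_econv_sq_le (a b : ℤ → ℝ≥0∞) :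
    ∑' k, econv a b k ^ 2 ≤ 2 * ((∑' k, a k) ^ 2 * ∑' k, b k ^ 2) := by
  calc ∑' k, econv a b k ^ 2 ≤ ∑' k, 2 * ((∑' j, a j) * ∑' j, a j * b (k - j) ^ 2) :=
        ENNReal.tsum_le_tsum fun k ↦ ENNReal.tsum_mul_sq_le _ _
    _ = 2 * ((∑' j, a j) * ∑' k, econv a (fun k ↦ b k ^ 2) k) := by
        rw [ENNReal.tsum_mul_left, ENNReal.tsum_mul_left]; rfl
    _ = _ := by rw [tsum_econv]; ring

end Sequences

/-! ### Sobolev weights and norms as extended sums -/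

section Weights

theorem sobolevWeight_mono {a b : ℝ} (h : a ≤ b) (k : ℤ) : sobolevWeight a k ≤ sobolevWeight b k :=
  Real.rpow_le_rpow_of_exponent_le (by nlinarith [sq_nonneg (k : ℝ)]) h

theorem one_le_sobolevWeight {a : ℝ} (h : 0 ≤ a) (k : ℤ) : 1 ≤ sobolevWeight a k := by
  simpa [sobolevWeight] using sobolevWeight_mono h k

theorem sobolevWeight_neg_int (a : ℝ) (k : ℤ) : sobolevWeight a (-k) = sobolevWeight a k := by
  simp [sobolevWeight]

/-- The larger of `|j|` and `|k|` controls `|j + k|` up to a factor `2`, and squaring that factor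
gives the `4`. -/
theorem sobolevWeight_add_le {a : ℝ} (ha : 0 ≤ a) (j k : ℤ) :
    sobolevWeight a (j + k) ≤ 4 ^ a * (sobolevWeight a j + sobolevWeight a k) := by
  have h : ∀ x y : ℝ, x ^ 2 ≤ y ^ 2 → (1 + (x + y) ^ 2) ^ a ≤ 4 ^ a * (1 + y ^ 2) ^ a := by
    intro x y hxy
    rw [← Real.mul_rpow (by norm_num) (by positivity)]
    exact Real.rpow_le_rpow (by positivity) (by nlinarith [sq_nonneg (x - y)]) ha
  have p1 := sobolevWeight_pos a j
  have p2 := sobolevWeight_pos a k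
  have p3 : (0 : ℝ) < 4 ^ a := by positivity
  rcases le_total ((j : ℝ) ^ 2) ((k : ℝ) ^ 2) with hjk | hjk
  · have := h _ _ hjk
    simp only [sobolevWeight] at *
    push_cast
    nlinarith
  · have := h _ _ hjk
    simp only [sobolevWeight] at *
    push_cast
    rw [add_comm (j : ℝ)]
    nlinarith

/-- `(1 + k²)^t` as an extended nonnegative number. -/
noncomputable def eWeight (t : ℝ) (k : ℤ) : ℝ≥0∞ := ENNReal.ofReal (sobolevWeight t k)

/-- `|û(k)|` as an extended nonnegative number. -/
noncomputable def eCoeff (u : UnitAddCircle → ℝ) (k : ℤ) : ℝ≥0∞ := ‖fourierHat u k‖ₑ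

theorem ofReal_weighted_sq (q : ℝ) (u : UnitAddCircle → ℝ) (k : ℤ) :
    ENNReal.ofReal (sobolevWeight q k * ‖fourierHat u k‖ ^ 2) = (eWeight (q / 2) k * eCoeff u k) ^ 2 := by
  rw [eWeight, eCoeff, ← ofReal_norm, ← ENNReal.ofReal_mul (sobolevWeight_pos _ _).le,
    ← ENNReal.ofReal_pow (mul_nonneg (sobolevWeight_pos _ _).le (norm_nonneg _)), mul_pow,
    Hq.weight_half_sq]

theorem summable_iff_tsum_ofReal_ne_top {ι : Type*} {f : ι → ℝ} (hf : ∀ i, 0 ≤ f i) :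
    Summable f ↔ ∑' i, ENNReal.ofReal (f i) ≠ ⊤ := by
  constructor
  · exact fun h ↦ h.tsum_ofReal_ne_top
  · intro h
    have := ENNReal.summable_toReal h
    exact this.congr fun i ↦ ENNReal.toReal_ofReal (hf i)

/-- Membership in `H^q` as finiteness of an `ℝ≥0∞`-valued sum, the form in which the convolution
estimates apply. -/
theorem mem_hqSubmodule_iff {q : ℝ} {u : C(UnitAddCircle, ℝ)} :
    u ∈ hqSubmodule q ↔ ∑' k, (eWeight (q / 2) k * eCoeff u k) ^ 2 ≠ ⊤ := by
  simp_rw [← ofReal_weighted_sq]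
  exact summable_iff_tsum_ofReal_ne_top fun k ↦ mul_nonneg (sobolevWeight_pos _ _).le (sq_nonneg _)

theorem Hq.tsum_eq_norm_sq {q : ℝ} (u : Hq q) :
    ∑' k, (eWeight (q / 2) k * eCoeff u k) ^ 2 = ENNReal.ofReal ‖u‖ ^ 2 := by
  simp_rw [← ofReal_weighted_sq]
  rw [← ENNReal.ofReal_pow (norm_nonneg _), u.norm_sq_eq, ENNReal.ofReal_tsum_of_nonneg _ u.summable]
  exact fun k ↦ mul_nonneg (sobolevWeight_pos _ _).le (sq_nonneg _)

theorem Hq.tsum_weight_le {q : ℝ} (u : Hq q) {t : ℝ} (ht : t < q / 2 - 1 / 4) :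
    ∑' k, eWeight t k * eCoeff u k ≤
      ENNReal.ofReal (√(∑' k, sobolevWeight (2 * t - q) k)) * ENNReal.ofReal ‖u‖ := by
  have h := u.summable_weight_mul ht
  rw [← ENNReal.ofReal_mul (Real.sqrt_nonneg _)]
  refine le_trans (le_of_eq ?_) (ENNReal.ofReal_le_ofReal h.2)
  rw [ENNReal.ofReal_tsum_of_nonneg (fun k ↦ mul_nonneg (sobolevWeight_pos _ _).le (norm_nonneg _)) h.1]
  refine tsum_congr fun k ↦ ?_
  rw [ENNReal.ofReal_mul (sobolevWeight_pos _ _).le, ofReal_norm]; rfl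

theorem eWeight_zero (k : ℤ) : eWeight 0 k = 1 := by simp [eWeight, sobolevWeight]

theorem eWeight_mono {a b : ℝ} (h : a ≤ b) (k : ℤ) : eWeight a k ≤ eWeight b k :=
  ENNReal.ofReal_le_ofReal (sobolevWeight_mono h k)

theorem eWeight_add_le {a : ℝ} (ha : 0 ≤ a) (j k : ℤ) :
    eWeight a (j + k) ≤ ENNReal.ofReal (4 ^ a) * (eWeight a j + eWeight a k) := by
  rw [eWeight, eWeight, eWeight, ← ENNReal.ofReal_add (sobolevWeight_pos _ _).le (sobolevWeight_pos _ _).le,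
    ← ENNReal.ofReal_mul (by positivity)]
  exact ENNReal.ofReal_le_ofReal (sobolevWeight_add_le ha j k)

theorem Hq.tsum_eCoeff_ne_top {q : ℝ} (hq : 1 / 2 < q) (u : Hq q) : ∑' k, eCoeff u k ≠ ⊤ := by
  have := u.tsum_weight_le (t := 0) (by linarith)
  simp only [eWeight_zero, one_mul] at this
  exact ne_top_of_le_ne_top (by finiteness) this

end Weights

/-! ### Fourier coefficients of products, and Parseval's identity -/

section Fourier

/-- Fourier coefficients of a product, the first factor having an absolutely convergent Fourier series. -/
theorem integral_fourierSeries_mul {c : ℤ → ℂ} (hc : Summable fun k ↦ ‖c k‖) {g : UnitAddCircle → ℂ}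
    (hg : Continuous g) :
    ∫ x, (∑' k, c k * fourier k x) * g x ∂AddCircle.haarAddCircle =
      ∑' k, c k * fourierCoeff g (-k) := by
  obtain ⟨B, hB⟩ := (isCompact_univ (X := UnitAddCircle)).exists_bound_of_continuousOn hg.continuousOn
  have hB' : ∀ x, ‖g x‖ ≤ B := fun x ↦ hB x trivial
  have hB0 : 0 ≤ B := (norm_nonneg _).trans (hB' 0)
  have e : ∀ x, (∑' k, c k * fourier k x) * g x = ∑' k, c k * (fourier k x * g x) := fun x ↦ by
    rw [← tsum_mul_right]; exact tsum_congr fun k ↦ by ring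
  simp_rw [e]
  have hcont : ∀ k, Continuous fun x : UnitAddCircle ↦ c k * (fourier k x * g x) := fun k ↦ by fun_prop
  rw [← integral_tsum_of_summable_integral_norm
    (fun k ↦ (hcont k).integrable_of_hasCompactSupport (HasCompactSupport.of_compactSpace _))]
  · refine tsum_congr fun k ↦ ?_
    rw [integral_const_mul, fourierCoeff, neg_neg]
    rfl
  · refine Summable.of_nonneg_of_le (fun k ↦ by positivity) (fun k ↦ ?_) (hc.mul_right B)
    have h1 : ‖∫ x, ‖c k * (fourier k x * g x)‖ ∂AddCircle.haarAddCircle‖ ≤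
        ‖c k‖ * B * (AddCircle.haarAddCircle (T := 1)).real Set.univ :=
      norm_integral_le_of_norm_le_const (Eventually.of_forall fun x ↦ ?_)
    · rw [probReal_univ, mul_one] at h1
      exact (le_abs_self _).trans h1
    · rw [norm_norm, norm_mul, norm_mul, fourier_apply, Circle.norm_coe, one_mul]
      gcongr
      exact hB' x

theorem Hq.summable_norm_coeff {q : ℝ} (hq : 1 / 2 < q) (u : Hq q) :
    Summable fun k ↦ ‖fourierHat u k‖ := by
  have h := (u.summable_weight_mul (t := 0) (by linarith)).1
  simpa only [sobolevWeight, Real.rpow_zero, one_mul] using h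

theorem Hq.fourierHat_mul {q : ℝ} (hq : 1 / 2 < q) (u : Hq q) (v : C(UnitAddCircle, ℝ)) (k : ℤ) :
    fourierHat (toC u * v : C(UnitAddCircle, ℝ)) k = ∑' j, fourierHat u j * fourierHat v (k - j) := by
  have h := integral_fourierSeries_mul (u.summable_norm_coeff hq)
    (g := fun x ↦ fourier (-k) x * (v x : ℂ)) (by fun_prop)
  have e : ∀ j, fourierCoeff (fun x : UnitAddCircle ↦ fourier (-k) x * (v x : ℂ)) (-j) =
      fourierHat v (k - j) := fun j ↦ by
    unfold fourierHat fourierCoeff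
    refine integral_congr_ae (Eventually.of_forall fun x ↦ ?_)
    simp only [smul_eq_mul, neg_neg, ← mul_assoc, ← fourier_add]
    congr 2; ring_nf
  simp_rw [e] at h
  rw [← h]
  refine integral_congr_ae (Eventually.of_forall fun x ↦ ?_)
  simp only [smul_eq_mul]
  rw [(u.hasSum_coeff hq x).tsum_eq]
  simp only [ContinuousMap.mul_apply, Complex.ofReal_mul]
  ring

theorem hasSum_sq_fourierHat (u : C(UnitAddCircle, ℝ)) :
    HasSum (fun k ↦ ‖fourierHat u k‖ ^ 2) (∫ x, u x ^ 2 ∂AddCircle.haarAddCircle) := by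
  let w : C(UnitAddCircle, ℂ) := ⟨fun x ↦ (u x : ℂ), by fun_prop⟩
  have h := hasSum_sq_fourierCoeff (ContinuousMap.toLp (E := ℂ) 2 AddCircle.haarAddCircle ℂ w)
  have e : ∫ t, ‖(ContinuousMap.toLp (E := ℂ) 2 AddCircle.haarAddCircle ℂ w) t‖ ^ 2
      ∂AddCircle.haarAddCircle = ∫ x, u x ^ 2 ∂AddCircle.haarAddCircle := by
    refine integral_congr_ae ?_
    filter_upwards [ContinuousMap.coeFn_toLp (E := ℂ) (p := 2) (𝕜 := ℂ) AddCircle.haarAddCircle w] with x hx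
    rw [hx]
    simp [w]
  rw [e] at h
  convert h using 3 with k
  rw [fourierCoeff_toLp]
  rfl

end Fourier

/-! ### Inclusions, the algebra property, and a closed graph criterion -/

namespace Hq

variable {a b : ℝ}

theorem mem_of_mem (h : b ≤ a) {u : C(UnitAddCircle, ℝ)} (hu : u ∈ hqSubmodule a) :
    u ∈ hqSubmodule b := by
  rw [mem_hqSubmodule_iff] at hu ⊢
  refine ne_top_of_le_ne_top hu (ENNReal.tsum_le_tsum fun k ↦ ?_)
  gcongr
  exact eWeight_mono (by linarith) k

/-- By `eWeight_add_le` the weight at the output frequency falls on one of the two factors. That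
factor is then in weighted `ℓ²`, the other one is in `ℓ¹` because `a > 1/2`, and Young's inequality
concludes. -/
theorem mul_mem (ha : 1 / 2 < a) {u v : C(UnitAddCircle, ℝ)} (hu : u ∈ hqSubmodule a)
    (hv : v ∈ hqSubmodule a) : u * v ∈ hqSubmodule a := by
  rw [mem_hqSubmodule_iff]
  have hu1 : ∑' k, eCoeff u k ≠ ⊤ := tsum_eCoeff_ne_top ha (mk u hu)
  have hv1 : ∑' k, eCoeff v k ≠ ⊤ := tsum_eCoeff_ne_top ha (mk v hv)
  set wu : ℤ → ℝ≥0∞ := fun k ↦ eWeight (a / 2) k * eCoeff u k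
  set wv : ℤ → ℝ≥0∞ := fun k ↦ eWeight (a / 2) k * eCoeff v k
  have hle : ∀ k, eWeight (a / 2) k * eCoeff (u * v : C(UnitAddCircle, ℝ)) k ≤
      ENNReal.ofReal (4 ^ (a / 2)) * (econv (eCoeff v) wu k + econv (eCoeff u) wv k) := by
    intro k
    have h1 : eCoeff (u * v : C(UnitAddCircle, ℝ)) k ≤ econv (eCoeff u) (eCoeff v) k := by
      unfold eCoeff econv
      rw [show u = toC (mk u hu) from rfl, fourierHat_mul ha (mk u hu) v k]
      refine (enorm_tsum_le_tsum_enorm).trans ?_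
      simp only [enorm_mul]; rfl
    calc _ ≤ eWeight (a / 2) k * econv (eCoeff u) (eCoeff v) k := by gcongr
      _ = ∑' j, eWeight (a / 2) (j + (k - j)) * (eCoeff u j * eCoeff v (k - j)) := by
          rw [econv, ← ENNReal.tsum_mul_left]; simp
      _ ≤ ∑' j, ENNReal.ofReal (4 ^ (a / 2)) *
            (wu j * eCoeff v (k - j) + eCoeff u j * wv (k - j)) := by
          refine ENNReal.tsum_le_tsum fun j ↦ ?_
          refine (mul_le_mul_left (eWeight_add_le (by linarith) j (k - j)) _).trans (le_of_eq ?_)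
          simp only [wu, wv]; ring
      _ = _ := by
          rw [ENNReal.tsum_mul_left, ENNReal.tsum_add, econv_comm (eCoeff v) wu]; rfl
  refine ne_top_of_le_ne_top ?_ (ENNReal.tsum_le_tsum fun k ↦ pow_le_pow_left' (hle k) 2)
  have hb : ∀ k, (ENNReal.ofReal (4 ^ (a / 2)) * (econv (eCoeff v) wu k + econv (eCoeff u) wv k)) ^ 2 ≤
      ENNReal.ofReal (4 ^ (a / 2)) ^ 2 * 4 * (econv (eCoeff v) wu k ^ 2 + econv (eCoeff u) wv k ^ 2) := by
    intro k
    rw [mul_pow, mul_assoc]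
    gcongr
    exact ENNReal.add_sq_le _ _
  refine ne_top_of_le_ne_top ?_ (ENNReal.tsum_le_tsum hb)
  rw [ENNReal.tsum_mul_left, ENNReal.tsum_add]
  have h2 := mem_hqSubmodule_iff.mp hu
  have h3 := mem_hqSubmodule_iff.mp hv
  refine ENNReal.mul_ne_top (by finiteness) (ENNReal.add_ne_top.mpr ⟨?_, ?_⟩)
  · refine ne_top_of_le_ne_top ?_ (tsum_econv_sq_le _ _)
    finiteness
  · refine ne_top_of_le_ne_top ?_ (tsum_econv_sq_le _ _)
    finiteness

theorem continuous_eval' (ha : 1 / 2 < a) (x : UnitAddCircle) : Continuous fun u : Hq a ↦ u x := by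
  let L : Hq a →ₗ[ℝ] ℝ :=
    { toFun := fun u ↦ u x, map_add' := fun _ _ ↦ rfl, map_smul' := fun _ _ ↦ rfl }
  exact AddMonoidHomClass.continuous_of_bound L _ fun u ↦ Hq.abs_apply_le u ha x

/-- A linear map into `H^b` whose evaluations are continuous is continuous. -/
theorem continuous_of_eval {E : Type*} [NormedAddCommGroup E] [NormedSpace ℝ E] [CompleteSpace E]
    (hb : 1 / 2 < b) (L : E →ₗ[ℝ] Hq b) (h : ∀ x, Continuous fun v ↦ (L v) x) : Continuous L := by
  have := completeSpace hb
  -- Closed graph theorem: convergence in `H^b` implies pointwise convergence, and a limit is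
  -- determined by its values. Continuity thus comes without any norm estimate.
  refine L.continuous_of_seq_closed_graph fun u v w hu hw ↦ ext fun x ↦ ?_
  exact tendsto_nhds_unique (((continuous_eval' hb x).tendsto w).comp hw) (((h x).tendsto v).comp hu)

end Hq
end

/-! ### Differentiation, multiplication and Fourier multipliers on `H^q` -/

section
open scoped Manifold ContDiff
attribute [-instance] Hq.instModuleReal Hq.instAddCommGroup
open MeasureTheory Filter Topology
open scoped ENNReal NNReal

/-- `v` is the derivative of `u`, both regarded as `1`-periodic functions on the line. -/
def HasCircleDeriv (u v : C(UnitAddCircle, ℝ)) : Prop :=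
  ∀ x : ℝ, HasDerivAt (fun y : ℝ ↦ u (y : UnitAddCircle)) (v (x : UnitAddCircle)) x

theorem coe_norm_coeff_deriv {u v : C(UnitAddCircle, ℝ)} (h : HasCircleDeriv u v) (k : ℤ) :
    ‖fourierHat v k‖ = 2 * Real.pi * |(k : ℝ)| * ‖fourierHat u k‖ := by
  rw [coeff_hasDerivAt u v h]
  simp only [norm_mul, Complex.norm_I, Complex.norm_ofNat,
    Complex.norm_real, Real.norm_eq_abs, abs_of_pos Real.pi_pos, Complex.norm_intCast, mul_one]

/-- The closed graph theorem for operator-valued maps: strong continuity suffices to identify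
limits, and it upgrades itself to continuity in operator norm. -/
theorem continuous_of_separately {E F G : Type*} [NormedAddCommGroup E] [NormedSpace ℝ E] [CompleteSpace E]
    [NormedAddCommGroup F] [NormedSpace ℝ F] [NormedAddCommGroup G] [NormedSpace ℝ G] [CompleteSpace G]
    (L : E →ₗ[ℝ] F →L[ℝ] G) (h : ∀ f, Continuous fun u ↦ L u f) : Continuous L := by
  refine L.continuous_of_seq_closed_graph fun u v w hu hw ↦ ?_
  ext f
  exact tendsto_nhds_unique
    (((ContinuousLinearMap.apply ℝ G f).continuous.tendsto w).comp hw) (((h f).tendsto v).comp hu)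

namespace Hq
variable {a b q : ℝ}

/-- The inclusion `H^a ⊆ H^b` for `b ≤ a`, as a linear map. -/
noncomputable def inclₗ (h : b ≤ a) : Hq a →ₗ[ℝ] Hq b where
  toFun u := mk (toC u) (mem_of_mem h u.2)
  map_add' _ _ := rfl
  map_smul' _ _ := rfl

@[simp] theorem inclₗ_apply (h : b ≤ a) (u : Hq a) (x : UnitAddCircle) : inclₗ h u x = u x := rfl

/-- The derivative does not see the frequency `0`, which is a single term and is discarded. For `k ≠
0` one has `1 + k² ≤ 2 (2πk)²`, so the additional weight is paid for by the derivative. -/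
theorem mem_add_one_of_hasCircleDeriv {u v : C(UnitAddCircle, ℝ)} (h : HasCircleDeriv u v)
    (hv : v ∈ hqSubmodule b) : u ∈ hqSubmodule (b + 1) := by
  change Summable _
  have hv' : Summable fun k : ℤ ↦ sobolevWeight b k * ‖fourierHat v k‖ ^ 2 := hv
  rw [← (Set.finite_singleton (0 : ℤ)).summable_compl_iff]
  refine Summable.of_nonneg_of_le (fun k ↦ mul_nonneg (sobolevWeight_pos _ _).le (sq_nonneg _))
    (fun k ↦ ?_) ((hv'.subtype _).mul_left 2)
  obtain ⟨k, hk⟩ := k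
  have hk1 : (1 : ℝ) ≤ |(k : ℝ)| := by exact_mod_cast Int.one_le_abs hk
  have hk2 : 1 + (k : ℝ) ^ 2 ≤ 2 * (2 * Real.pi * |(k : ℝ)|) ^ 2 := by
    have : (1 : ℝ) ≤ (k : ℝ) ^ 2 := by nlinarith [sq_abs (k : ℝ)]
    have h3 := Real.pi_gt_three
    have h4 : 9 < Real.pi ^ 2 := by nlinarith
    rw [mul_pow, sq_abs]
    nlinarith
  simp only [Function.comp_apply]
  rw [sobolevWeight_add, coe_norm_coeff_deriv h, mul_pow]
  have e : sobolevWeight 1 k = 1 + (k : ℝ) ^ 2 := by simp [sobolevWeight]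
  rw [e]
  have := mul_le_mul_of_nonneg_left hk2
    (mul_nonneg (sobolevWeight_pos b k).le (sq_nonneg ‖fourierHat u k‖))
  linarith

theorem mem_of_hasCircleDeriv {u v : C(UnitAddCircle, ℝ)} (h : HasCircleDeriv u v)
    (hu : u ∈ hqSubmodule a) : v ∈ hqSubmodule (a - 1) := by
  have hu' : Summable fun k : ℤ ↦ sobolevWeight a k * ‖fourierHat u k‖ ^ 2 := hu
  refine Summable.of_nonneg_of_le (fun k ↦ mul_nonneg (sobolevWeight_pos _ _).le (sq_nonneg _))
    (fun k ↦ ?_) (hu'.mul_left ((2 * Real.pi) ^ 2))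
  have e : sobolevWeight a k = sobolevWeight (a - 1) k * (1 + (k : ℝ) ^ 2) := by
    have : sobolevWeight 1 k = 1 + (k : ℝ) ^ 2 := by simp [sobolevWeight]
    rw [← this, ← sobolevWeight_add]; congr 1; ring
  rw [coe_norm_coeff_deriv h, e, mul_pow, mul_pow, sq_abs]
  have := (sobolevWeight_pos (a - 1) k).le
  have h2 : 0 ≤ sobolevWeight (a - 1) k * ((2 * Real.pi) ^ 2 * ‖fourierHat u k‖ ^ 2) := by positivity
  nlinarith

/-- The derivative of `u ∈ H^q`, `q > 3/2`, as a continuous function on the circle. -/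
noncomputable def derivC (hq : 3 / 2 < q) (u : Hq q) : C(UnitAddCircle, ℝ) :=
  ⟨u.deriv_periodic.lift, continuous_coinduced_dom.mpr (u.continuous_deriv hq)⟩

theorem hasCircleDeriv (hq : 3 / 2 < q) (u : Hq q) : HasCircleDeriv (toC u) (u.derivC hq) :=
  fun x ↦ u.hasDerivAt hq x

theorem _root_.HasCircleDeriv.unique {u v w : C(UnitAddCircle, ℝ)} (h : HasCircleDeriv u v)
    (h' : HasCircleDeriv u w) : v = w := by
  ext x
  induction x using QuotientAddGroup.induction_on with | H x => ?_
  exact (h x).unique (h' x)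

/-- The derivative `H^q → H^{q-1}`, as a linear map. -/
noncomputable def derivₗ (hq : 3 / 2 < q) : Hq q →ₗ[ℝ] Hq (q - 1) where
  toFun u := mk (u.derivC hq) (mem_of_hasCircleDeriv (u.hasCircleDeriv hq) u.2)
  map_add' u v := toC_injective <| ((u + v).hasCircleDeriv hq).unique
    fun x ↦ (u.hasCircleDeriv hq x).add (v.hasCircleDeriv hq x)
  map_smul' c u := toC_injective <| ((c • u).hasCircleDeriv hq).unique
    fun x ↦ (u.hasCircleDeriv hq x).const_mul c

theorem continuous_inclₗ (hb : 1 / 2 < b) (h : b ≤ a) : Continuous (inclₗ h : Hq a →ₗ[ℝ] Hq b) := by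
  have := completeSpace (q := a) (by linarith)
  exact continuous_of_eval hb _ fun x ↦ continuous_eval' (by linarith) x

theorem continuous_derivₗ (hq : 3 / 2 < q) : Continuous (derivₗ hq) := by
  have := completeSpace (q := q) (by linarith)
  refine continuous_of_eval (by linarith) _ fun x ↦ ?_
  induction x using QuotientAddGroup.induction_on with | H x => ?_
  let L : Hq q →ₗ[ℝ] ℝ :=
    { toFun := fun u ↦ derivₗ hq u (x : UnitAddCircle)
      map_add' := fun u v ↦ by rw [map_add]; rfl
      map_smul' := fun c u ↦ by rw [map_smul]; rfl }
  exact AddMonoidHomClass.continuous_of_bound L _ fun u ↦ abs_deriv_le u hq x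

/-- The inclusion `H^a ⊆ H^b` for `1/2 < b ≤ a`. -/
noncomputable def incl (hb : 1 / 2 < b) (h : b ≤ a) : Hq a →L[ℝ] Hq b :=
  ⟨inclₗ h, continuous_inclₗ hb h⟩

@[simp] theorem incl_apply (hb : 1 / 2 < b) (h : b ≤ a) (u : Hq a) (x : UnitAddCircle) :
    incl hb h u x = u x := rfl

/-- The derivative `H^q → H^{q-1}`. -/
noncomputable def derivL (hq : 3 / 2 < q) : Hq q →L[ℝ] Hq (q - 1) := ⟨derivₗ hq, continuous_derivₗ hq⟩

@[simp] theorem derivL_coe (hq : 3 / 2 < q) (u : Hq q) (x : ℝ) :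
    derivL hq u (x : UnitAddCircle) = u.deriv x := rfl

/-- Multiplication by a fixed element of `H^a` on `H^b`, `1/2 < b ≤ a`, as a linear map. -/
noncomputable def mulₗ (hb : 1 / 2 < b) (h : b ≤ a) (u : Hq a) : Hq b →ₗ[ℝ] Hq b where
  toFun v := mk (toC u * toC v) (mul_mem hb (mem_of_mem h u.2) v.2)
  map_add' v w := by apply ext; intro x; simp [mul_add]
  map_smul' c v := by apply ext; intro x; simp

/-- Multiplication by a fixed element of `H^b` as a map `H^a → H^b`, `1/2 < b ≤ a`. -/
noncomputable def mulₗ' (hb : 1 / 2 < b) (h : b ≤ a) (v : Hq b) : Hq a →ₗ[ℝ] Hq b where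
  toFun u := mulₗ hb h u v
  map_add' u w := ext fun x ↦ add_mul (u x) (w x) (v x)
  map_smul' c u := ext fun x ↦ mul_assoc c (u x) (v x)

theorem continuous_mulₗ (hb : 1 / 2 < b) (h : b ≤ a) (u : Hq a) : Continuous (mulₗ hb h u) := by
  have := completeSpace hb
  exact continuous_of_eval hb _ fun x ↦ (continuous_eval' hb x).const_mul (u x)

/-- Multiplication `H^a × H^b → H^b`, `1/2 < b ≤ a`. -/
noncomputable def mulL (hb : 1 / 2 < b) (h : b ≤ a) : Hq a →L[ℝ] Hq b →L[ℝ] Hq b where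
  toFun u := ⟨mulₗ hb h u, continuous_mulₗ hb h u⟩
  map_add' u v := by
    ext w; apply ext; intro x
    change (u x + v x) * w x = u x * w x + v x * w x
    ring
  map_smul' c u := by
    ext w; apply ext; intro x
    change (c * u x) * w x = c * (u x * w x)
    ring
  cont := by
    have := completeSpace hb
    have := completeSpace (q := a) (by linarith)
    let L : Hq a →ₗ[ℝ] Hq b →L[ℝ] Hq b :=
      { toFun := fun u ↦ ⟨mulₗ hb h u, continuous_mulₗ hb h u⟩
        map_add' := fun u v ↦ by
          ext w; apply ext; intro x
          change (u x + v x) * w x = u x * w x + v x * w x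
          ring
        map_smul' := fun c u ↦ by
          ext w; apply ext; intro x
          change (c * u x) * w x = c * (u x * w x)
          ring }
    refine continuous_of_separately L fun f ↦ ?_
    exact continuous_of_eval hb (mulₗ' hb h f) fun x ↦ (continuous_eval' (by linarith) x).mul_const (f x)

@[simp] theorem mulL_apply (hb : 1 / 2 < b) (h : b ≤ a) (u : Hq a) (v : Hq b) (x : UnitAddCircle) :
    mulL hb h u v x = u x * v x := rfl

/-- Fourier multipliers between Sobolev spaces. -/
theorem exists_multiplier (hb : 1 / 2 < b) (m : ℤ → ℝ) (hm : ∀ k, m (-k) = m k) {K : ℝ}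
    (hK : ∀ k, sobolevWeight (b / 2) k * |m k| ≤ K * sobolevWeight (a / 2) k) (u : Hq a) :
    ∃ v : Hq b, ∀ k, fourierHat v k = m k * fourierHat u k := by
  let c : ℤ → ℂ := fun k ↦ (sobolevWeight (b / 2) k * m k / sobolevWeight (a / 2) k : ℝ) * toL2 a u k
  have hc : Memℓp c 2 := by
    refine memℓp_gen ?_
    have h1 := (lp.memℓp (toL2 a u)).summable (by norm_num)
    refine Summable.of_nonneg_of_le (fun k ↦ by positivity) (fun k ↦ ?_) (h1.mul_left (K ^ 2))
    simp only [ENNReal.toReal_ofNat, Real.rpow_ofNat, c, norm_mul, Complex.norm_real, Real.norm_eq_abs, mul_pow]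
    gcongr
    rw [abs_div, abs_mul, abs_of_pos (sobolevWeight_pos _ _), abs_of_pos (sobolevWeight_pos _ _)]
    exact div_le_of_le_mul₀ (sobolevWeight_pos _ _).le
      (by
        -- The sign of `K` is not assumed; it is forced by the bound at frequency `0`.
        have := hK 0
        have h2 : 0 ≤ K * sobolevWeight (a / 2) 0 :=
          (mul_nonneg (sobolevWeight_pos _ _).le (abs_nonneg _)).trans this
        exact nonneg_of_mul_nonneg_left h2 (sobolevWeight_pos _ _)) (hK k)
  obtain ⟨v, hv⟩ := exists_of_symm hb ⟨c, hc⟩ fun k ↦ by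
    change c (-k) = starRingEnd ℂ (c k)
    simp only [c, map_mul, toL2_symm, Complex.conj_ofReal, hm, sobolevWeight_neg_int]
  refine ⟨v, fun k ↦ ?_⟩
  have h1 : toL2 b v k = c k := by rw [hv]
  rw [toL2_apply] at h1
  simp only [c, toL2_apply] at h1
  have p1 : (sobolevWeight (a / 2) k : ℂ) ≠ 0 := by exact_mod_cast (sobolevWeight_pos _ _).ne'
  have p2 : (sobolevWeight (b / 2) k : ℂ) ≠ 0 := by exact_mod_cast (sobolevWeight_pos _ _).ne'
  refine mul_left_cancel₀ p2 (h1.trans ?_)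
  push_cast
  field_simp

end Hq

/-! ### Interpolation between `L²` and `H²` -/

section Interpolation

theorem tsum_sq_eCoeff (u : C(UnitAddCircle, ℝ)) :
    ∑' k, eCoeff u k ^ 2 = ENNReal.ofReal (∫ x, u x ^ 2 ∂AddCircle.haarAddCircle) := by
  have h := hasSum_sq_fourierHat u
  rw [← h.tsum_eq, ENNReal.ofReal_tsum_of_nonneg (fun k ↦ sq_nonneg _) h.summable]
  refine tsum_congr fun k ↦ ?_
  rw [ENNReal.ofReal_pow (norm_nonneg _), ofReal_norm]; rfl

theorem eCoeff_add_sq_le (u v : C(UnitAddCircle, ℝ)) (k : ℤ) :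
    eCoeff (u + v : C(UnitAddCircle, ℝ)) k ^ 2 ≤ 4 * (eCoeff u k ^ 2 + eCoeff v k ^ 2) := by
  refine le_trans ?_ (ENNReal.add_sq_le _ _)
  gcongr
  unfold eCoeff
  rw [coeff_add]
  exact enorm_add_le _ _

/-- Represents `x^α` as a superposition over `t` of the functions `t^{α-1} x / (t + x)`. This
replaces an abstract interpolation theorem by integration of one family of estimates. -/
theorem lintegral_rpowIntegrand {α x : ℝ} (hα : α ∈ Set.Ioo (0 : ℝ) 1) (hx : 0 ≤ x) :
    ∫⁻ t in Set.Ioi (0 : ℝ), ENNReal.ofReal (Real.rpowIntegrand₀₁ α t x) =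
      ENNReal.ofReal (x ^ α) * ENNReal.ofReal (∫ t in Set.Ioi (0 : ℝ), Real.rpowIntegrand₀₁ α t 1) := by
  rw [← ENNReal.ofReal_mul (by positivity), ← Real.integral_rpowIntegrand₀₁_eq_rpow_mul_const hα hx,
    ofReal_integral_eq_lintegral_ofReal (Real.integrableOn_rpowIntegrand₀₁_Ioi hα hx)]
  exact ae_restrict_of_forall_mem measurableSet_Ioi fun t ht ↦
    Real.rpowIntegrand₀₁_nonneg hα.1 (le_of_lt ht) hx

/-- Interpolation between `L²` and `H²`. -/
theorem mem_hqSubmodule_of_interpolation {θ : ℝ} (hθ : θ ∈ Set.Ioo (1 / 2 : ℝ) 2)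
    (T : C(UnitAddCircle, ℝ) →+ C(UnitAddCircle, ℝ)) {C : ℝ≥0∞} (hC : C ≠ ⊤)
    (h0 : ∀ g, ∑' k, eCoeff (T g) k ^ 2 ≤ C * ∑' k, eCoeff g k ^ 2)
    (h2 : ∀ g ∈ hqSubmodule (θ + 4),
      ∑' k, eWeight 2 k * eCoeff (T g) k ^ 2 ≤ C * ∑' k, eWeight 2 k * eCoeff g k ^ 2)
    {v : C(UnitAddCircle, ℝ)} (hv : v ∈ hqSubmodule θ) : T v ∈ hqSubmodule θ := by
  have hα : θ / 2 ∈ Set.Ioo (0 : ℝ) 1 := ⟨by linarith [hθ.1], by linarith [hθ.2]⟩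
  have hy : ∀ k, 0 < sobolevWeight 2 k := sobolevWeight_pos 2
  -- With `y = (1 + k²)²`, split `v = A + B` by the multipliers `y/(t+y)` and `t/(t+y)`. Since
  -- `y/(t+y) ≤ min(1, y/t)`, the `L²` bound handles `T A` and the `H²` bound handles `T B`. The
  -- right sides recombine exactly: `y²/(t+y)² + t⁻¹ y t²/(t+y)² = y/(t+y)`.
  have key : ∀ t : ℝ, 0 < t →
      ∑' k, ENNReal.ofReal (sobolevWeight 2 k / (t + sobolevWeight 2 k)) * eCoeff (T v) k ^ 2 ≤
        4 * C * ∑' k, ENNReal.ofReal (sobolevWeight 2 k / (t + sobolevWeight 2 k)) * eCoeff v k ^ 2 := by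
    intro t ht
    have hmt : ∀ k, |t / (t + sobolevWeight 2 k)| = t / (t + sobolevWeight 2 k) := fun k ↦
      abs_of_pos (div_pos ht (by have := hy k; linarith))
    -- The multiplier `t/(t+y)` decays like `k⁻⁴`, which is why `B` lies in `H^{θ+4}`, the class on
    -- which the `H²` bound is assumed.
    obtain ⟨b, hb⟩ := Hq.exists_multiplier (a := θ) (b := θ + 4) (by linarith [hθ.1])
      (fun k ↦ t / (t + sobolevWeight 2 k)) (fun k ↦ by simp [sobolevWeight_neg_int]) (K := t)
      (fun k ↦ by
        rw [show (θ + 4) / 2 = θ / 2 + 2 by ring, sobolevWeight_add, hmt]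
        have := hy k
        have h1 : sobolevWeight 2 k * (t / (t + sobolevWeight 2 k)) ≤ t := by
          rw [← mul_div_assoc, div_le_iff₀ (by linarith)]; nlinarith
        nlinarith [sobolevWeight_pos (θ / 2) k])
      (Hq.mk v hv)
    set B : C(UnitAddCircle, ℝ) := Hq.toC b
    set A : C(UnitAddCircle, ℝ) := v - B
    have hB : ∀ k, eCoeff B k = ENNReal.ofReal (t / (t + sobolevWeight 2 k)) * eCoeff v k := by
      intro k
      unfold eCoeff
      rw [hb k, enorm_mul, Hq.toC_mk, ← ofReal_norm (Complex.ofReal _), Complex.norm_real, Real.norm_eq_abs, hmt]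
    have hA : ∀ k, eCoeff A k = ENNReal.ofReal (sobolevWeight 2 k / (t + sobolevWeight 2 k)) * eCoeff v k := by
      intro k
      have e : fourierHat A k = ((sobolevWeight 2 k / (t + sobolevWeight 2 k) : ℝ) : ℂ) * fourierHat v k := by
        have h1 : fourierHat v k = fourierHat A k + fourierHat B k := by
          rw [← coeff_add]; simp [A]
        have h3 : fourierHat A k = fourierHat v k - fourierHat B k := by rw [h1]; ring
        rw [h3, hb k, Hq.toC_mk]
        have h4 : ((t + sobolevWeight 2 k : ℝ) : ℂ) ≠ 0 := by
          exact_mod_cast (by have := hy k; linarith : t + sobolevWeight 2 k ≠ 0)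
        push_cast at h4 ⊢
        field_simp
        ring
      unfold eCoeff
      rw [e, enorm_mul, ← ofReal_norm (Complex.ofReal _), Complex.norm_real, Real.norm_eq_abs,
        abs_of_pos (div_pos (hy k) (by have := hy k; linarith))]
    have hTv : T v = T A + T B := by rw [← map_add]; simp [A]
    calc ∑' k, ENNReal.ofReal (sobolevWeight 2 k / (t + sobolevWeight 2 k)) * eCoeff (T v) k ^ 2
        ≤ ∑' k, 4 * (eCoeff (T A) k ^ 2 + ENNReal.ofReal t⁻¹ * (eWeight 2 k * eCoeff (T B) k ^ 2)) := by
          refine ENNReal.tsum_le_tsum fun k ↦ ?_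
          have h1 : ENNReal.ofReal (sobolevWeight 2 k / (t + sobolevWeight 2 k)) ≤ 1 := by
            rw [← ENNReal.ofReal_one]
            refine ENNReal.ofReal_le_ofReal ?_
            rw [div_le_one (by have := hy k; linarith)]; linarith
          have h2 : ENNReal.ofReal (sobolevWeight 2 k / (t + sobolevWeight 2 k)) ≤
              ENNReal.ofReal t⁻¹ * eWeight 2 k := by
            rw [eWeight, ← ENNReal.ofReal_mul (by positivity)]
            refine ENNReal.ofReal_le_ofReal ?_
            rw [div_eq_inv_mul]
            have := hy k
            gcongr
            linarith
          calc _ ≤ ENNReal.ofReal (sobolevWeight 2 k / (t + sobolevWeight 2 k)) *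
                (4 * (eCoeff (T A) k ^ 2 + eCoeff (T B) k ^ 2)) := by
                rw [hTv]; gcongr; exact eCoeff_add_sq_le _ _ k
            _ = 4 * (ENNReal.ofReal (sobolevWeight 2 k / (t + sobolevWeight 2 k)) * eCoeff (T A) k ^ 2 +
                ENNReal.ofReal (sobolevWeight 2 k / (t + sobolevWeight 2 k)) * eCoeff (T B) k ^ 2) := by ring
            _ ≤ 4 * (1 * eCoeff (T A) k ^ 2 +
                ENNReal.ofReal t⁻¹ * eWeight 2 k * eCoeff (T B) k ^ 2) := by gcongr
            _ = _ := by ring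
      _ = 4 * (∑' k, eCoeff (T A) k ^ 2 + ENNReal.ofReal t⁻¹ * ∑' k, eWeight 2 k * eCoeff (T B) k ^ 2) := by
          rw [ENNReal.tsum_mul_left, ENNReal.tsum_add, ENNReal.tsum_mul_left]
      _ ≤ 4 * (C * ∑' k, eCoeff A k ^ 2 + ENNReal.ofReal t⁻¹ * (C * ∑' k, eWeight 2 k * eCoeff B k ^ 2)) := by
          gcongr
          · exact h0 A
          · exact h2 B b.2
      _ = 4 * C * ∑' k, (eCoeff A k ^ 2 + ENNReal.ofReal t⁻¹ * (eWeight 2 k * eCoeff B k ^ 2)) := by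
          rw [ENNReal.tsum_add, ENNReal.tsum_mul_left]; ring
      _ = _ := by
          congr 1
          refine tsum_congr fun k ↦ ?_
          have := hy k
          have p : 0 < t + sobolevWeight 2 k := by linarith
          rw [hA, hB, eWeight, mul_pow, mul_pow, ← ENNReal.ofReal_pow (by positivity),
            ← ENNReal.ofReal_pow (by positivity), ← mul_assoc, ← mul_assoc, ← add_mul,
            ← ENNReal.ofReal_mul (by positivity), ← ENNReal.ofReal_mul (by positivity),
            ← ENNReal.ofReal_add (by positivity) (by positivity)]
          congr 2
          field_simp
          ring
  -- integrate over `t`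
  set I : ℝ≥0∞ := ENNReal.ofReal (∫ t in Set.Ioi (0 : ℝ), Real.rpowIntegrand₀₁ (θ / 2) t 1) with hI
  have hI0 : I ≠ 0 := by
    rw [hI, Ne, ENNReal.ofReal_eq_zero, not_le]
    exact Real.integral_rpowIntegrand₀₁_one_pos hα
  -- Since `y = (1 + k²)²`, the power `y^{θ/2}` is exactly the `H^θ` weight.
  have hint : ∀ w : C(UnitAddCircle, ℝ),
      ∫⁻ t in Set.Ioi (0 : ℝ), ∑' k, ENNReal.ofReal (Real.rpowIntegrand₀₁ (θ / 2) t (sobolevWeight 2 k)) *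
        eCoeff w k ^ 2 = I * ∑' k, (eWeight (θ / 2) k * eCoeff w k) ^ 2 := by
    intro w
    rw [lintegral_tsum, ← ENNReal.tsum_mul_left]
    · refine tsum_congr fun k ↦ ?_
      rw [lintegral_mul_const' _ _ (by unfold eCoeff; finiteness), lintegral_rpowIntegrand hα (hy k).le, mul_pow]
      have : ENNReal.ofReal (sobolevWeight 2 k ^ (θ / 2)) = eWeight (θ / 2) k ^ 2 := by
        rw [eWeight, ← ENNReal.ofReal_pow (sobolevWeight_pos _ _).le, Hq.weight_half_sq]
        congr 1
        unfold sobolevWeight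
        rw [← Real.rpow_mul (by positivity)]
        congr 1; ring
      rw [this]; ring
    · intro k
      refine (AEMeasurable.ennreal_ofReal ?_).mul_const _
      exact (Real.integrableOn_rpowIntegrand₀₁_Ioi hα (hy k).le).aestronglyMeasurable.aemeasurable
  have hfac : ∀ (w : C(UnitAddCircle, ℝ)) (t : ℝ), 0 < t →
      ∑' k, ENNReal.ofReal (Real.rpowIntegrand₀₁ (θ / 2) t (sobolevWeight 2 k)) * eCoeff w k ^ 2 =
        ENNReal.ofReal (t ^ (θ / 2 - 1)) *
          ∑' k, ENNReal.ofReal (sobolevWeight 2 k / (t + sobolevWeight 2 k)) * eCoeff w k ^ 2 := by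
    intro w t ht
    rw [← ENNReal.tsum_mul_left]
    refine tsum_congr fun k ↦ ?_
    rw [Real.rpowIntegrand₀₁_eq_pow_div hα ht.le (hy k).le, mul_div_assoc, ENNReal.ofReal_mul (by positivity)]
    ring
  have hfin : I * ∑' k, (eWeight (θ / 2) k * eCoeff (T v) k) ^ 2 ≤
      4 * C * (I * ∑' k, (eWeight (θ / 2) k * eCoeff v k) ^ 2) := by
    rw [← hint, ← hint, ← lintegral_const_mul' _ _ (by finiteness)]
    refine setLIntegral_mono_ae' measurableSet_Ioi (Eventually.of_forall fun t ht ↦ ?_)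
    rw [hfac _ t ht, hfac _ t ht]
    calc _ ≤ ENNReal.ofReal (t ^ (θ / 2 - 1)) * _ := mul_le_mul_right (key t ht) _
      _ = _ := by ring
  rw [mem_hqSubmodule_iff] at hv ⊢
  intro htop
  rw [htop, ENNReal.mul_top hI0, top_le_iff] at hfin
  exact absurd hfin (by finiteness)

end Interpolation
end

/-! ### Composition with circle diffeomorphisms below `H²` -/

section
open scoped Manifold ContDiff
attribute [-instance] Hq.instModuleReal Hq.instAddCommGroup
open MeasureTheory Filter Topology
open scoped ENNReal NNReal

/-- The map `x ↦ x + u(x)` of the circle. -/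
noncomputable def circleMap' (u : C(UnitAddCircle, ℝ)) : C(UnitAddCircle, UnitAddCircle) :=
  ⟨fun x ↦ x + ((u x : ℝ) : UnitAddCircle), continuous_id.add ((AddCircle.continuous_mk' 1).comp u.continuous)⟩

theorem circleMap'_apply (u : C(UnitAddCircle, ℝ)) (x : UnitAddCircle) :
    circleMap' u x = x + ((u x : ℝ) : UnitAddCircle) := rfl

theorem Hq.circleMap'_toC {q : ℝ} (u : Hq q) (x : UnitAddCircle) : circleMap' (Hq.toC u) x = u.toMap x := rfl

theorem integral_haar_eq_intervalIntegral {E : Type*} [NormedAddCommGroup E] [NormedSpace ℝ E]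
    (g : UnitAddCircle → E) (t : ℝ) :
    ∫ x, g x ∂AddCircle.haarAddCircle = ∫ x in t..t + 1, g (x : UnitAddCircle) := by
  rw [AddCircle.integral_haarAddCircle, inv_one, one_smul]
  exact (UnitAddCircle.intervalIntegral_preimage t g).symm

/-- Change of variables by a circle map of degree one. -/
theorem integral_comp_circleMap' {E : Type*} [NormedAddCommGroup E] [NormedSpace ℝ E]
    {u u₁ : C(UnitAddCircle, ℝ)} (h : HasCircleDeriv u u₁) {g : UnitAddCircle → E} (hg : Continuous g) :
    ∫ x, (1 + u₁ x) • g (circleMap' u x) ∂AddCircle.haarAddCircle = ∫ x, g x ∂AddCircle.haarAddCircle := by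
  have cmk : Continuous fun x : ℝ ↦ (x : UnitAddCircle) := AddCircle.continuous_mk' 1
  -- The lift `x ↦ x + u(x)` takes the endpoints of `[0, 1]` to `u(0)` and `u(0) + 1`, so the target
  -- integral is taken over the period starting at `u 0`. Monotonicity of the lift plays no role.
  rw [integral_haar_eq_intervalIntegral _ 0, integral_haar_eq_intervalIntegral g (u 0)]
  have e := intervalIntegral.integral_deriv_smul_comp (a := 0) (b := 0 + 1)
    (f := fun x : ℝ ↦ x + u (x : UnitAddCircle)) (f' := fun x : ℝ ↦ 1 + u₁ (x : UnitAddCircle))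
    (g := fun x : ℝ ↦ g (x : UnitAddCircle))
    (fun x _ ↦ (hasDerivAt_id x).add (h x)) (by fun_prop) (by fun_prop)
  refine Eq.trans e ?_
  have h1 : ((0 + 1 : ℝ) : UnitAddCircle) = ((0 : ℝ) : UnitAddCircle) := by
    rw [zero_add, AddCircle.coe_zero]; exact AddCircle.coe_period 1
  rw [h1, AddCircle.coe_zero]
  congr 1 <;> ring

theorem HasCircleDeriv.comp {g g₁ u u₁ : C(UnitAddCircle, ℝ)} (hg : HasCircleDeriv g g₁)
    (hu : HasCircleDeriv u u₁) : HasCircleDeriv (g.comp (circleMap' u)) (g₁.comp (circleMap' u) * (1 + u₁)) :=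
  fun x ↦ HasDerivAt.comp (h₂ := fun y : ℝ ↦ g (y : UnitAddCircle)) (h := fun y : ℝ ↦ y + u (y : UnitAddCircle))
    (h₂' := g₁ ((x + u (x : UnitAddCircle) : ℝ) : UnitAddCircle)) x
    (hg (x + u (x : UnitAddCircle))) ((hasDerivAt_id x).add (hu x))

theorem HasCircleDeriv.mul {g g₁ u u₁ : C(UnitAddCircle, ℝ)} (hg : HasCircleDeriv g g₁)
    (hu : HasCircleDeriv u u₁) : HasCircleDeriv (g * u) (g₁ * u + g * u₁) :=
  fun x ↦ (hg x).mul (hu x)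

theorem HasCircleDeriv.const_add {u u₁ : C(UnitAddCircle, ℝ)}
    (hu : HasCircleDeriv u u₁) (c : ℝ) : HasCircleDeriv (ContinuousMap.const _ c + u) u₁ :=
  fun x ↦ (hu x).const_add c

theorem exists_pos_le_of_pos {u : C(UnitAddCircle, ℝ)} (h : ∀ x, 0 < u x) : ∃ c > 0, ∀ x, c ≤ u x := by
  obtain ⟨x₀, -, hx₀⟩ := (isCompact_univ (X := UnitAddCircle)).exists_isMinOn Set.univ_nonempty
    u.continuous.continuousOn
  exact ⟨u x₀, h x₀, fun x ↦ hx₀ (Set.mem_univ x)⟩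

theorem continuous_integrable {E : Type*} [NormedAddCommGroup E] {g : UnitAddCircle → E} (hg : Continuous g) :
    Integrable g AddCircle.haarAddCircle :=
  hg.integrable_of_hasCompactSupport (HasCompactSupport.of_compactSpace _)

/-- By Parseval this is an `L²` estimate: insert the factor `c⁻¹ (1 + u₁) ≥ 1` and change variables.
-/
theorem tsum_sq_eCoeff_comp_le {u u₁ : C(UnitAddCircle, ℝ)} (h : HasCircleDeriv u u₁) {c : ℝ} (hc : 0 < c)
    (hle : ∀ x, c ≤ (1 + u₁) x) (g : C(UnitAddCircle, ℝ)) :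
    ∑' k, eCoeff (g.comp (circleMap' u)) k ^ 2 ≤ ENNReal.ofReal c⁻¹ * ∑' k, eCoeff g k ^ 2 := by
  rw [tsum_sq_eCoeff, tsum_sq_eCoeff, ← ENNReal.ofReal_mul (by positivity)]
  refine ENNReal.ofReal_le_ofReal ?_
  rw [← integral_comp_circleMap' h (g := fun x ↦ g x ^ 2) (by fun_prop), ← integral_const_mul]
  refine integral_mono (continuous_integrable (by fun_prop)) (continuous_integrable (by fun_prop)) fun x ↦ ?_
  have h1 := hle x
  simp only [ContinuousMap.add_apply, ContinuousMap.one_apply] at h1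
  simp only [ContinuousMap.comp_apply, smul_eq_mul]
  rw [← mul_assoc]
  have : 1 ≤ c⁻¹ * (1 + u₁ x) := by rw [inv_mul_eq_div, le_div_iff₀ hc]; linarith
  exact le_mul_of_one_le_left (sq_nonneg _) this

theorem tsum_sq_eCoeff_mul_le (m g : C(UnitAddCircle, ℝ)) :
    ∑' k, eCoeff (m * g : C(UnitAddCircle, ℝ)) k ^ 2 ≤ ENNReal.ofReal (‖m‖ ^ 2) * ∑' k, eCoeff g k ^ 2 := by
  rw [tsum_sq_eCoeff, tsum_sq_eCoeff, ← ENNReal.ofReal_mul (by positivity)]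
  refine ENNReal.ofReal_le_ofReal ?_
  rw [← integral_const_mul]
  refine integral_mono (continuous_integrable (by fun_prop)) (continuous_integrable (by fun_prop)) fun x ↦ ?_
  simp only [ContinuousMap.mul_apply, mul_pow]
  refine mul_le_mul_of_nonneg_right ?_ (sq_nonneg _)
  rw [← sq_abs]
  exact pow_le_pow_left₀ (abs_nonneg _) (m.norm_coe_le_norm x) 2

theorem tsum_sq_eCoeff_add_le (u v : C(UnitAddCircle, ℝ)) :
    ∑' k, eCoeff (u + v : C(UnitAddCircle, ℝ)) k ^ 2 ≤
      4 * (∑' k, eCoeff u k ^ 2 + ∑' k, eCoeff v k ^ 2) := by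
  rw [← ENNReal.tsum_add, ← ENNReal.tsum_mul_left]
  exact ENNReal.tsum_le_tsum fun k ↦ eCoeff_add_sq_le u v k

theorem eCoeff_deriv {u v : C(UnitAddCircle, ℝ)} (h : HasCircleDeriv u v) (k : ℤ) :
    eCoeff v k = ENNReal.ofReal (2 * Real.pi * |(k : ℝ)|) * eCoeff u k := by
  unfold eCoeff
  rw [← ofReal_norm, coe_norm_coeff_deriv h, ENNReal.ofReal_mul (by positivity), ofReal_norm]

theorem tsum_sq_eCoeff_deriv_le {u v : C(UnitAddCircle, ℝ)} (h : HasCircleDeriv u v) :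
    ∑' k, eCoeff v k ^ 2 ≤ ENNReal.ofReal ((2 * Real.pi) ^ 2) * ∑' k, eWeight 2 k * eCoeff u k ^ 2 := by
  rw [← ENNReal.tsum_mul_left]
  refine ENNReal.tsum_le_tsum fun k ↦ ?_
  rw [eCoeff_deriv h, mul_pow, ← mul_assoc, ← ENNReal.ofReal_pow (by positivity), eWeight,
    ← ENNReal.ofReal_mul (by positivity), mul_pow, sq_abs]
  gcongr
  have : sobolevWeight 2 k = (1 + (k : ℝ) ^ 2) ^ 2 := by simp [sobolevWeight]
  rw [this]
  nlinarith [sq_nonneg (k : ℝ)]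

theorem tsum_sq_eCoeff_deriv_deriv_le {u v w : C(UnitAddCircle, ℝ)} (h : HasCircleDeriv u v)
    (h' : HasCircleDeriv v w) :
    ∑' k, eCoeff w k ^ 2 ≤ ENNReal.ofReal ((2 * Real.pi) ^ 4) * ∑' k, eWeight 2 k * eCoeff u k ^ 2 := by
  rw [← ENNReal.tsum_mul_left]
  refine ENNReal.tsum_le_tsum fun k ↦ ?_
  rw [eCoeff_deriv h', eCoeff_deriv h, ← mul_assoc, mul_pow, ← mul_assoc, ← ENNReal.ofReal_mul (by positivity),
    ← ENNReal.ofReal_pow (by positivity), eWeight, ← ENNReal.ofReal_mul (by positivity)]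
  gcongr
  have : sobolevWeight 2 k = (1 + (k : ℝ) ^ 2) ^ 2 := by simp [sobolevWeight]
  rw [this]
  have e : (2 * Real.pi * |(k : ℝ)| * (2 * Real.pi * |(k : ℝ)|)) ^ 2 =
      (2 * Real.pi) ^ 4 * ((k : ℝ) ^ 2) ^ 2 := by rw [← sq_abs (k : ℝ)]; ring
  rw [e]
  gcongr
  linarith

/-- The `H²` norm is controlled by the function and its second derivative alone, because `(1 + k²)²
≤ 2 (1 + (2πk)⁴)`. -/
theorem tsum_weight_two_le {u v w : C(UnitAddCircle, ℝ)} (h : HasCircleDeriv u v)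
    (h' : HasCircleDeriv v w) :
    ∑' k, eWeight 2 k * eCoeff u k ^ 2 ≤ 2 * (∑' k, eCoeff u k ^ 2 + ∑' k, eCoeff w k ^ 2) := by
  rw [← ENNReal.tsum_add, ← ENNReal.tsum_mul_left]
  refine ENNReal.tsum_le_tsum fun k ↦ ?_
  have e : (2 * Real.pi * |(k : ℝ)| * (2 * Real.pi * |(k : ℝ)|)) ^ 2 =
      (2 * Real.pi) ^ 4 * ((k : ℝ) ^ 2) ^ 2 := by rw [← sq_abs (k : ℝ)]; ring
  have h1 : (1 : ℝ) ≤ (2 * Real.pi) ^ 4 := one_le_pow₀ (by linarith [Real.pi_gt_three])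
  have e2 : sobolevWeight 2 k = (1 + (k : ℝ) ^ 2) ^ 2 := by simp [sobolevWeight]
  have h2 : sobolevWeight 2 k ≤ 2 * (1 + (2 * Real.pi * |(k : ℝ)| * (2 * Real.pi * |(k : ℝ)|)) ^ 2) := by
    rw [e, e2]
    nlinarith [sq_nonneg ((k : ℝ) ^ 2 - 1), sq_nonneg ((k : ℝ) ^ 2)]
  rw [eCoeff_deriv h', eCoeff_deriv h, ← mul_assoc, mul_pow, ← ENNReal.ofReal_mul (by positivity),
    ← ENNReal.ofReal_pow (by positivity)]
  calc eWeight 2 k * eCoeff u k ^ 2 ≤ ENNReal.ofReal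
        (2 * (1 + (2 * Real.pi * |(k : ℝ)| * (2 * Real.pi * |(k : ℝ)|)) ^ 2)) * eCoeff u k ^ 2 := by
        gcongr; exact ENNReal.ofReal_le_ofReal h2
    _ = _ := by
        rw [ENNReal.ofReal_mul (by norm_num), ENNReal.ofReal_add (by norm_num) (by positivity)]
        simp; ring

/-- Composition with a `C²` diffeomorphism preserves `H^θ`, `1/2 < θ < 2`. -/
theorem comp_mem_of_hasCircleDeriv {u u₁ u₂ : C(UnitAddCircle, ℝ)} (h₁ : HasCircleDeriv u u₁)
    (h₂ : HasCircleDeriv u₁ u₂) (hpos : ∀ x, 0 < (1 + u₁) x) {θ : ℝ} (hθ : θ ∈ Set.Ioo (1 / 2 : ℝ) 2)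
    {v : C(UnitAddCircle, ℝ)} (hv : v ∈ hqSubmodule θ) : v.comp (circleMap' u) ∈ hqSubmodule θ := by
  obtain ⟨c, hc, hle⟩ := exists_pos_le_of_pos hpos
  let T : C(UnitAddCircle, ℝ) →+ C(UnitAddCircle, ℝ) :=
    { toFun := fun g ↦ g.comp (circleMap' u), map_zero' := rfl, map_add' := fun _ _ ↦ rfl }
  set K₁ : ℝ≥0∞ := ENNReal.ofReal c⁻¹
  -- `K₁` bounds composition on `L²`. `K₂` collects the terms of the chain rule `(g ∘ φ)'' = (1 +
  -- u₁)² (g'' ∘ φ) + u₂ (g' ∘ φ)`, each estimated by `K₁` and a supremum norm.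
  set K₂ : ℝ≥0∞ := 2 * (K₁ + 4 * (ENNReal.ofReal (‖(1 + u₁) ^ 2‖ ^ 2) * (K₁ * ENNReal.ofReal ((2 * Real.pi) ^ 4)) +
    ENNReal.ofReal (‖u₂‖ ^ 2) * (K₁ * ENNReal.ofReal ((2 * Real.pi) ^ 2))))
  have h0 : ∀ g, ∑' k, eCoeff (T g) k ^ 2 ≤ K₁ * ∑' k, eCoeff g k ^ 2 :=
    tsum_sq_eCoeff_comp_le h₁ hc hle
  refine mem_hqSubmodule_of_interpolation hθ T (C := K₁ + K₂) (by finiteness) (fun g ↦ ?_) (fun g hg ↦ ?_) hv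
  · exact (h0 g).trans (mul_le_mul_left le_self_add _)
  · let g' : Hq (θ + 4) := Hq.mk g hg
    obtain ⟨g₁, hg₁⟩ : ∃ g₁, HasCircleDeriv g g₁ := ⟨_, g'.hasCircleDeriv (by linarith [hθ.1])⟩
    have hg1m := Hq.mem_of_hasCircleDeriv hg₁ hg
    obtain ⟨g₂, hg₂⟩ : ∃ g₂, HasCircleDeriv g₁ g₂ :=
      ⟨_, (Hq.mk g₁ hg1m).hasCircleDeriv (by linarith [hθ.1])⟩
    have d1 : HasCircleDeriv (T g) (g₁.comp (circleMap' u) * (1 + u₁)) := hg₁.comp h₁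
    have d2 : HasCircleDeriv (g₁.comp (circleMap' u) * (1 + u₁)) _ :=
      (hg₂.comp h₁).mul (h₂.const_add 1)
    have e : g₂.comp (circleMap' u) * (1 + u₁) * (1 + u₁) + g₁.comp (circleMap' u) * u₂ =
        (1 + u₁) ^ 2 * g₂.comp (circleMap' u) + u₂ * g₁.comp (circleMap' u) := by ring
    have d2' : HasCircleDeriv (g₁.comp (circleMap' u) * (1 + u₁))
        ((1 + u₁) ^ 2 * g₂.comp (circleMap' u) + u₂ * g₁.comp (circleMap' u)) := e ▸ d2
    have hN0 : ∑' k, eCoeff g k ^ 2 ≤ ∑' k, eWeight 2 k * eCoeff g k ^ 2 := by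
      refine ENNReal.tsum_le_tsum fun k ↦ le_mul_of_one_le_left' ?_
      rw [← ENNReal.ofReal_one]
      exact ENNReal.ofReal_le_ofReal (one_le_sobolevWeight (by norm_num) k)
    set N := ∑' k, eWeight 2 k * eCoeff g k ^ 2
    calc _ ≤ 2 * (∑' k, eCoeff (T g) k ^ 2 + ∑' k, eCoeff ((1 + u₁) ^ 2 * g₂.comp (circleMap' u) +
          u₂ * g₁.comp (circleMap' u) : C(UnitAddCircle, ℝ)) k ^ 2) := tsum_weight_two_le d1 d2'
      _ ≤ 2 * (K₁ * N + 4 * (ENNReal.ofReal (‖(1 + u₁) ^ 2‖ ^ 2) *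
            (K₁ * (ENNReal.ofReal ((2 * Real.pi) ^ 4) * N)) +
          ENNReal.ofReal (‖u₂‖ ^ 2) * (K₁ * (ENNReal.ofReal ((2 * Real.pi) ^ 2) * N)))) := by
          gcongr
          · exact (h0 g).trans (by gcongr)
          · refine (tsum_sq_eCoeff_add_le _ _).trans ?_
            gcongr
            · refine (tsum_sq_eCoeff_mul_le _ _).trans ?_
              gcongr
              refine (h0 g₂).trans ?_
              gcongr
              exact tsum_sq_eCoeff_deriv_deriv_le hg₁ hg₂
            · refine (tsum_sq_eCoeff_mul_le _ _).trans ?_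
              gcongr
              refine (h0 g₁).trans ?_
              gcongr
              exact tsum_sq_eCoeff_deriv_le hg₁
      _ = K₂ * N := by simp only [K₂]; ring
      _ ≤ (K₁ + K₂) * N := by gcongr; exact le_add_self

/-! ### Composition, reciprocals and inverse diffeomorphisms in `H^q` -/

namespace Hq
variable {a b q σ : ℝ}

theorem one_mem (a : ℝ) : (1 : C(UnitAddCircle, ℝ)) ∈ hqSubmodule a := (const 1 : Hq a).2

theorem IsDisplacement.pos {u : Hq q} (hu : u.IsDisplacement) (hq : 3 / 2 < q) (x : UnitAddCircle) :
    0 < (1 + u.derivC hq) x := by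
  induction x using QuotientAddGroup.induction_on with | H x => ?_
  exact hu x

theorem derivC_mem (hq : 3 / 2 < q) (u : Hq q) : u.derivC hq ∈ hqSubmodule (q - 1) :=
  mem_of_hasCircleDeriv (u.hasCircleDeriv hq) u.2

/-- Composition with a diffeomorphism of class `H^q`, `q > 5/2`, preserves `H^σ` for `1/2 < σ ≤ q`. -/
theorem comp_mem (hq : 5 / 2 < q) {u : Hq q} (hu : u.IsDisplacement) (n : ℕ) :
    ∀ {σ : ℝ}, 1 / 2 < σ → σ ≤ q → σ < n + 2 → ∀ {v : C(UnitAddCircle, ℝ)}, v ∈ hqSubmodule σ →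
      v.comp (circleMap' (toC u)) ∈ hqSubmodule σ := by
  have hq' : 3 / 2 < q := by linarith
  have d1 := u.hasCircleDeriv hq'
  have m1 := u.derivC_mem hq'
  -- Interpolation covers `σ < 2`; it needs `φ ∈ C²`, hence `q > 5/2`. Each later step lowers `σ` by
  -- one through `(v ∘ φ)' = (v' ∘ φ) φ'`, the second factor being in `H^{q-1} ⊆ H^{σ-1}`.
  induction n with
  | zero =>
    intro σ h1 h2 h3 v hv
    exact comp_mem_of_hasCircleDeriv d1
      ((mk _ m1).hasCircleDeriv (by linarith)) (hu.pos hq') ⟨h1, by simpa using h3⟩ hv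
  | succ n ih =>
    intro σ h1 h2 h3 v hv
    push_cast at h3
    rcases lt_or_ge σ (n + 2) with h | h
    · exact ih h1 h2 h hv
    have hn : (0 : ℝ) ≤ n := n.cast_nonneg
    have hσ : 3 / 2 < σ := by linarith
    have dv := (mk v hv).hasCircleDeriv hσ
    have mv := (mk v hv).derivC_mem hσ
    have h5 := ih (σ := σ - 1) (by linarith) (by linarith) (by linarith) mv
    have h6 := mem_add_one_of_hasCircleDeriv (dv.comp d1)
      (mul_mem (a := σ - 1) (by linarith) h5 (Submodule.add_mem _ (one_mem _) (mem_of_mem (by linarith) m1)))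
    rwa [sub_add_cancel] at h6

theorem mem_zero (u : C(UnitAddCircle, ℝ)) : u ∈ hqSubmodule 0 := by
  change Summable _
  simpa [sobolevWeight] using (hasSum_sq_fourierHat u).summable

/-- A bootstrap on `g' = -f' g²`: regularity `b - 1` of `g` gives regularity `b` as soon as
`H^{b-1}` is an algebra. It starts from `g' ∈ L²`, which gives `g ∈ H¹`. -/
theorem inv_mem_aux (ha : 3 / 2 < a) {f g : C(UnitAddCircle, ℝ)} (hf : f ∈ hqSubmodule a)
    (hpos : ∀ x, 0 < f x) (hg : ∀ x, g x = (f x)⁻¹) (n : ℕ) :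
    ∀ {b : ℝ}, b ≤ a → b ≤ n + 1 → g ∈ hqSubmodule b := by
  have d1 := (mk f hf).hasCircleDeriv ha
  have m1 := (mk f hf).derivC_mem ha
  set f₁ := (mk f hf).derivC ha
  have dg : HasCircleDeriv g (-f₁ * (g * g)) := by
    intro x
    have := (d1 x).inv (hpos x).ne'
    have e : (fun y : ℝ ↦ g (y : UnitAddCircle)) = (fun y : ℝ ↦ (f (y : UnitAddCircle)))⁻¹ := by
      funext y; simp [hg]
    rw [e]
    refine this.congr_deriv ?_
    simp only [toC_mk, ContinuousMap.mul_apply, ContinuousMap.neg_apply, hg]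
    field_simp
  induction n with
  | zero =>
    intro b _ hb
    have := mem_add_one_of_hasCircleDeriv dg (mem_zero _)
    exact mem_of_mem (by simpa using hb) this
  | succ n ih =>
    intro b hba hbn
    push_cast at hbn
    have hn : (0 : ℝ) ≤ n := n.cast_nonneg
    -- The exponent is raised strictly above `3/2`, so that `H^{b'-1}` is an algebra. The midpoint
    -- of `3/2` and `min a 2` keeps `b' ≤ a` and leaves `b' - 1` within reach of the induction
    -- hypothesis.
    set b' := max b ((3 / 2 + min a 2) / 2)
    have h1 : 3 / 2 < b' := lt_max_of_lt_right (by
      have : 3 / 2 < min a 2 := lt_min ha (by norm_num)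
      linarith)
    have h2 : b' ≤ a := max_le hba (by linarith [min_le_left a 2])
    have h3 : b' ≤ n + 2 := max_le (by linarith) (by linarith [min_le_right a 2])
    have h4 := ih (b := b' - 1) (by linarith) (by linarith)
    have h5 := mem_add_one_of_hasCircleDeriv dg
      (mul_mem (a := b' - 1) (by linarith) (Submodule.neg_mem _ (mem_of_mem (by linarith) m1))
        (mul_mem (by linarith) h4 h4))
    rw [sub_add_cancel] at h5
    exact mem_of_mem (le_max_left _ _) h5

theorem inv_mem (ha : 3 / 2 < a) {f g : C(UnitAddCircle, ℝ)} (hf : f ∈ hqSubmodule a)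
    (hpos : ∀ x, 0 < f x) (hg : ∀ x, g x = (f x)⁻¹) : g ∈ hqSubmodule a := by
  obtain ⟨n, hn⟩ := exists_nat_gt a
  exact inv_mem_aux ha hf hpos hg n le_rfl (by linarith)

/-- The inverse of a diffeomorphism of class `H^q`, `q > 5/2`, is of class `H^q`. -/
theorem exists_inverse_displacement (hq : 5 / 2 < q) {u : Hq q} (hu : u.IsDisplacement)
    (ψ : C(UnitAddCircle, UnitAddCircle)) (hψ : ∀ x, u.toMap (ψ x) = x) :
    ∃ w : Hq q, w.IsDisplacement ∧ ∀ x, ψ x = w.toMap x := by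
  have hq' : 3 / 2 < q := by linarith
  -- From `ψ + u ∘ ψ = id`.
  let w : C(UnitAddCircle, ℝ) := -(toC u).comp ψ
  have hw : ∀ x, ψ x = circleMap' w x := by
    intro x
    rw [circleMap'_apply]
    have h := hψ x
    simp only [toMap] at h
    simp only [w, ContinuousMap.neg_apply, ContinuousMap.comp_apply, AddCircle.coe_neg]
    nth_rewrite 2 [← h]
    abel
  have hψw : ψ = circleMap' w := ContinuousMap.ext hw
  have hpos := hu.pos hq'
  let ρ : C(UnitAddCircle, ℝ) := ⟨fun x ↦ ((1 + u.derivC hq') x)⁻¹,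
    (1 + u.derivC hq').continuous.inv₀ fun x ↦ (hpos x).ne'⟩
  have hρm : ρ ∈ hqSubmodule (q - 1) :=
    inv_mem (by linarith) (Submodule.add_mem _ (one_mem _) (u.derivC_mem hq')) hpos fun x ↦ rfl
  let r : C(UnitAddCircle, ℝ) := ρ - 1
  have hrm : r ∈ hqSubmodule (q - 1) := Submodule.sub_mem _ hρm (one_mem _)
  -- The derivative of the inverse is `1/(1 + u')` at `ψ`. Hence `w' = r ∘ ψ` with `r ∈ H^{q-1}`
  -- known, and the regularity of `w` is one more than what composition with `ψ` preserves.
  have dw : HasCircleDeriv w (r.comp (circleMap' w)) := by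
    intro x
    have hΨc : Continuous fun y : ℝ ↦ y + w (y : UnitAddCircle) :=
      continuous_id.add (w.continuous.comp (AddCircle.continuous_mk' 1))
    have hd := (hasDerivAt_id (x + w (x : UnitAddCircle))).add (u.hasCircleDeriv hq' (x + w (x : UnitAddCircle)))
    have hinv := HasDerivAt.of_local_left_inverse (f := fun y : ℝ ↦ y + u (y : UnitAddCircle))
      (g := fun y : ℝ ↦ y + w (y : UnitAddCircle)) (a := x) hΨc.continuousAt hd (hpos _).ne'
      (Eventually.of_forall fun y ↦ by
        have h1 : (((y + w (y : UnitAddCircle) : ℝ)) : UnitAddCircle) = ψ y := by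
          rw [hw]; rfl
        simp only [h1]
        simp [w])
    have := hinv.sub (hasDerivAt_id x)
    refine (this.congr_of_eventuallyEq (Eventually.of_forall fun y ↦ ?_)).congr_deriv ?_
    · simp
    · rfl
  have hrpos : ∀ x, 0 < (1 + r.comp (circleMap' w)) x := by
    intro x
    simp only [r, ρ, ContinuousMap.add_apply, ContinuousMap.comp_apply, ContinuousMap.sub_apply,
      ContinuousMap.one_apply, ContinuousMap.coe_mk, add_sub_cancel]
    exact inv_pos.mpr (hpos _)
  have disp : ∀ {p : ℝ}, 3 / 2 < p → ∀ h : w ∈ hqSubmodule p, (mk w h : Hq p).IsDisplacement := by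
    intro p hp h x
    have h1 : (mk w h).deriv x = r (circleMap' w x) := (dw x).deriv
    rw [h1]
    exact hrpos x
  -- The starting exponent must lie below `2` for the interpolation result, which only needs `w` of
  -- class `C²`, and above `3/2` so that the first gain `w ∈ H^{θ+1}` passes the threshold `5/2` of
  -- `comp_mem`.
  set θ := min (q - 1) (7 / 4)
  have hθ : 3 / 2 < θ := lt_min (by linarith) (by norm_num)
  have hθ2 : θ ≤ 7 / 4 := min_le_right _ _
  have base : w ∈ hqSubmodule (θ + 1) :=
    mem_add_one_of_hasCircleDeriv dw (comp_mem_of_hasCircleDeriv dw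
      (((mk r hrm).hasCircleDeriv (by linarith)).comp dw) hrpos ⟨by linarith, by linarith⟩
      (mem_of_mem (min_le_left _ _) hrm))
  -- If `w ∈ H^p` with `p > 5/2`, composition with `ψ` preserves `H^{min(p+1, q) - 1}`, so `w' = r ∘
  -- ψ` gains one order until `q` is reached.
  have step : ∀ n : ℕ, w ∈ hqSubmodule (min q (θ + 1 + n)) := by
    intro n
    induction n with
    | zero => exact mem_of_mem (by simp) base
    | succ n ih =>
      set p := min q (θ + 1 + n)
      have hn : (0 : ℝ) ≤ n := n.cast_nonneg
      have hp : 5 / 2 < p := lt_min hq (by linarith)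
      obtain ⟨m, hm⟩ := exists_nat_gt p
      have h1 : 5 / 2 ≤ min (p + 1) q := le_min (by linarith) (by linarith)
      have h2 := min_le_left (p + 1) q
      have h2' := min_le_right (p + 1) q
      have h3 := comp_mem hp (disp (by linarith) ih) m (σ := min (p + 1) q - 1) (by linarith) (by linarith)
        (by linarith) (mem_of_mem (by linarith) hrm)
      have h4 := mem_add_one_of_hasCircleDeriv dw h3
      refine mem_of_mem ?_ h4
      rw [sub_add_cancel]
      refine le_min ?_ (min_le_left _ _)
      push_cast
      rcases min_cases q (θ + 1 + n) with ⟨h, h'⟩ | ⟨h, h'⟩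
      · exact (min_le_left _ _).trans (by simp only [p, h]; linarith)
      · exact (min_le_right _ _).trans (by simp only [p, h]; linarith)
  obtain ⟨n, hn⟩ := exists_nat_gt q
  have hwm : w ∈ hqSubmodule q := mem_of_mem (le_min le_rfl (by linarith)) (step n)
  exact ⟨mk w hwm, disp hq' hwm, hw⟩

end Hq
end

section
open scoped Manifold ContDiff
attribute [-instance] Hq.instModuleReal Hq.instAddCommGroup
open MeasureTheory Filter Topology
open scoped ENNReal NNReal

/-! ### Weighted iterated convolutions -/

section MultiConvolution

/-- The total size of a family of frequencies. -/
def freqSize {n : ℕ} (j : Fin n → ℤ) (m : ℤ) : ℝ := 1 + |(m : ℝ)| + ∑ i, |(j i : ℝ)|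

theorem one_le_freqSize {n : ℕ} (j : Fin n → ℤ) (m : ℤ) : 1 ≤ freqSize j m := by
  have : 0 ≤ ∑ i, |(j i : ℝ)| := Finset.sum_nonneg fun i _ ↦ abs_nonneg _
  unfold freqSize
  linarith [abs_nonneg (m : ℝ)]

theorem freqSize_cons {n : ℕ} (a : ℤ) (j : Fin n → ℤ) (m : ℤ) :
    freqSize (Fin.cons a j : Fin (n + 1) → ℤ) m = freqSize j m + |(a : ℝ)| := by
  simp only [freqSize, Fin.sum_univ_succ, Fin.cons_zero, Fin.cons_succ]; ring

/-- The output frequency is the sum of the input frequencies, so the output Sobolev weight is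
dominated by a power of the total size. -/
theorem abs_add_sum_le_freqSize {n : ℕ} (j : Fin n → ℤ) (k : ℤ) :
    1 + |(k : ℝ)| ≤ freqSize j (k - ∑ i, j i) := by
  have h1 : (k : ℝ) = ((k - ∑ i, j i : ℤ) : ℝ) + ∑ i, (j i : ℝ) := by push_cast; ring
  have h2 := abs_add_le ((k - ∑ i, j i : ℤ) : ℝ) (∑ i, (j i : ℝ))
  have h3 := Finset.abs_sum_le_sum_abs (fun i ↦ (j i : ℝ)) Finset.univ
  rw [← h1] at h2
  unfold freqSize
  linarith

/-- The iterated convolution, weighted by a power of the total size of the frequencies. -/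
noncomputable def multiConv (p : ℝ) {n : ℕ} (α : Fin n → ℤ → ℝ≥0∞) (β : ℤ → ℝ≥0∞) (k : ℤ) : ℝ≥0∞ :=
  ∑' j : Fin n → ℤ, ENNReal.ofReal (freqSize j (k - ∑ i, j i) ^ p) * ((∏ i, α i (j i)) * β (k - ∑ i, j i))

theorem tsum_fin_succ {n : ℕ} (F : (Fin (n + 1) → ℤ) → ℝ≥0∞) :
    ∑' j, F j = ∑' a : ℤ, ∑' j : Fin n → ℤ, F (Fin.cons a j) := by
  rw [← (Fin.consEquiv (fun _ : Fin (n + 1) ↦ ℤ)).tsum_eq, ENNReal.tsum_prod']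
  rfl

theorem multiConv_zero (p : ℝ) (α : Fin 0 → ℤ → ℝ≥0∞) (β : ℤ → ℝ≥0∞) (k : ℤ) :
    multiConv p α β k = ENNReal.ofReal ((1 + |(k : ℝ)|) ^ p) * β k := by
  simp only [multiConv]
  rw [tsum_eq_single (default : Fin 0 → ℤ) fun j hj ↦ absurd (Subsingleton.elim _ _) hj]
  simp [freqSize]

theorem multiConv_exponent_zero_succ {n : ℕ} (α : Fin (n + 1) → ℤ → ℝ≥0∞) (β : ℤ → ℝ≥0∞) :
    multiConv 0 α β = econv (α 0) (multiConv 0 (Fin.tail α) β) := by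
  funext k
  simp only [multiConv, econv]
  rw [tsum_fin_succ]
  refine tsum_congr fun a ↦ ?_
  rw [← ENNReal.tsum_mul_left]
  refine tsum_congr fun j ↦ ?_
  simp only [Fin.sum_univ_succ, Fin.prod_univ_succ, Fin.cons_zero, Fin.cons_succ, Fin.tail,
    Real.rpow_zero, ENNReal.ofReal_one, one_mul, sub_sub]
  ring

/-- From `(M + |a|)^p ≤ 2^p (M^p + |a|^p)`: the power of the total size lands either on the first
frequency or on the remaining ones. -/
theorem multiConv_succ_le {p : ℝ} (hp : 0 ≤ p) {n : ℕ} (α : Fin (n + 1) → ℤ → ℝ≥0∞) (β : ℤ → ℝ≥0∞) (k : ℤ) :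
    multiConv p α β k ≤ ENNReal.ofReal (2 ^ p) * (econv (α 0) (multiConv p (Fin.tail α) β) k +
      econv (fun a ↦ ENNReal.ofReal (|(a : ℝ)| ^ p) * α 0 a) (multiConv 0 (Fin.tail α) β) k) := by
  simp only [multiConv, econv]
  rw [tsum_fin_succ, ← ENNReal.tsum_add, ← ENNReal.tsum_mul_left]
  refine ENNReal.tsum_le_tsum fun a ↦ ?_
  rw [← ENNReal.tsum_mul_left, ← ENNReal.tsum_mul_left, ← ENNReal.tsum_add, ← ENNReal.tsum_mul_left]
  refine ENNReal.tsum_le_tsum fun j ↦ ?_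
  simp only [freqSize_cons, Fin.sum_univ_succ, Fin.prod_univ_succ, Fin.cons_zero, Fin.cons_succ, Fin.tail,
    Real.rpow_zero, ENNReal.ofReal_one, one_mul, ← sub_sub]
  set M := freqSize j (k - a - ∑ i, j i)
  have hM : 0 ≤ M := zero_le_one.trans (one_le_freqSize _ _)
  have h1 : (M + |(a : ℝ)|) ^ p ≤ 2 ^ p * (M ^ p + |(a : ℝ)| ^ p) := by
    have h2 : (M + |(a : ℝ)|) ^ p ≤ (2 * max M |(a : ℝ)|) ^ p :=
      Real.rpow_le_rpow (by positivity) (by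
        have := le_max_left M |(a : ℝ)|
        have := le_max_right M |(a : ℝ)|
        linarith) hp
    refine h2.trans ?_
    rw [Real.mul_rpow (by norm_num) (le_max_of_le_left hM)]
    gcongr
    have h3 : 0 ≤ M ^ p := by positivity
    have h4 : 0 ≤ |(a : ℝ)| ^ p := by positivity
    rcases max_cases M |(a : ℝ)| with ⟨h, -⟩ | ⟨h, -⟩ <;> rw [h] <;> linarith
  calc _ ≤ ENNReal.ofReal (2 ^ p * (M ^ p + |(a : ℝ)| ^ p)) *
        (α 0 a * (∏ i : Fin n, α i.succ (j i)) * β (k - a - ∑ i, j i)) := by gcongr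
    _ = _ := by
        rw [ENNReal.ofReal_mul (by positivity), ENNReal.ofReal_add (by positivity) (by positivity)]
        ring

theorem tsum_multiConv_zero {n : ℕ} (α : Fin n → ℤ → ℝ≥0∞) (β : ℤ → ℝ≥0∞) :
    ∑' k, multiConv 0 α β k = (∏ i, ∑' k, α i k) * ∑' k, β k := by
  induction n with
  | zero => simp [multiConv_zero]
  | succ n ih =>
    rw [multiConv_exponent_zero_succ, tsum_econv, ih, Fin.prod_univ_succ]
    simp only [Fin.tail]
    ring

/-- Young's inequality for the weighted iterated convolution. -/
theorem tsum_multiConv_sq_le {p : ℝ} (hp : 0 ≤ p) {n : ℕ} (α : Fin n → ℤ → ℝ≥0∞) (β : ℤ → ℝ≥0∞)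
    (A : Fin n → ℝ≥0∞) (B : ℝ≥0∞) (hα : ∀ i, ∑' k, α i k ≤ A i) (hβ : ∑' k, β k ≤ B)
    (hα' : ∀ i, ∑' k : ℤ, (ENNReal.ofReal (|(k : ℝ)| ^ p) * α i k) ^ 2 ≤ A i ^ 2)
    (hβ' : ∑' k : ℤ, (ENNReal.ofReal ((1 + |(k : ℝ)|) ^ p) * β k) ^ 2 ≤ B ^ 2) :
    ∑' k, multiConv p α β k ^ 2 ≤ (16 * ENNReal.ofReal (2 ^ p) ^ 2) ^ n * ((∏ i, A i) * B) ^ 2 := by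
  induction n with
  | zero => simpa [multiConv_zero] using hβ'
  | succ n ih =>
    have ih' := ih (Fin.tail α) (Fin.tail A) (fun i ↦ hα _) (fun i ↦ hα' _)
    set P := (∏ i, Fin.tail A i) * B
    set K := 16 * ENNReal.ofReal (2 ^ p) ^ 2
    have hK : 1 ≤ K := by
      have h1 : 1 ≤ ENNReal.ofReal (2 ^ p) := by
        rw [← ENNReal.ofReal_one]
        exact ENNReal.ofReal_le_ofReal (Real.one_le_rpow (by norm_num) hp)
      calc (1 : ℝ≥0∞) ≤ 16 * 1 ^ 2 := by norm_num
        _ ≤ 16 * ENNReal.ofReal (2 ^ p) ^ 2 := by gcongr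
    have hP : ∑' k, multiConv 0 (Fin.tail α) β k ≤ P := by
      rw [tsum_multiConv_zero]
      exact mul_le_mul' (Finset.prod_le_prod' fun i _ ↦ hα _) hβ
    -- Young's inequality twice: in one term `α 0` is taken in `ℓ¹` and the rest in `ℓ²`, in the
    -- other the roles are exchanged. The constant grows only geometrically in `n`, which the radius
    -- of convergence depends on.
    calc ∑' k, multiConv p α β k ^ 2
        ≤ ∑' k, ENNReal.ofReal (2 ^ p) ^ 2 * (4 * (econv (α 0) (multiConv p (Fin.tail α) β) k ^ 2 +
          econv (fun a ↦ ENNReal.ofReal (|(a : ℝ)| ^ p) * α 0 a) (multiConv 0 (Fin.tail α) β) k ^ 2)) := by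
          refine ENNReal.tsum_le_tsum fun k ↦ ?_
          refine (pow_le_pow_left' (multiConv_succ_le hp α β k) 2).trans ?_
          rw [mul_pow]
          gcongr
          exact ENNReal.add_sq_le _ _
      _ = ENNReal.ofReal (2 ^ p) ^ 2 * (4 * (∑' k, econv (α 0) (multiConv p (Fin.tail α) β) k ^ 2 +
          ∑' k, econv (multiConv 0 (Fin.tail α) β)
            (fun a ↦ ENNReal.ofReal (|(a : ℝ)| ^ p) * α 0 a) k ^ 2)) := by
          rw [ENNReal.tsum_mul_left, ENNReal.tsum_mul_left, ENNReal.tsum_add, econv_comm (multiConv 0 _ _)]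
      _ ≤ ENNReal.ofReal (2 ^ p) ^ 2 * (4 * (2 * (A 0 ^ 2 * (K ^ n * P ^ 2)) + 2 * (P ^ 2 * A 0 ^ 2))) := by
          gcongr
          · refine (tsum_econv_sq_le _ _).trans ?_
            gcongr
            exact hα 0
          · refine (tsum_econv_sq_le _ _).trans ?_
            gcongr
            exact hα' 0
      _ ≤ ENNReal.ofReal (2 ^ p) ^ 2 * (4 * (2 * (A 0 ^ 2 * (K ^ n * P ^ 2)) +
            2 * (K ^ n * P ^ 2 * A 0 ^ 2))) := by
          gcongr
          exact le_mul_of_one_le_left' (one_le_pow₀ hK)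
      _ = K ^ (n + 1) * ((∏ i, A i) * B) ^ 2 := by
          rw [Fin.prod_univ_succ]
          simp only [P, K, Fin.tail]
          ring

end MultiConvolution

namespace Hq
variable {a b q : ℝ}

theorem _root_.fourierHat_neg (u : UnitAddCircle → ℝ) (k : ℤ) :
    fourierHat u (-k) = starRingEnd ℂ (fourierHat u k) := by
  unfold fourierHat fourierCoeff
  rw [← integral_conj]
  refine integral_congr_ae (Eventually.of_forall fun x ↦ ?_)
  simp

theorem ext_coeff {u v : Hq q} (h : ∀ k, fourierHat u k = fourierHat v k) : u = v :=
  toC_injective (eq_of_coeff_eq h)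

/-- An element of `H^b` with prescribed Fourier coefficients. -/
theorem exists_of_coeff (hb : 1 / 2 < b) (c : ℤ → ℂ) (hc : ∀ k, c (-k) = starRingEnd ℂ (c k))
    (hs : ∑' k, (eWeight (b / 2) k * ‖c k‖ₑ) ^ 2 ≠ ⊤) : ∃ v : Hq b, ∀ k, fourierHat v k = c k := by
  have h1 : Memℓp (fun k : ℤ ↦ (sobolevWeight (b / 2) k : ℂ) * c k) 2 := by
    refine memℓp_gen ?_
    rw [summable_iff_tsum_ofReal_ne_top fun k ↦ by positivity]
    convert hs using 4 with k
    simp only [ENNReal.toReal_ofNat, Real.rpow_ofNat]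
    rw [ENNReal.ofReal_pow (norm_nonneg _), norm_mul, ENNReal.ofReal_mul (norm_nonneg _), Complex.norm_real,
      Real.norm_eq_abs, abs_of_pos (sobolevWeight_pos _ _), ofReal_norm, eWeight]
  obtain ⟨v, hv⟩ := exists_of_symm hb ⟨_, h1⟩ fun k ↦ by
    change (sobolevWeight (b / 2) (-k) : ℂ) * c (-k) = starRingEnd ℂ ((sobolevWeight (b / 2) k : ℂ) * c k)
    rw [map_mul, Complex.conj_ofReal, hc, sobolevWeight_neg_int]
  refine ⟨v, fun k ↦ ?_⟩
  have h2 : toL2 b v k = (sobolevWeight (b / 2) k : ℂ) * c k := by rw [hv]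
  rw [toL2_apply] at h2
  exact mul_left_cancel₀ (by exact_mod_cast (sobolevWeight_pos _ _).ne') h2

theorem fourierHat_add (u v : Hq q) (k : ℤ) :
    fourierHat (u + v : Hq q) k = fourierHat u k + fourierHat v k := coeff_add (toC u) (toC v) k

theorem fourierHat_smul (c : ℝ) (u : Hq q) (k : ℤ) :
    fourierHat (c • u : Hq q) k = c • fourierHat u k := by
  rw [Complex.real_smul]; exact coeff_smul c (toC u) k

/-- The `k`-th Fourier coefficient as a linear functional. -/
noncomputable def coeffₗ (q : ℝ) (k : ℤ) : Hq q →ₗ[ℝ] ℂ where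
  toFun u := fourierHat u k
  map_add' u v := coeff_add (toC u) (toC v) k
  map_smul' c u := by
    rw [RingHom.id_apply, Complex.real_smul]
    exact coeff_smul c (toC u) k

end Hq

/-! ### Multilinear Fourier operators with prescribed symbol -/

section MultiOperator

/-- A bound on a symbol by a product of frequencies and a power of their total size. -/
def SymbolBound {n : ℕ} (σ : (Fin n → ℤ) → ℤ → ℂ) (ρ L : ℝ) : Prop :=
  ∀ j m, ‖σ j m‖ ≤ L * (∏ i, |(j i : ℝ)|) * freqSize j m ^ ρ

/-- The Fourier coefficients of the multilinear operator with symbol `σ`. -/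
noncomputable def multiTerm {n : ℕ} (σ : (Fin n → ℤ) → ℤ → ℂ) (u : Fin n → ℤ → ℂ) (f : ℤ → ℂ) (k : ℤ)
    (j : Fin n → ℤ) : ℂ :=
  σ j (k - ∑ i, j i) * ((∏ i, u i (j i)) * f (k - ∑ i, j i))

/-- A constant for the continuity of multilinear Fourier operators. -/
noncomputable def multiConst (q : ℝ) : ℝ :=
  1 + √(∑' k, sobolevWeight (1 - q) k) + 2 ^ (q - 1)

theorem multiConst_pos (q : ℝ) : 0 < multiConst q := by unfold multiConst; positivity

variable {q b ρ L : ℝ} {n : ℕ} {σ : (Fin n → ℤ) → ℤ → ℂ}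

theorem eWeight_le_ofReal {t : ℝ} (ht : 0 ≤ t) (k : ℤ) :
    eWeight (t / 2) k ≤ ENNReal.ofReal ((1 + |(k : ℝ)|) ^ t) := by
  refine ENNReal.ofReal_le_ofReal ?_
  have : ((1 + |(k : ℝ)|) ^ t) = ((1 + |(k : ℝ)|) ^ 2) ^ (t / 2) := by
    rw [← Real.rpow_natCast, ← Real.rpow_mul (by positivity)]; congr 1; push_cast; ring
  rw [this]
  refine Real.rpow_le_rpow (by positivity) ?_ (by linarith)
  nlinarith [abs_nonneg (k : ℝ), sq_abs (k : ℝ)]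

theorem ofReal_le_eWeight {t : ℝ} (ht : 0 ≤ t) (k : ℤ) :
    ENNReal.ofReal ((1 + |(k : ℝ)|) ^ t) ≤ ENNReal.ofReal (2 ^ t) * eWeight (t / 2) k := by
  rw [eWeight, ← ENNReal.ofReal_mul (by positivity)]
  refine ENNReal.ofReal_le_ofReal ?_
  have e : ∀ x : ℝ, 0 ≤ x → x ^ t = (x ^ 2) ^ (t / 2) := fun x hx ↦ by
    rw [← Real.rpow_natCast, ← Real.rpow_mul hx]; congr 1; push_cast; ring
  rw [sobolevWeight, e _ (by positivity), e 2 (by norm_num), ← Real.mul_rpow (by positivity) (by positivity)]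
  refine Real.rpow_le_rpow (by positivity) ?_ (by linarith)
  nlinarith [sq_nonneg (1 - |(k : ℝ)|), sq_abs (k : ℝ)]

theorem abs_le_eWeight (k : ℤ) : ENNReal.ofReal |(k : ℝ)| ≤ eWeight (1 / 2) k := by
  refine ENNReal.ofReal_le_ofReal ?_
  unfold sobolevWeight
  rw [← Real.sqrt_eq_rpow]
  exact Real.abs_le_sqrt (by linarith)

theorem Hq.tsum_abs_mul_eCoeff_le (hq : 3 / 2 < q) (u : Hq q) :
    ∑' k : ℤ, ENNReal.ofReal |(k : ℝ)| * eCoeff u k ≤ ENNReal.ofReal (multiConst q * ‖u‖) := by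
  calc _ ≤ ∑' k : ℤ, eWeight (1 / 2) k * eCoeff u k := by
        gcongr with k; exact abs_le_eWeight k
    _ ≤ _ := u.tsum_weight_le (by linarith)
    _ ≤ _ := by
        rw [← ENNReal.ofReal_mul (Real.sqrt_nonneg _)]
        refine ENNReal.ofReal_le_ofReal ?_
        rw [show 2 * (1 / 2 : ℝ) - q = 1 - q by ring]
        gcongr
        unfold multiConst
        have : (0 : ℝ) < 2 ^ (q - 1) := by positivity
        linarith

theorem Hq.tsum_abs_rpow_mul_eCoeff_le (hq : 3 / 2 < q) (u : Hq q) :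
    ∑' k : ℤ, (ENNReal.ofReal (|(k : ℝ)| ^ (q - 1)) * (ENNReal.ofReal |(k : ℝ)| * eCoeff u k)) ^ 2 ≤
      ENNReal.ofReal (multiConst q * ‖u‖) ^ 2 := by
  calc _ ≤ ∑' k : ℤ, (eWeight (q / 2) k * eCoeff u k) ^ 2 := by
        refine ENNReal.tsum_le_tsum fun k ↦ ?_
        rw [← mul_assoc]
        gcongr
        rw [← ENNReal.ofReal_mul (by positivity)]
        refine ENNReal.ofReal_le_ofReal ?_
        have e : |(k : ℝ)| ^ (q - 1) * |(k : ℝ)| = (|(k : ℝ)| ^ 2) ^ (q / 2) := by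
          rw [← Real.rpow_natCast, ← Real.rpow_mul (abs_nonneg _), ← Real.rpow_add_one' (abs_nonneg _) (by linarith)]
          congr 1; push_cast; ring
        rw [e, sq_abs]
        exact Real.rpow_le_rpow (by positivity) (by linarith) (by linarith)
    _ = ENNReal.ofReal ‖u‖ ^ 2 := u.tsum_eq_norm_sq
    _ ≤ _ := by
        gcongr
        refine le_mul_of_one_le_left (norm_nonneg _) ?_
        unfold multiConst
        have : (0 : ℝ) < 2 ^ (q - 1) := by positivity
        linarith [Real.sqrt_nonneg (∑' k, sobolevWeight (1 - q) k)]

theorem Hq.tsum_eCoeff_le' (hq : 3 / 2 < q) (f : Hq (q - 1)) :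
    ∑' k : ℤ, eCoeff f k ≤ ENNReal.ofReal (multiConst q * ‖f‖) := by
  have h := f.tsum_weight_le (t := 0) (by linarith)
  simp only [eWeight_zero, one_mul] at h
  refine h.trans ?_
  rw [← ENNReal.ofReal_mul (Real.sqrt_nonneg _)]
  refine ENNReal.ofReal_le_ofReal ?_
  rw [show 2 * (0 : ℝ) - (q - 1) = 1 - q by ring]
  gcongr
  unfold multiConst
  have : (0 : ℝ) < 2 ^ (q - 1) := by positivity
  linarith

theorem Hq.tsum_rpow_mul_eCoeff_le (hq : 3 / 2 < q) (f : Hq (q - 1)) :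
    ∑' k : ℤ, (ENNReal.ofReal ((1 + |(k : ℝ)|) ^ (q - 1)) * eCoeff f k) ^ 2 ≤
      ENNReal.ofReal (multiConst q * ‖f‖) ^ 2 := by
  calc _ ≤ ∑' k : ℤ, ENNReal.ofReal (2 ^ (q - 1)) ^ 2 * (eWeight ((q - 1) / 2) k * eCoeff f k) ^ 2 := by
        refine ENNReal.tsum_le_tsum fun k ↦ ?_
        rw [← mul_pow, ← mul_assoc]
        gcongr
        exact ofReal_le_eWeight (by linarith) k
    _ = ENNReal.ofReal (2 ^ (q - 1)) ^ 2 * ENNReal.ofReal ‖f‖ ^ 2 := by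
        rw [ENNReal.tsum_mul_left, f.tsum_eq_norm_sq]
    _ ≤ _ := by
        rw [ENNReal.ofReal_mul (multiConst_pos q).le, mul_pow]
        gcongr
        unfold multiConst
        linarith [Real.sqrt_nonneg (∑' k, sobolevWeight (1 - q) k)]

/-- The majorant of the Fourier coefficients of a multilinear Fourier operator. -/
noncomputable def multiMajorant (u : Fin n → Hq q) (f : Hq (q - 1)) (k : ℤ) : ℝ≥0∞ :=
  multiConv (q - 1) (fun i j ↦ ENNReal.ofReal |(j : ℝ)| * eCoeff (u i) j) (eCoeff f) k

theorem tsum_multiMajorant_sq_le (hq : 3 / 2 < q) (u : Fin n → Hq q) (f : Hq (q - 1)) :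
    ∑' k, multiMajorant u f k ^ 2 ≤ ENNReal.ofReal
      (((4 * 2 ^ (q - 1)) ^ n * ((∏ i, (multiConst q * ‖u i‖)) * (multiConst q * ‖f‖))) ^ 2) := by
  refine (tsum_multiConv_sq_le (by linarith) _ _ (fun i ↦ ENNReal.ofReal (multiConst q * ‖u i‖))
    (ENNReal.ofReal (multiConst q * ‖f‖)) (fun i ↦ (u i).tsum_abs_mul_eCoeff_le hq)
    (f.tsum_eCoeff_le' hq) (fun i ↦ (u i).tsum_abs_rpow_mul_eCoeff_le hq)
    (f.tsum_rpow_mul_eCoeff_le hq)).trans (le_of_eq ?_)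
  have hc := multiConst_pos q
  have h0 : ∀ i ∈ Finset.univ, 0 ≤ multiConst q * ‖u i‖ := fun i _ ↦ by positivity
  have h1 : 0 ≤ ∏ i, (multiConst q * ‖u i‖) := Finset.prod_nonneg h0
  have e : ((4 * 2 ^ (q - 1)) ^ n * ((∏ i, (multiConst q * ‖u i‖)) * (multiConst q * ‖f‖))) ^ 2 =
      (16 * (2 ^ (q - 1)) ^ 2) ^ n * ((∏ i, (multiConst q * ‖u i‖)) * (multiConst q * ‖f‖)) ^ 2 := by
    rw [mul_pow, ← pow_mul, mul_comm n 2, pow_mul, mul_pow]; norm_num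
  have h16 : (16 : ℝ≥0∞) = ENNReal.ofReal 16 := by norm_num
  rw [e, h16, ← ENNReal.ofReal_prod_of_nonneg h0, ← ENNReal.ofReal_mul h1,
    ← ENNReal.ofReal_pow (by positivity), ← ENNReal.ofReal_pow (by positivity),
    ← ENNReal.ofReal_mul (by positivity), ← ENNReal.ofReal_pow (by positivity),
    ← ENNReal.ofReal_mul (by positivity)]

/-- The output weight is at most `M^b`, with `M` the total size, and the symbol contributes `M^ρ`;
together they make `M^{q-1}`. The factors `|jᵢ|` spend one derivative of each `uᵢ ∈ H^q`, so all
arguments enter at the level `H^{q-1}`. -/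
theorem tsum_enorm_multiTerm_le (hb : 0 ≤ b) (hbq : ρ + b = q - 1) (hL : 0 ≤ L)
    (hσ : SymbolBound σ ρ L) (u : Fin n → Hq q) (f : Hq (q - 1)) (k : ℤ) :
    eWeight (b / 2) k * ∑' j, ‖multiTerm σ (fun i ↦ fourierHat (u i)) (fourierHat f) k j‖ₑ ≤
      ENNReal.ofReal L * multiMajorant u f k := by
  unfold multiMajorant multiConv
  rw [← ENNReal.tsum_mul_left, ← ENNReal.tsum_mul_left]
  refine ENNReal.tsum_le_tsum fun j ↦ ?_
  set M := freqSize j (k - ∑ i, j i)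
  have hM : 1 ≤ M := one_le_freqSize _ _
  have h1 : eWeight (b / 2) k ≤ ENNReal.ofReal (M ^ b) :=
    (eWeight_le_ofReal hb k).trans (ENNReal.ofReal_le_ofReal
      (Real.rpow_le_rpow (by positivity) (abs_add_sum_le_freqSize j k) hb))
  have hp : 0 ≤ ∏ i, |(j i : ℝ)| := Finset.prod_nonneg fun i _ ↦ abs_nonneg _
  have h2 : ‖σ j (k - ∑ i, j i)‖ₑ ≤
      ENNReal.ofReal L * (∏ i, ENNReal.ofReal |(j i : ℝ)|) * ENNReal.ofReal (M ^ ρ) := by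
    rw [← ofReal_norm, ← ENNReal.ofReal_prod_of_nonneg fun i _ ↦ abs_nonneg _, ← ENNReal.ofReal_mul hL,
      ← ENNReal.ofReal_mul (mul_nonneg hL hp)]
    exact ENNReal.ofReal_le_ofReal (hσ j _)
  have h3 : ENNReal.ofReal (M ^ (q - 1)) = ENNReal.ofReal (M ^ ρ) * ENNReal.ofReal (M ^ b) := by
    rw [← ENNReal.ofReal_mul (by positivity), ← Real.rpow_add (by linarith), hbq]
  unfold multiTerm
  rw [enorm_mul, enorm_mul]
  have h4 : ‖∏ i, fourierHat (u i) (j i)‖ₑ = ∏ i, eCoeff (u i) (j i) := by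
    unfold eCoeff
    rw [← ofReal_norm, norm_prod, ENNReal.ofReal_prod_of_nonneg fun i _ ↦ norm_nonneg _]
    simp only [ofReal_norm]
  rw [h4, h3, Finset.prod_mul_distrib]
  calc _ ≤ ENNReal.ofReal (M ^ b) * (ENNReal.ofReal L * (∏ i, ENNReal.ofReal |(j i : ℝ)|) *
        ENNReal.ofReal (M ^ ρ) * ((∏ i, eCoeff (u i) (j i)) * ‖fourierHat f (k - ∑ i, j i)‖ₑ)) := by gcongr
    _ = _ := by unfold eCoeff; ring

theorem tsum_multiOp_sq_le (hq : 3 / 2 < q) (hb : 0 ≤ b) (hbq : ρ + b = q - 1) (hL : 0 ≤ L)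
    (hσ : SymbolBound σ ρ L) (u : Fin n → Hq q) (f : Hq (q - 1)) :
    ∑' k, (eWeight (b / 2) k * ∑' j, ‖multiTerm σ (fun i ↦ fourierHat (u i)) (fourierHat f) k j‖ₑ) ^ 2 ≤
      ENNReal.ofReal ((L * multiConst q * (4 * 2 ^ (q - 1) * multiConst q) ^ n * (∏ i, ‖u i‖) * ‖f‖) ^ 2) := by
  calc _ ≤ ∑' k, ENNReal.ofReal L ^ 2 * multiMajorant u f k ^ 2 := by
        refine ENNReal.tsum_le_tsum fun k ↦ ?_
        rw [← mul_pow]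
        exact pow_le_pow_left' (tsum_enorm_multiTerm_le hb hbq hL hσ u f k) 2
    _ ≤ ENNReal.ofReal L ^ 2 * ENNReal.ofReal _ := by
        rw [ENNReal.tsum_mul_left]
        gcongr
        exact tsum_multiMajorant_sq_le hq u f
    _ = _ := by
        rw [← ENNReal.ofReal_pow hL, ← ENNReal.ofReal_mul (by positivity), ← mul_pow,
          Finset.prod_mul_distrib, Finset.prod_const, Finset.card_univ, Fintype.card_fin]
        congr 2
        rw [mul_pow _ (multiConst q) n]
        ring

theorem summable_multiTerm (hq : 3 / 2 < q) (hb : 0 ≤ b) (hbq : ρ + b = q - 1) (hL : 0 ≤ L)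
    (hσ : SymbolBound σ ρ L) (u : Fin n → Hq q) (f : Hq (q - 1)) (k : ℤ) :
    Summable fun j ↦ ‖multiTerm σ (fun i ↦ fourierHat (u i)) (fourierHat f) k j‖ := by
  have h := tsum_multiOp_sq_le hq hb hbq hL hσ u f
  have h1 := ENNReal.ne_top_of_tsum_ne_top (ne_top_of_le_ne_top ENNReal.ofReal_ne_top h) k
  rw [summable_iff_tsum_ofReal_ne_top fun j ↦ norm_nonneg _]
  simp only [ofReal_norm]
  intro htop
  rw [htop, ENNReal.mul_top (by
    rw [eWeight, Ne, ENNReal.ofReal_eq_zero, not_le]; exact sobolevWeight_pos _ _)] at h1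
  exact h1 (by simp)

/-- The symbol of an operator which maps real functions to real functions. -/
def SymbolReal {n : ℕ} (σ : (Fin n → ℤ) → ℤ → ℂ) : Prop :=
  ∀ j m, σ (-j) (-m) = starRingEnd ℂ (σ j m)

/-- The Fourier coefficients are absolutely convergent sums, so multilinearity can be checked
coefficientwise. `SymbolReal` makes the coefficients Hermitian, hence the output real valued, and
the norm bound is geometric in `n` up to `L`. -/
theorem exists_multiOp (hq : 3 / 2 < q) (hb : 1 / 2 < b) (hbq : ρ + b = q - 1) (hL : 0 ≤ L)
    (hσ : SymbolBound σ ρ L) (hσr : SymbolReal σ) :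
    ∃ T : ContinuousMultilinearMap ℝ (fun _ : Fin n ↦ Hq q) (Hq (q - 1) →L[ℝ] Hq b),
      (∀ u f k, fourierHat (T u f) k =
        ∑' j, multiTerm σ (fun i ↦ fourierHat (u i)) (fourierHat f) k j) ∧
      ‖T‖ ≤ L * multiConst q * (4 * 2 ^ (q - 1) * multiConst q) ^ n := by
  have hb0 : 0 ≤ b := by linarith
  have hC : 0 ≤ L * multiConst q * (4 * 2 ^ (q - 1) * multiConst q) ^ n := by
    have := multiConst_pos q; positivity
  have hle : ∀ (u : Fin n → Hq q) (f : Hq (q - 1)) (k : ℤ),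
      ‖∑' j, multiTerm σ (fun i ↦ fourierHat (u i)) (fourierHat f) k j‖ₑ ≤
        ∑' j, ‖multiTerm σ (fun i ↦ fourierHat (u i)) (fourierHat f) k j‖ₑ := fun u f k ↦
    enorm_tsum_le_tsum_enorm
  have hbound : ∀ (u : Fin n → Hq q) (f : Hq (q - 1)),
      ∑' k, (eWeight (b / 2) k * ‖∑' j, multiTerm σ (fun i ↦ fourierHat (u i)) (fourierHat f) k j‖ₑ) ^ 2 ≤
      ENNReal.ofReal ((L * multiConst q * (4 * 2 ^ (q - 1) * multiConst q) ^ n * (∏ i, ‖u i‖) * ‖f‖) ^ 2) := by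
    intro u f
    refine le_trans ?_ (tsum_multiOp_sq_le hq hb0 hbq hL hσ u f)
    gcongr with k
    exact hle u f k
  have hex : ∀ (u : Fin n → Hq q) (f : Hq (q - 1)), ∃ v : Hq b, ∀ k, fourierHat v k =
      ∑' j, multiTerm σ (fun i ↦ fourierHat (u i)) (fourierHat f) k j := by
    intro u f
    refine Hq.exists_of_coeff hb _ (fun k ↦ ?_)
      (ne_top_of_le_ne_top ENNReal.ofReal_ne_top (hbound u f))
    rw [Complex.conj_tsum, ← (Equiv.neg (Fin n → ℤ)).tsum_eq]
    refine tsum_congr fun j ↦ ?_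
    have e : (-k - ∑ i, (-j) i) = -(k - ∑ i, j i) := by
      simp only [Pi.neg_apply, Finset.sum_neg_distrib]; ring
    unfold multiTerm
    rw [Equiv.neg_apply, e, hσr, map_mul, map_mul, map_prod, fourierHat_neg]
    simp only [Pi.neg_apply, fourierHat_neg]
  choose T hT using hex
  have hnorm : ∀ u f, ‖T u f‖ ≤
      L * multiConst q * (4 * 2 ^ (q - 1) * multiConst q) ^ n * (∏ i, ‖u i‖) * ‖f‖ := by
    intro u f
    have h1 := hbound u f
    simp only [← hT] at h1
    have h2 := (T u f).tsum_eq_norm_sq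
    unfold eCoeff at h2
    rw [h2, ← ENNReal.ofReal_pow (norm_nonneg _), ENNReal.ofReal_le_ofReal_iff (by positivity)] at h1
    refine le_of_sq_le_sq h1 ?_
    have : 0 ≤ ∏ i, ‖u i‖ := Finset.prod_nonneg fun i _ ↦ norm_nonneg _
    positivity
  have hsum : ∀ (u : Fin n → Hq q) (f : Hq (q - 1)) (k : ℤ),
      Summable fun j ↦ multiTerm σ (fun i ↦ fourierHat (u i)) (fourierHat f) k j := fun u f k ↦
    (summable_multiTerm hq hb0 hbq hL hσ u f k).of_norm
  let T₁ : (Fin n → Hq q) → Hq (q - 1) →L[ℝ] Hq b := fun u ↦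
    LinearMap.mkContinuous
      { toFun := T u
        map_add' := fun f g ↦ Hq.ext_coeff fun k ↦ by
          rw [Hq.fourierHat_add, hT, hT, hT, ← (hsum u f k).tsum_add (hsum u g k)]
          refine tsum_congr fun j ↦ ?_
          unfold multiTerm
          rw [Hq.fourierHat_add]
          ring
        map_smul' := fun c f ↦ Hq.ext_coeff fun k ↦ by
          rw [RingHom.id_apply, Hq.fourierHat_smul, hT, hT, ← (hsum u f k).tsum_const_smul]
          refine tsum_congr fun j ↦ ?_
          unfold multiTerm
          rw [Hq.fourierHat_smul]
          simp only [Complex.real_smul]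
          ring } _ (hnorm u)
  have hT₁ : ∀ u f, T₁ u f = T u f := fun u f ↦ rfl
  let P : (Fin n → ℤ) → MultilinearMap ℝ (fun _ : Fin n ↦ Hq q) ℂ := fun j ↦
    (MultilinearMap.mkPiAlgebra ℝ (Fin n) ℂ).compLinearMap fun i ↦ Hq.coeffₗ q (j i)
  have hP : ∀ j u, P j u = ∏ i, fourierHat (u i) (j i) := fun j u ↦ rfl
  let T₂ : MultilinearMap ℝ (fun _ : Fin n ↦ Hq q) (Hq (q - 1) →L[ℝ] Hq b) :=
    { toFun := T₁
      map_update_add' := by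
        intro _ u i x y
        have e : ‹DecidableEq (Fin n)› = instDecidableEqFin n := Subsingleton.elim _ _
        subst e
        refine ContinuousLinearMap.ext fun f ↦ ?_
        refine Hq.ext_coeff (u := T _ f) (v := T _ f + T _ f) fun k ↦ ?_
        rw [Hq.fourierHat_add, hT, hT, hT, ← (hsum _ f k).tsum_add (hsum _ f k)]
        refine tsum_congr fun j ↦ ?_
        unfold multiTerm
        rw [← hP, ← hP, ← hP, (P j).map_update_add]
        ring
      map_update_smul' := by
        intro _ u i c x
        have e : ‹DecidableEq (Fin n)› = instDecidableEqFin n := Subsingleton.elim _ _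
        subst e
        refine ContinuousLinearMap.ext fun f ↦ ?_
        refine Hq.ext_coeff (u := T _ f) (v := c • T _ f) fun k ↦ ?_
        rw [Hq.fourierHat_smul, hT, hT, ← (hsum _ f k).tsum_const_smul]
        refine tsum_congr fun j ↦ ?_
        unfold multiTerm
        rw [← hP, ← hP, (P j).map_update_smul]
        simp only [Complex.real_smul]
        ring }
  have hT₂ : ∀ u, ‖T₂ u‖ ≤ L * multiConst q * (4 * 2 ^ (q - 1) * multiConst q) ^ n * ∏ i, ‖u i‖ := by
    intro u
    refine ContinuousLinearMap.opNorm_le_bound _ ?_ (hnorm u)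
    have : 0 ≤ ∏ i, ‖u i‖ := Finset.prod_nonneg fun i _ ↦ norm_nonneg _
    positivity
  exact ⟨T₂.mkContinuous _ hT₂, fun u f k ↦ hT u f k, MultilinearMap.mkContinuous_norm_le _ hC _⟩

end MultiOperator
end

section
open scoped Manifold ContDiff
attribute [-instance] Hq.instModuleReal Hq.instAddCommGroup
open MeasureTheory Filter Topology
open scoped ENNReal NNReal

/-! ### Iterated finite differences -/

section FiniteDifference

/-- The iterated finite difference `∏ᵢ (1 - τ_{jᵢ}) p`. -/
def fdiff : (n : ℕ) → (Fin n → ℤ) → (ℤ → ℂ) → ℤ → ℂ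
  | 0, _, p => p
  | n + 1, j, p => fdiff n (Fin.tail j) fun m ↦ p m - p (m + j 0)

theorem fdiff_neg {n : ℕ} (j : Fin n → ℤ) (p p' : ℤ → ℂ) (hp : ∀ k, p' (-k) = starRingEnd ℂ (p k)) (m : ℤ) :
    fdiff n (-j) p' (-m) = starRingEnd ℂ (fdiff n j p m) := by
  induction n generalizing p p' with
  | zero => exact hp m
  | succ n ih =>
    simp only [fdiff]
    refine ih (Fin.tail j) _ _ fun k ↦ ?_
    rw [map_sub, ← hp, ← hp, Pi.neg_apply, neg_add]

theorem norm_fdiff_le_two_pow {n : ℕ} (j : Fin n → ℤ) (p : ℤ → ℂ) {B : ℝ} (hp : ∀ k, ‖p k‖ ≤ B) (m : ℤ) :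
    ‖fdiff n j p m‖ ≤ 2 ^ n * B := by
  induction n generalizing p B with
  | zero => simpa [fdiff] using hp m
  | succ n ih =>
    refine (ih (Fin.tail j) _ (B := 2 * B) fun k ↦ ?_).trans (le_of_eq (by ring))
    exact (norm_sub_le _ _).trans (by linarith [hp k, hp (k + j 0)])

theorem tendsto_fdiff {ι : Type*} {l : Filter ι} {n : ℕ} (j : Fin n → ℤ) {P : ι → ℤ → ℂ} {p : ℤ → ℂ}
    (h : ∀ k, Tendsto (fun i ↦ P i k) l (𝓝 (p k))) (m : ℤ) :
    Tendsto (fun i ↦ fdiff n j (P i) m) l (𝓝 (fdiff n j p m)) := by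
  induction n generalizing P p with
  | zero => exact h m
  | succ n ih => exact ih (Fin.tail j) fun k ↦ (h k).sub (h _)

/-- The mean value inequality for iterated finite differences. -/
theorem norm_fdiff_le {ρ : ℝ} (hρ : 0 ≤ ρ) (n : ℕ) : ∀ {P : ℕ → ℝ → ℂ} {c L : ℝ}, 0 ≤ c → 0 ≤ L →
    (∀ i ξ, HasDerivAt (P i) (P (i + 1) ξ) ξ) → (∀ ξ, ‖P n ξ‖ ≤ L * (c + |ξ|) ^ ρ) →
    ∀ (j : Fin n → ℤ) (m : ℤ),
      ‖fdiff n j (fun k ↦ P 0 k) m‖ ≤ L * (∏ i, |(j i : ℝ)|) * (c + |(m : ℝ)| + ∑ i, |(j i : ℝ)|) ^ ρ := by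
  induction n with
  | zero => intro P c L _ _ _ hb j m; simpa [fdiff] using hb m
  | succ n ih =>
    intro P c L hc hL hP hb j m
    simp only [fdiff]
    -- The induction hypothesis is applied to the first difference. Its `n`-th derivative is at most
    -- `|j 0|` times the supremum of `P (n + 1)` over the segment; enlarging `c` by `|j 0|` absorbs
    -- the shift of the argument.
    have h := ih (P := fun i ξ ↦ P i ξ - P i (ξ + j 0)) (c := c + |(j 0 : ℝ)|) (L := L * |(j 0 : ℝ)|)
      (by positivity) (by positivity) (fun i ξ ↦ (hP i ξ).sub ((hP i _).comp_add_const ξ _)) (fun ξ ↦ ?_)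
      (Fin.tail j) m
    · refine (le_of_eq ?_).trans (h.trans (le_of_eq ?_))
      · congr 2; funext k; push_cast; rfl
      · rw [Fin.prod_univ_succ, Fin.sum_univ_succ]
        simp only [Fin.tail]
        ring_nf
    · have hseg : ∀ x ∈ Set.uIcc (ξ + j 0) ξ, ‖P (n + 1) x‖ ≤ L * (c + |(j 0 : ℝ)| + |ξ|) ^ ρ := by
        intro x hx
        refine (hb x).trans ?_
        have h1 : |x - ξ| ≤ |(j 0 : ℝ)| := by
          have := Set.abs_sub_right_of_mem_uIcc hx
          rwa [abs_sub_comm, sub_add_cancel_left, abs_neg] at this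
        have h2 : |x| ≤ |ξ| + |x - ξ| := by
          have := abs_add_le ξ (x - ξ); simpa using this
        exact mul_le_mul_of_nonneg_left (Real.rpow_le_rpow (by positivity) (by linarith) hρ) hL
      have := (convex_uIcc (ξ + j 0) ξ).norm_image_sub_le_of_norm_hasDerivWithin_le
        (fun x _ ↦ (hP n x).hasDerivWithinAt) hseg Set.left_mem_uIcc Set.right_mem_uIcc
      refine this.trans (le_of_eq ?_)
      rw [sub_add_cancel_left, norm_neg, Real.norm_eq_abs]; ring

end FiniteDifference

/-! ### Symbol estimates for `Λ^{2s}` by Cauchy's inequality -/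

section Symbol

/-- The function `((1 + z²)^s - 1) exp(-εz²) (2πiz)^n`. -/
noncomputable def symbolFun (s ε : ℝ) (n : ℕ) (z : ℂ) : ℂ :=
  ((1 + z ^ 2) ^ (s : ℂ) - 1) * Complex.exp (-(ε * z ^ 2)) * (2 * Real.pi * Complex.I * z) ^ n

/-- On discs whose radius is a fixed fraction of `1 + |ξ|`, the number `1 + z²` stays in the right
half plane, where the complex power is holomorphic, and `exp(-εz²)` stays bounded uniformly for `ε ∈
[0, 1]`. -/
theorem cone_estimates {ξ : ℝ} {z : ℂ} (hz : ‖z - ξ‖ ≤ (1 + |ξ|) / 4) :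
    ‖z‖ ≤ 2 * (1 + |ξ|) ∧ -(1 / 4) ≤ (z ^ 2).re := by
  have h0 := abs_nonneg ξ
  constructor
  · have := norm_add_le (z - ξ) (ξ : ℂ)
    rw [sub_add_cancel, Complex.norm_real, Real.norm_eq_abs] at this
    linarith
  · have h1 := (Complex.abs_re_le_norm (z - ξ)).trans hz
    have h2 := (Complex.abs_im_le_norm (z - ξ)).trans hz
    simp only [Complex.sub_re, Complex.ofReal_re, Complex.sub_im, Complex.ofReal_im, sub_zero] at h1 h2
    have e : (z ^ 2).re = z.re ^ 2 - z.im ^ 2 := by rw [sq, Complex.mul_re]; ring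
    rw [e, ← sq_abs z.re, ← sq_abs z.im]
    have h3 : |ξ| - |z.re - ξ| ≤ |z.re| := by
      have := abs_sub_abs_le_abs_sub ξ z.re
      rw [abs_sub_comm] at this; linarith
    have h4 := abs_nonneg z.im
    rcases le_total 1 |ξ| with h | h
    · have h5 : |z.im| ≤ |z.re| := by linarith
      nlinarith [abs_nonneg z.re]
    · have h5 : |z.im| ≤ 1 / 2 := by linarith
      nlinarith [sq_nonneg |z.re|]

theorem differentiableAt_symbolFun (s ε : ℝ) (n : ℕ) {z : ℂ} (hz : -1 < (z ^ 2).re) :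
    DifferentiableAt ℂ (symbolFun s ε n) z := by
  have h1 : 1 + z ^ 2 ∈ Complex.slitPlane := Or.inl (by
    rw [Complex.add_re, Complex.one_re]; linarith)
  unfold symbolFun
  refine DifferentiableAt.mul (DifferentiableAt.mul (DifferentiableAt.sub ?_ (by fun_prop)) (by fun_prop))
    (by fun_prop)
  exact DifferentiableAt.cpow (by fun_prop) (by fun_prop) h1

theorem norm_symbolFun_le {s ε : ℝ} (hs : 0 ≤ s) (hε : ε ∈ Set.Icc (0 : ℝ) 1) (n : ℕ) {ξ : ℝ} {z : ℂ}
    (hz : ‖z - ξ‖ ≤ (1 + |ξ|) / 4) :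
    ‖symbolFun s ε n z‖ ≤ 2 * (5 ^ s + 1) * (1 + |ξ|) ^ (2 * s) * (4 * Real.pi * (1 + |ξ|)) ^ n := by
  obtain ⟨h1, h2⟩ := cone_estimates hz
  set R := 1 + |ξ|
  have hR : 1 ≤ R := by simp only [R]; linarith [abs_nonneg ξ]
  have a1 : ‖(1 + z ^ 2) ^ (s : ℂ) - 1‖ ≤ (5 ^ s + 1) * R ^ (2 * s) := by
    have b0 : 1 + z ^ 2 ≠ 0 := fun h ↦ by
      have := congrArg Complex.re h
      rw [Complex.add_re, Complex.one_re, Complex.zero_re] at this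
      linarith
    have b1 : ‖(1 + z ^ 2) ^ (s : ℂ)‖ = ‖1 + z ^ 2‖ ^ s := by
      rw [Complex.norm_cpow_of_ne_zero b0]; simp
    have b2 : ‖1 + z ^ 2‖ ≤ 5 * R ^ 2 := by
      refine (norm_add_le _ _).trans ?_
      rw [norm_one, norm_pow]
      nlinarith [norm_nonneg z]
    have b3 : ‖1 + z ^ 2‖ ^ s ≤ 5 ^ s * R ^ (2 * s) := by
      refine (Real.rpow_le_rpow (norm_nonneg _) b2 hs).trans (le_of_eq ?_)
      rw [Real.mul_rpow (by norm_num) (by positivity), ← Real.rpow_natCast, ← Real.rpow_mul (by positivity)]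
      norm_num
    have b4 : 1 ≤ R ^ (2 * s) := Real.one_le_rpow hR (by linarith)
    refine (norm_sub_le _ _).trans ?_
    rw [b1, norm_one]
    linarith
  have a2 : ‖Complex.exp (-(ε * z ^ 2))‖ ≤ 2 := by
    rw [Complex.norm_exp]
    have : (-(ε * z ^ 2) : ℂ).re ≤ 1 / 4 := by
      rw [Complex.neg_re, Complex.re_ofReal_mul]
      nlinarith [hε.1, hε.2]
    refine (Real.exp_le_exp.mpr this).trans ?_
    have h3 := Real.exp_one_lt_d9
    have h4 : Real.exp (1 / 4) ≤ Real.exp (Real.log 2) := Real.exp_le_exp.mpr (by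
      linarith [Real.log_two_gt_d9])
    rwa [Real.exp_log (by norm_num)] at h4
  have a3 : ‖(2 * Real.pi * Complex.I * z) ^ n‖ ≤ (4 * Real.pi * R) ^ n := by
    rw [norm_pow]
    refine pow_le_pow_left₀ (norm_nonneg _) ?_ n
    simp only [norm_mul, Complex.norm_I, Complex.norm_ofNat, Complex.norm_real, Real.norm_eq_abs,
      abs_of_pos Real.pi_pos, mul_one]
    nlinarith [Real.pi_pos]
  unfold symbolFun
  rw [norm_mul, norm_mul]
  calc _ ≤ (5 ^ s + 1) * R ^ (2 * s) * 2 * (4 * Real.pi * R) ^ n := by gcongr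
    _ = _ := by ring

/-- Cauchy's estimate on the circle of radius `R/4`, `R = 1 + |ξ|`. The growth `R^{2s+n}` on the
circle against `R^{-(n+1)}` leaves `R^{2s-1}`, with a constant `n!`-like up to a geometric factor
and independent of `ε`. -/
theorem norm_iteratedDeriv_symbolFun_le {s ε : ℝ} (hs : 0 ≤ s) (hε : ε ∈ Set.Icc (0 : ℝ) 1) (n : ℕ) (ξ : ℝ) :
    ‖iteratedDeriv (n + 1) (symbolFun s ε n) ξ‖ ≤
      (n + 1).factorial * (2 * (5 ^ s + 1) * (16 * Real.pi) ^ (n + 1)) * (1 + |ξ|) ^ (2 * s - 1) := by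
  set R := 1 + |ξ|
  have hR : 1 ≤ R := by simp only [R]; linarith [abs_nonneg ξ]
  have hR4 : 0 < R / 4 := by positivity
  have h := Complex.norm_iteratedDeriv_le_of_forall_mem_sphere_norm_le (n + 1) hR4
    (c := (ξ : ℂ)) (f := symbolFun s ε n) (C := 2 * (5 ^ s + 1) * R ^ (2 * s) * (4 * Real.pi * R) ^ n)
    (DifferentiableOn.diffContOnCl (fun z hz ↦ by
      rw [closure_ball _ hR4.ne', Metric.mem_closedBall, dist_eq_norm] at hz
      exact (differentiableAt_symbolFun s ε n (by
        have := (cone_estimates hz).2; linarith)).differentiableWithinAt))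
    (fun z hz ↦ norm_symbolFun_le hs hε n (by
      rw [mem_sphere_iff_norm] at hz; exact hz.le))
  refine h.trans ?_
  have e1 : R ^ (2 * s) = R ^ (2 * s - 1) * R := by
    rw [← Real.rpow_add_one (by positivity)]; congr 1; ring
  have e2 : (4 * Real.pi * R) ^ n * R / (R / 4) ^ (n + 1) = 4 * (16 * Real.pi) ^ n := by
    rw [div_pow, mul_pow, mul_pow 16, show (16 : ℝ) = 4 * 4 by norm_num, mul_pow 4 4]
    field_simp
    ring
  calc (n + 1).factorial * (2 * (5 ^ s + 1) * R ^ (2 * s) * (4 * Real.pi * R) ^ n) / (R / 4) ^ (n + 1)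
      = (n + 1).factorial * (2 * (5 ^ s + 1)) * ((4 * Real.pi * R) ^ n * R / (R / 4) ^ (n + 1)) *
          R ^ (2 * s - 1) := by rw [e1]; ring
    _ = (n + 1).factorial * (2 * (5 ^ s + 1) * (4 * (16 * Real.pi) ^ n)) * R ^ (2 * s - 1) := by
        rw [e2]; ring
    _ ≤ _ := by
        gcongr
        rw [pow_succ']
        gcongr
        linarith [Real.pi_gt_three]

/-- The (regularized) symbol `((1 + k²)^s - 1) / (2πik) · exp(-εk²)`. -/
noncomputable def bSymbol (s ε : ℝ) (k : ℤ) : ℂ :=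
  (sobolevWeight s k - 1 : ℝ) / (2 * Real.pi * Complex.I * k) * (Real.exp (-(ε * (k : ℝ) ^ 2)) : ℝ)

/-- The symbol `b(k) (2πik)^n`. -/
noncomputable def pSymbol (s ε : ℝ) (n : ℕ) (k : ℤ) : ℂ := bSymbol s ε k * (2 * Real.pi * Complex.I * k) ^ n

/-- One factor `2πik` cancels the denominator of `bSymbol`, so the symbol extends holomorphically
near the real line. At `k = 0`, where the quotient is a default value, both sides vanish. -/
theorem pSymbol_succ (s ε : ℝ) (n : ℕ) (k : ℤ) : pSymbol s ε (n + 1) k = symbolFun s ε n ((k : ℝ) : ℂ) := by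
  have e : (((1 : ℂ) + ((k : ℝ) : ℂ) ^ 2) ^ (s : ℂ)) = (sobolevWeight s k : ℂ) := by
    rw [sobolevWeight, Complex.ofReal_cpow (by positivity)]; push_cast; rfl
  unfold pSymbol bSymbol symbolFun
  rw [e]
  rcases eq_or_ne k 0 with rfl | hk
  · simp [sobolevWeight]
  · have hk' : (2 * Real.pi * Complex.I * k : ℂ) ≠ 0 := by
      simp [hk, Real.pi_ne_zero]
    push_cast
    field_simp
    ring

theorem bSymbol_neg (s ε : ℝ) (k : ℤ) : bSymbol s ε (-k) = starRingEnd ℂ (bSymbol s ε k) := by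
  unfold bSymbol
  rw [sobolevWeight_neg_int]
  simp only [map_mul, map_div₀, Complex.conj_ofReal, Complex.conj_I, map_intCast, map_ofNat, Int.cast_neg, neg_sq]
  ring

theorem pSymbol_neg (s ε : ℝ) (n : ℕ) (k : ℤ) : pSymbol s ε n (-k) = starRingEnd ℂ (pSymbol s ε n k) := by
  unfold pSymbol
  rw [bSymbol_neg]
  simp [map_ofNat]

theorem norm_bSymbol_le {s ε : ℝ} (hs : 0 ≤ s) (hε : 0 ≤ ε) (k : ℤ) :
    ‖bSymbol s ε k‖ ≤ (1 + |(k : ℝ)|) ^ (2 * s - 1) := by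
  rcases eq_or_ne k 0 with rfl | hk
  · simp [bSymbol]
  have hk1 : (1 : ℝ) ≤ |(k : ℝ)| := by exact_mod_cast Int.one_le_abs hk
  unfold bSymbol
  have h1 : ‖((Real.exp (-(ε * (k : ℝ) ^ 2)) : ℝ) : ℂ)‖ ≤ 1 := by
    rw [Complex.norm_real, Real.norm_eq_abs, abs_of_pos (Real.exp_pos _), Real.exp_le_one_iff]
    have := mul_nonneg hε (sq_nonneg (k : ℝ)); linarith
  have h2 : ‖((sobolevWeight s k - 1 : ℝ) : ℂ)‖ ≤ (1 + |(k : ℝ)|) ^ (2 * s) := by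
    rw [Complex.norm_real, Real.norm_eq_abs, abs_of_nonneg (by linarith [one_le_sobolevWeight hs k])]
    have e : (1 + |(k : ℝ)|) ^ (2 * s) = ((1 + |(k : ℝ)|) ^ 2) ^ s := by
      rw [← Real.rpow_natCast, ← Real.rpow_mul (by positivity)]; norm_num
    have : sobolevWeight s k ≤ (1 + |(k : ℝ)|) ^ (2 * s) := by
      rw [e]
      refine Real.rpow_le_rpow (by positivity) ?_ hs
      nlinarith [sq_abs (k : ℝ)]
    linarith
  have h3 : ‖(2 * Real.pi * Complex.I * k : ℂ)‖ = 2 * Real.pi * |(k : ℝ)| := by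
    simp [abs_of_pos Real.pi_pos]
  rw [norm_mul, norm_div, h3]
  have h4 : 1 + |(k : ℝ)| ≤ 2 * Real.pi * |(k : ℝ)| := by nlinarith [Real.pi_gt_three]
  calc _ ≤ (1 + |(k : ℝ)|) ^ (2 * s) / (1 + |(k : ℝ)|) * 1 := by gcongr
    _ = _ := by rw [mul_one, Real.rpow_sub_one (by positivity)]

/-- The constant in the estimate of the symbol of the `n`-fold commutator. -/
noncomputable def symbolConst (s : ℝ) (n : ℕ) : ℝ := n.factorial * (2 * (5 ^ s + 1) * (16 * Real.pi) ^ n)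

theorem symbolConst_nonneg (s : ℝ) (n : ℕ) : 0 ≤ symbolConst s n := by
  unfold symbolConst; have := Real.pi_pos; positivity

/-- For `n ≥ 1` the mean value inequality for differences meets the Cauchy bounds; the hypothesis `s
≥ 1/2` makes the exponent `2s - 1` nonnegative, as the former requires. For `n = 0` the symbol is
bounded directly. Uniformity in `ε` is needed to remove the cutoff. -/
theorem symbolBound_fdiff {s ε : ℝ} (hs : 1 / 2 ≤ s) (hε : ε ∈ Set.Icc (0 : ℝ) 1) (n : ℕ) :
    SymbolBound (fun j : Fin n → ℤ ↦ fdiff n j (pSymbol s ε n)) (2 * s - 1) (symbolConst s n) := by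
  intro j m
  cases n with
  | zero =>
    have h := norm_bSymbol_le (by linarith) hε.1 m (s := s)
    have h2 : 1 ≤ symbolConst s 0 := by
      have : (0 : ℝ) < 5 ^ s := by positivity
      simp [symbolConst]; linarith
    simp only [fdiff, pSymbol, pow_zero, mul_one, Finset.univ_eq_empty, Finset.prod_empty, freqSize,
      Finset.sum_empty, add_zero]
    exact h.trans (le_mul_of_one_le_left (by positivity) h2)
  | succ n =>
    have e : pSymbol s ε (n + 1) = fun k : ℤ ↦ (fun i (ξ : ℝ) ↦ iteratedDeriv i (symbolFun s ε n) ξ) 0 (k : ℝ) := by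
      funext k; rw [pSymbol_succ]; simp
    simp only [e]
    refine norm_fdiff_le (ρ := 2 * s - 1) (P := fun i (ξ : ℝ) ↦ iteratedDeriv i (symbolFun s ε n) ξ)
      (c := 1) (L := symbolConst s (n + 1)) (by linarith) (n + 1) zero_le_one (symbolConst_nonneg _ _) (fun i ξ ↦ ?_)
      (norm_iteratedDeriv_symbolFun_le (by linarith) hε n) j m
    have ha : AnalyticAt ℂ (symbolFun s ε n) (ξ : ℂ) := by
      have ho : IsOpen {z : ℂ | -1 < (z ^ 2).re} :=
        isOpen_lt continuous_const (Complex.continuous_re.comp (continuous_pow 2))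
      refine DifferentiableOn.analyticAt (s := {z : ℂ | -1 < (z ^ 2).re})
        (fun z hz ↦ (differentiableAt_symbolFun s ε n hz).differentiableWithinAt) (ho.mem_nhds ?_)
      change -1 < (((ξ : ℂ)) ^ 2).re
      rw [← Complex.ofReal_pow, Complex.ofReal_re]
      linarith [sq_nonneg ξ]
    have hd : HasDerivAt (iteratedDeriv i (symbolFun s ε n)) (iteratedDeriv (i + 1) (symbolFun s ε n) ξ) (ξ : ℂ) := by
      rw [iteratedDeriv_succ]
      have h3 : AnalyticAt ℂ (iteratedDeriv i (symbolFun s ε n)) (ξ : ℂ) := by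
        rw [iteratedDeriv_eq_iterate]; exact ha.iterated_deriv i
      exact h3.differentiableAt.hasDerivAt
    exact hd.comp_ofReal

theorem symbolReal_fdiff (s ε : ℝ) (n : ℕ) : SymbolReal (fun j : Fin n → ℤ ↦ fdiff n j (pSymbol s ε n)) :=
  fun j m ↦ fdiff_neg j _ _ (pSymbol_neg s ε n) m

end Symbol
end

section
open scoped Manifold ContDiff
attribute [-instance] Hq.instModuleReal Hq.instAddCommGroup
open MeasureTheory Filter Topology
open scoped ENNReal NNReal

/-! ### Pointwise values of the multilinear operators -/

section TotalSum

variable {q b ρ L : ℝ} {n : ℕ} {σ : (Fin n → ℤ) → ℤ → ℂ}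

/-- The largest symbol which satisfies `SymbolBound`. -/
noncomputable def majorantSymbol (n : ℕ) (ρ L : ℝ) (j : Fin n → ℤ) (m : ℤ) : ℂ :=
  (L * (∏ i, |(j i : ℝ)|) * freqSize j m ^ ρ : ℝ)

theorem norm_majorantSymbol (hL : 0 ≤ L) (j : Fin n → ℤ) (m : ℤ) :
    ‖majorantSymbol n ρ L j m‖ = L * (∏ i, |(j i : ℝ)|) * freqSize j m ^ ρ := by
  have h1 := one_le_freqSize j m
  have h2 : 0 ≤ ∏ i, |(j i : ℝ)| := Finset.prod_nonneg fun i _ ↦ abs_nonneg _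
  rw [majorantSymbol, Complex.norm_real, Real.norm_eq_abs, abs_of_nonneg (by positivity)]

theorem symbolBound_majorantSymbol (hL : 0 ≤ L) : SymbolBound (majorantSymbol n ρ L) ρ L :=
  fun j m ↦ (norm_majorantSymbol hL j m).le

theorem SymbolBound.norm_multiTerm_le (hσ : SymbolBound σ ρ L) (hL : 0 ≤ L) (u : Fin n → ℤ → ℂ) (f : ℤ → ℂ)
    (k : ℤ) (j : Fin n → ℤ) :
    ‖multiTerm σ u f k j‖ ≤ ‖multiTerm (majorantSymbol n ρ L) u f k j‖ := by
  unfold multiTerm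
  rw [norm_mul, norm_mul (majorantSymbol n ρ L j _), norm_majorantSymbol hL]
  exact mul_le_mul_of_nonneg_right (hσ _ _) (norm_nonneg _)

/-- Because `b > 1/2`, the weights `(1 + k²)^{-b}` are summable, and Cauchy–Schwarz turns the `H^b`
estimate into absolute convergence over all frequencies at once. -/
theorem tsum_tsum_enorm_multiTerm_le (hq : 3 / 2 < q) (hb : 1 / 2 < b) (hbq : ρ + b = q - 1) (hL : 0 ≤ L)
    (hσ : SymbolBound σ ρ L) (u : Fin n → Hq q) (f : Hq (q - 1)) :
    ∑' x : ℤ × (Fin n → ℤ), ‖multiTerm σ (fun i ↦ fourierHat (u i)) (fourierHat f) x.1 x.2‖ₑ ≤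
      ENNReal.ofReal (√(2 * ∑' k, sobolevWeight (-b) k) *
        (L * multiConst q * (4 * 2 ^ (q - 1) * multiConst q) ^ n * (∏ i, ‖u i‖) * ‖f‖)) := by
  have h0 : 0 ≤ ∏ i, ‖u i‖ := Finset.prod_nonneg fun i _ ↦ norm_nonneg _
  have h1 := multiConst_pos q
  have hS : 0 ≤ ∑' k, sobolevWeight (-b) k := tsum_nonneg fun k ↦ (sobolevWeight_pos _ _).le
  rw [ENNReal.tsum_prod']
  set X : ℤ → ℝ≥0∞ := fun k ↦ ∑' j, ‖multiTerm σ (fun i ↦ fourierHat (u i)) (fourierHat f) k j‖ₑ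
  have h := tsum_multiOp_sq_le hq (by linarith : 0 ≤ b) hbq hL hσ u f
  have hw : ∀ k, eWeight (-b) k * eWeight b k = 1 := fun k ↦ by
    unfold eWeight
    rw [← ENNReal.ofReal_mul (sobolevWeight_pos _ _).le, ← sobolevWeight_add]
    simp [sobolevWeight]
  have hw2 : ∀ k, eWeight (b / 2) k ^ 2 = eWeight b k := fun k ↦ by
    unfold eWeight
    rw [← ENNReal.ofReal_pow (sobolevWeight_pos _ _).le, Hq.weight_half_sq]
  have h2 := ENNReal.tsum_mul_sq_le (eWeight (-b)) fun k ↦ eWeight b k * X k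
  have e1 : ∀ k, eWeight (-b) k * (eWeight b k * X k) = X k := fun k ↦ by rw [← mul_assoc, hw, one_mul]
  have e2 : ∀ k, eWeight (-b) k * (eWeight b k * X k) ^ 2 = (eWeight (b / 2) k * X k) ^ 2 := fun k ↦ by
    rw [mul_pow, mul_pow, hw2, sq (eWeight b k), ← mul_assoc, ← mul_assoc, hw, one_mul]
  simp only [e1, e2] at h2
  have e3 : ∑' k, eWeight (-b) k = ENNReal.ofReal (∑' k, sobolevWeight (-b) k) := by
    rw [ENNReal.ofReal_tsum_of_nonneg (fun k ↦ (sobolevWeight_pos _ _).le)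
      (summable_sobolevWeight (by linarith))]
    rfl
  have h3 : (∑' k, X k) ^ 2 ≤ ENNReal.ofReal (√(2 * ∑' k, sobolevWeight (-b) k) *
        (L * multiConst q * (4 * 2 ^ (q - 1) * multiConst q) ^ n * (∏ i, ‖u i‖) * ‖f‖)) ^ 2 := by
    refine h2.trans ?_
    rw [← ENNReal.ofReal_pow (by positivity), mul_pow, Real.sq_sqrt (by positivity),
      ENNReal.ofReal_mul (by positivity), ENNReal.ofReal_mul (by norm_num), e3, mul_assoc, ENNReal.ofReal_ofNat]
    gcongr
  exact (ENNReal.pow_le_pow_left_iff two_ne_zero).mp h3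

theorem summable_multiTerm_prod (hq : 3 / 2 < q) (hb : 1 / 2 < b) (hbq : ρ + b = q - 1) (hL : 0 ≤ L)
    (hσ : SymbolBound σ ρ L) (u : Fin n → Hq q) (f : Hq (q - 1)) :
    Summable fun x : ℤ × (Fin n → ℤ) ↦
      ‖multiTerm σ (fun i ↦ fourierHat (u i)) (fourierHat f) x.1 x.2‖ := by
  rw [summable_iff_tsum_ofReal_ne_top fun _ ↦ norm_nonneg _]
  simp only [ofReal_norm]
  exact ne_top_of_le_ne_top ENNReal.ofReal_ne_top (tsum_tsum_enorm_multiTerm_le hq hb hbq hL hσ u f)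

theorem tsum_norm_multiTerm_le (hq : 3 / 2 < q) (hb : 1 / 2 < b) (hbq : ρ + b = q - 1) (hL : 0 ≤ L)
    (hσ : SymbolBound σ ρ L) (u : Fin n → Hq q) (f : Hq (q - 1)) :
    ∑' x : ℤ × (Fin n → ℤ), ‖multiTerm σ (fun i ↦ fourierHat (u i)) (fourierHat f) x.1 x.2‖ ≤
      √(2 * ∑' k, sobolevWeight (-b) k) *
        (L * multiConst q * (4 * 2 ^ (q - 1) * multiConst q) ^ n * (∏ i, ‖u i‖) * ‖f‖) := by
  have h0 : 0 ≤ ∏ i, ‖u i‖ := Finset.prod_nonneg fun i _ ↦ norm_nonneg _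
  have h1 := multiConst_pos q
  have h := tsum_tsum_enorm_multiTerm_le hq hb hbq hL hσ u f
  simp only [← ofReal_norm] at h
  rw [← ENNReal.ofReal_tsum_of_nonneg (fun _ ↦ norm_nonneg _)
    (summable_multiTerm_prod hq hb hbq hL hσ u f)] at h
  exact (ENNReal.ofReal_le_ofReal_iff (by positivity)).mp h

/-- The value at `x` of the multilinear operator with symbol `σ`. -/
noncomputable def multiSum (σ : (Fin n → ℤ) → ℤ → ℂ) (u : Fin n → ℤ → ℂ) (f : ℤ → ℂ) (x : UnitAddCircle) : ℂ :=
  ∑' y : ℤ × (Fin n → ℤ), multiTerm σ u f y.1 y.2 * fourier y.1 x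

theorem norm_fourier_apply (k : ℤ) (x : UnitAddCircle) : ‖fourier k x‖ = 1 := by
  rw [fourier_apply, Circle.norm_coe]

theorem eval_eq_multiSum (hq : 3 / 2 < q) (hb : 1 / 2 < b) (hbq : ρ + b = q - 1) (hL : 0 ≤ L)
    (hσ : SymbolBound σ ρ L) (u : Fin n → Hq q) (f : Hq (q - 1)) {g : Hq b}
    (hg : ∀ k, fourierHat g k = ∑' j, multiTerm σ (fun i ↦ fourierHat (u i)) (fourierHat f) k j)
    (x : UnitAddCircle) :
    (g x : ℂ) = multiSum σ (fun i ↦ fourierHat (u i)) (fourierHat f) x := by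
  have hs : Summable fun y : ℤ × (Fin n → ℤ) ↦
      multiTerm σ (fun i ↦ fourierHat (u i)) (fourierHat f) y.1 y.2 * fourier y.1 x :=
    Summable.of_norm ((summable_multiTerm_prod hq hb hbq hL hσ u f).congr fun y ↦ by
      rw [norm_mul, norm_fourier_apply, mul_one])
  rw [← (g.hasSum_coeff hb x).tsum_eq, multiSum, hs.tsum_prod]
  refine tsum_congr fun k ↦ ?_
  rw [hg]
  exact tsum_mul_right.symm

theorem norm_multiSum_le (hq : 3 / 2 < q) (hb : 1 / 2 < b) (hbq : ρ + b = q - 1) (hL : 0 ≤ L)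
    (hσ : SymbolBound σ ρ L) (u : Fin n → Hq q) (f : Hq (q - 1)) (x : UnitAddCircle) :
    ‖multiSum σ (fun i ↦ fourierHat (u i)) (fourierHat f) x‖ ≤
      √(2 * ∑' k, sobolevWeight (-b) k) *
        (L * multiConst q * (4 * 2 ^ (q - 1) * multiConst q) ^ n * (∏ i, ‖u i‖) * ‖f‖) := by
  refine le_trans ?_ (tsum_norm_multiTerm_le hq hb hbq hL hσ u f)
  refine tsum_of_norm_bounded (summable_multiTerm_prod hq hb hbq hL hσ u f).hasSum fun y ↦ ?_
  rw [norm_mul, norm_fourier_apply, mul_one]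

/-- Dominated convergence, the majorant being the term with the largest admissible symbol. It serves
to let the Gaussian cutoff tend to `1`. -/
theorem tendsto_multiSum (hq : 3 / 2 < q) (hb : 1 / 2 < b) (hbq : ρ + b = q - 1) (hL : 0 ≤ L)
    {ι : Type*} {l : Filter ι} {τ : ι → (Fin n → ℤ) → ℤ → ℂ} (hτ : ∀ᶠ i in l, SymbolBound (τ i) ρ L)
    (hlim : ∀ j m, Tendsto (fun i ↦ τ i j m) l (𝓝 (σ j m)))
    (u : Fin n → Hq q) (f : Hq (q - 1)) (x : UnitAddCircle) :
    Tendsto (fun i ↦ multiSum (τ i) (fun i ↦ fourierHat (u i)) (fourierHat f) x) l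
      (𝓝 (multiSum σ (fun i ↦ fourierHat (u i)) (fourierHat f) x)) := by
  refine tendsto_tsum_of_dominated_convergence
    (summable_multiTerm_prod hq hb hbq hL (symbolBound_majorantSymbol hL) u f) (fun y ↦ ?_) ?_
  · unfold multiTerm
    exact ((hlim _ _).mul_const _).mul_const _
  · filter_upwards [hτ] with i hi y
    rw [norm_mul, norm_fourier_apply, mul_one]
    exact hi.norm_multiTerm_le hL _ _ _ _

end TotalSum

/-! ### From kernels `∏ (uᵢ(x) - uᵢ(y))` to finite differences of the symbol -/

section Kernel

variable {q : ℝ} {n : ℕ}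

/-- The function `y ↦ ∏ᵢ (uᵢ(x) - uᵢ(y)) f(y)`. -/
noncomputable def kernelFun (u : Fin n → Hq q) (f : C(UnitAddCircle, ℝ)) (x : UnitAddCircle) :
    C(UnitAddCircle, ℝ) :=
  (∏ i, (ContinuousMap.const _ (u i x) - Hq.toC (u i))) * f

/-- One factor `u₀(x) - u₀(y)` is split off and `u₀` expanded in its Fourier series: its value at
`x` multiplies by `e_a(x)`, its value at `y` shifts the frequency by `a`. -/
theorem fourierHat_kernelFun_succ (hq : 1 / 2 < q) (u : Fin (n + 1) → Hq q) (f : C(UnitAddCircle, ℝ))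
    (x : UnitAddCircle) (k : ℤ) :
    fourierHat (kernelFun u f x) k = ∑' a, fourierHat (u 0) a *
      (fourier a x * fourierHat (kernelFun (Fin.tail u) f x) k - fourierHat (kernelFun (Fin.tail u) f x) (k - a)) := by
  set g := kernelFun (Fin.tail u) f x
  have e : kernelFun u f x = (u 0 x) • g + (-1 : ℝ) • (Hq.toC (u 0) * g) := by
    ext y
    simp only [kernelFun, Fin.prod_univ_succ, g, Fin.tail, ContinuousMap.add_apply, ContinuousMap.smul_apply,
      ContinuousMap.mul_apply, ContinuousMap.sub_apply, ContinuousMap.const_apply, smul_eq_mul]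
    ring
  have hsu := Hq.summable_norm_coeff hq (u 0)
  have s1 : Summable fun a ↦ fourierHat (u 0) a * fourier a x := ((u 0).hasSum_coeff hq x).summable
  have s2 : Summable fun a ↦ fourierHat (u 0) a * fourierHat g (k - a) := by
    refine Summable.of_norm_bounded (hsu.mul_right ‖g‖) fun a ↦ ?_
    rw [norm_mul]
    gcongr
    exact norm_coeff_le g _
  rw [e, coeff_add, coeff_smul, coeff_smul, Hq.fourierHat_mul hq, ← ((u 0).hasSum_coeff hq x).tsum_eq,
    ← tsum_mul_right]
  push_cast
  rw [neg_one_mul, ← sub_eq_add_neg, ← (s1.mul_right _).tsum_sub s2]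
  exact tsum_congr fun a ↦ by ring

theorem summable_prod_fin {n : ℕ} {a : Fin n → ℤ → ℝ} (h0 : ∀ i k, 0 ≤ a i k) (h : ∀ i, Summable (a i)) :
    Summable fun j : Fin n → ℤ ↦ ∏ i, a i (j i) := by
  induction n with
  | zero => exact (hasSum_fintype _).summable
  | succ n ih =>
    rw [← (Fin.consEquiv (fun _ : Fin (n + 1) ↦ ℤ)).summable_iff]
    refine ((h 0).mul_of_nonneg (ih (fun i k ↦ h0 i.succ k) fun i ↦ h i.succ) (h0 0)
      fun j ↦ Finset.prod_nonneg fun i _ ↦ h0 _ _).congr fun y ↦ ?_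
    simp [Fin.consEquiv, Fin.prod_univ_succ]

theorem summable_kernelTerm (hq : 1 / 2 < q) {f : C(UnitAddCircle, ℝ)} (hf : Summable fun k ↦ ‖fourierHat f k‖)
    (x : UnitAddCircle) (u : Fin n → Hq q) {p : ℤ → ℂ} {B : ℝ} (hp : ∀ k, ‖p k‖ ≤ B) :
    Summable fun y : (Fin n → ℤ) × ℤ ↦ (∏ i, fourierHat (u i) (y.1 i) * fourier (y.1 i) x) *
      (fdiff n y.1 p y.2 * (fourierHat f y.2 * fourier y.2 x)) := by
  have h1 := summable_prod_fin (a := fun i k ↦ ‖fourierHat (u i) k‖) (fun i k ↦ norm_nonneg _)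
    fun i ↦ (u i).summable_norm_coeff hq
  refine Summable.of_norm_bounded ((h1.mul_of_nonneg hf
    (fun j ↦ Finset.prod_nonneg fun i _ ↦ norm_nonneg _) fun k ↦ norm_nonneg _).mul_left (2 ^ n * B)) fun y ↦ ?_
  have h2 : 0 ≤ ∏ i, ‖fourierHat (u i) (y.1 i)‖ := Finset.prod_nonneg fun i _ ↦ norm_nonneg _
  simp only [norm_mul, norm_prod, norm_fourier_apply, mul_one]
  calc _ ≤ (∏ i, ‖fourierHat (u i) (y.1 i)‖) * ((2 ^ n * B) * ‖fourierHat f y.2‖) := by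
        gcongr
        exact norm_fdiff_le_two_pow _ _ hp _
    _ = _ := by ring

/-- The kernel form of the iterated commutators. -/
theorem kernelSum_eq_tsum (hq : 1 / 2 < q) {f : C(UnitAddCircle, ℝ)} (hf : Summable fun k ↦ ‖fourierHat f k‖)
    (x : UnitAddCircle) (n : ℕ) : ∀ (u : Fin n → Hq q) {p : ℤ → ℂ}, Summable (fun k ↦ ‖p k‖) →
    ∑' k, p k * (fourier k x * fourierHat (kernelFun u f x) k) =
      ∑' j : Fin n → ℤ, ∑' l, (∏ i, fourierHat (u i) (j i) * fourier (j i) x) *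
        (fdiff n j p l * (fourierHat f l * fourier l x)) := by
  induction n with
  | zero =>
    intro u p hp
    rw [tsum_eq_single (default : Fin 0 → ℤ) fun j hj ↦ absurd (Subsingleton.elim _ _) hj]
    refine tsum_congr fun k ↦ ?_
    simp only [kernelFun, Finset.univ_eq_empty, Finset.prod_empty, one_mul, fdiff]
    ring
  | succ n ih =>
    intro u p hp
    have hpB : ∀ k, ‖p k‖ ≤ ∑' k, ‖p k‖ := fun k ↦ hp.le_tsum k fun _ _ ↦ norm_nonneg _
    have hps : ∀ a, Summable fun k ↦ ‖p (k + a)‖ := fun a ↦ (Equiv.addRight a).summable_iff.mpr hp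
    have hu := (u 0).summable_norm_coeff hq
    set H : ℤ → ℂ := fourierHat (kernelFun (Fin.tail u) f x)
    set M := ‖kernelFun (Fin.tail u) f x‖
    have hH : ∀ k, ‖H k‖ ≤ M := fun k ↦ norm_coeff_le _ k
    have hbd : ∀ {c : ℤ → ℂ} (hc : Summable fun k ↦ ‖c k‖) (d : ℤ), Summable fun k ↦ c k * (fourier k x * H (k - d)) :=
      fun {c} hc d ↦ Summable.of_norm_bounded (hc.mul_right M) fun k ↦ by
        rw [norm_mul, norm_mul, norm_fourier_apply, one_mul]
        gcongr
        exact hH _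
    let F : ℤ → ℤ → ℂ := fun k a ↦
      p k * (fourier k x * (fourierHat (u 0) a * (fourier a x * H k - H (k - a))))
    have hF : Summable (Function.uncurry F) := by
      refine Summable.of_norm_bounded ((hp.mul_of_nonneg hu (fun _ ↦ norm_nonneg _)
        fun _ ↦ norm_nonneg _).mul_right (2 * M)) fun y ↦ ?_
      have h1 : ‖fourier y.2 x * H y.1 - H (y.1 - y.2)‖ ≤ 2 * M := by
        refine (norm_sub_le _ _).trans ?_
        rw [norm_mul, norm_fourier_apply, one_mul]
        linarith [hH y.1, hH (y.1 - y.2)]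
      change ‖p y.1 * (fourier y.1 x * (fourierHat (u 0) y.2 * (fourier y.2 x * H y.1 - H (y.1 - y.2))))‖ ≤ _
      rw [norm_mul, norm_mul, norm_mul, norm_fourier_apply, one_mul, mul_assoc]
      gcongr
    have hR := (summable_kernelTerm hq hf x u hpB).prod
    rw [← (Fin.consEquiv (fun _ : Fin (n + 1) ↦ ℤ)).summable_iff] at hR
    rw [← (Fin.consEquiv (fun _ : Fin (n + 1) ↦ ℤ)).tsum_eq]
    refine Eq.trans ?_ (Summable.tsum_prod hR).symm
    calc _ = ∑' k, ∑' a, F k a := by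
          refine tsum_congr fun k ↦ ?_
          rw [fourierHat_kernelFun_succ hq, ← tsum_mul_left, ← tsum_mul_left]
      _ = ∑' a, ∑' k, F k a := hF.tsum_comm.symm
      _ = _ := by
          refine tsum_congr fun a ↦ ?_
          -- Substituting `k + a` for `k` moves the frequency shift from the kernel to `p`, which
          -- produces the difference `p k - p (k + a)` of the recursion defining `fdiff`.
          have e1 : ∑' k, F k a =
              (fourierHat (u 0) a * fourier a x) * ∑' k, (p k - p (k + a)) * (fourier k x * H k) := by
            have s1 := hbd hp 0
            have s2 := hbd hp a
            have s3 := hbd (hps a) 0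
            simp only [sub_zero] at s1 s3
            have e2 : ∑' k, p k * (fourier k x * H (k - a)) =
                fourier a x * ∑' k, p (k + a) * (fourier k x * H k) := by
              rw [← (Equiv.addRight a).tsum_eq, ← tsum_mul_left]
              refine tsum_congr fun k ↦ ?_
              rw [Equiv.coe_addRight, fourier_add, add_sub_cancel_right]; ring
            simp only [sub_mul, F]
            rw [s1.tsum_sub s3, mul_sub, mul_assoc _ _ (∑' k, p (k + a) * _), ← e2, ← tsum_mul_left,
              ← tsum_mul_left, ← (s1.mul_left _).tsum_sub (s2.mul_left _)]
            exact tsum_congr fun k ↦ by ring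
          have hP : Summable fun k ↦ ‖p k - p (k + a)‖ :=
            Summable.of_nonneg_of_le (fun _ ↦ norm_nonneg _) (fun k ↦ norm_sub_le _ _) (hp.add (hps a))
          rw [e1, ih (Fin.tail u) hP, ← tsum_mul_left]
          refine tsum_congr fun j ↦ ?_
          rw [← tsum_mul_left]
          refine tsum_congr fun l ↦ ?_
          simp only [Fin.consEquiv, Equiv.coe_fn_mk, Fin.prod_univ_succ, Fin.cons_zero, Fin.cons_succ, fdiff,
            Fin.tail, Fin.tail_cons]
          ring

theorem kernelSum_eq_multiSum (hq : 1 / 2 < q) {f : C(UnitAddCircle, ℝ)}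
    (hf : Summable fun k ↦ ‖fourierHat f k‖) (x : UnitAddCircle) (u : Fin n → Hq q) {p : ℤ → ℂ}
    (hp : Summable (fun k ↦ ‖p k‖)) :
    ∑' k, p k * (fourier k x * fourierHat (kernelFun u f x) k) =
      multiSum (fun j ↦ fdiff n j p) (fun i ↦ fourierHat (u i)) (fourierHat f) x := by
  have hpB : ∀ k, ‖p k‖ ≤ ∑' k, ‖p k‖ := fun k ↦ hp.le_tsum k fun _ _ ↦ norm_nonneg _
  have hs := summable_kernelTerm hq hf x u hpB
  -- Reindexing by the output frequency `l + ∑ j` in place of the frequency `l` of `f`.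
  let e : (Fin n → ℤ) × ℤ ≃ ℤ × (Fin n → ℤ) :=
    { toFun := fun y ↦ (y.2 + ∑ i, y.1 i, y.1)
      invFun := fun y ↦ (y.2, y.1 - ∑ i, y.2 i)
      left_inv := fun y ↦ by simp
      right_inv := fun y ↦ by simp }
  rw [kernelSum_eq_tsum hq hf x n u hp, ← hs.tsum_prod, multiSum, ← e.tsum_eq]
  refine tsum_congr fun y ↦ ?_
  have h1 : ∀ m : Finset (Fin n), fourier (∑ i ∈ m, y.1 i) x = ∏ i ∈ m, fourier (y.1 i) x := fun m ↦ by
    induction m using Finset.cons_induction with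
    | empty => simp
    | cons a m ha ih => rw [Finset.sum_cons, Finset.prod_cons, fourier_add, ih]
  simp only [e, Equiv.coe_fn_mk, multiTerm, add_sub_cancel_right, fourier_add, h1, Finset.prod_mul_distrib]
  ring

end Kernel
end

section
open scoped Manifold ContDiff
attribute [-instance] Hq.instModuleReal Hq.instAddCommGroup
open MeasureTheory Filter Topology
open scoped ENNReal NNReal

theorem HasSum.of_eq {ι : Type*} {f g : ι → ℂ} {a b : ℂ} (h : HasSum f a) (hf : ∀ i, g i = f i) (hb : b = a) :
    HasSum g b := by
  rw [hb, show g = f from funext hf]; exact h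

/-! ### Power series of the conjugated multiplier near the identity -/

section Expansion

variable {q : ℝ}

/-- The coefficients `∫ e_{-k}(φ(y)) f(y) dy`. -/
noncomputable def pullbackCoeff (u f : C(UnitAddCircle, ℝ)) (k : ℤ) : ℂ :=
  ∫ y, fourier (-k) (circleMap' u y) * (f y : ℂ) ∂AddCircle.haarAddCircle

theorem fourier_circleMap' (u : C(UnitAddCircle, ℝ)) (k : ℤ) (x : UnitAddCircle) :
    fourier k (circleMap' u x) = fourier k x * Complex.exp (2 * Real.pi * Complex.I * k * u x) := by
  have h : fourier k (circleMap' u x) = fourier k x * fourier k ((u x : ℝ) : UnitAddCircle) := by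
    rw [circleMap'_apply]
    simp only [fourier_apply, smul_add, AddCircle.toCircle_add, Circle.coe_mul]
  rw [h, fourier_coe_apply]
  simp

theorem norm_kernelFun_apply_le (u : Hq q) (f : C(UnitAddCircle, ℝ)) (x y : UnitAddCircle) (n : ℕ) :
    ‖kernelFun (fun _ : Fin n ↦ u) f x y‖ ≤ (2 * ‖Hq.toC u‖) ^ n * ‖f‖ := by
  have e : kernelFun (fun _ : Fin n ↦ u) f x y = (u x - u y) ^ n * f y := by
    simp [kernelFun]
  rw [e, norm_mul, norm_pow]
  have h1 : ‖u x - u y‖ ≤ 2 * ‖Hq.toC u‖ := by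
    refine (norm_sub_le _ _).trans ?_
    linarith [(Hq.toC u).norm_coe_le_norm x, (Hq.toC u).norm_coe_le_norm y]
  gcongr
  exact f.norm_coe_le_norm y

/-- The Taylor series of `exp(2πik(u(x) - u(y)))`, integrated term by term against `e_k(x - y)
f(y)`; it converges uniformly in `y` since `u` is bounded. -/
theorem hasSum_kernelFun (u : Hq q) (f : C(UnitAddCircle, ℝ)) (x : UnitAddCircle) (k : ℤ) :
    HasSum (fun n : ℕ ↦ (2 * Real.pi * Complex.I * k) ^ n / (n.factorial : ℂ) *
        (fourier k x * fourierHat (kernelFun (fun _ : Fin n ↦ u) f x) k))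
      (fourier k (circleMap' (Hq.toC u) x) * pullbackCoeff (Hq.toC u) f k) := by
  set M := 2 * ‖Hq.toC u‖
  set z : ℂ := 2 * Real.pi * Complex.I * k
  have key := hasSum_integral_of_dominated_convergence (μ := AddCircle.haarAddCircle (T := 1))
    (F := fun n y ↦ z ^ n / (n.factorial : ℂ) * (fourier k x * (fourier (-k) y * (kernelFun (fun _ : Fin n ↦ u) f x y : ℂ))))
    (f := fun y ↦ fourier k (circleMap' (Hq.toC u) x) * (fourier (-k) (circleMap' (Hq.toC u) y) * (f y : ℂ)))
    (fun n _ ↦ (‖z‖ * M) ^ n / n.factorial * ‖f‖) (fun n ↦ ?_) (fun n ↦ ?_) ?_ ?_ ?_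
  · refine key.of_eq (fun n ↦ ?_) ?_
    · rw [integral_const_mul, integral_const_mul]
      simp only [fourierHat, fourierCoeff, smul_eq_mul]
    · rw [integral_const_mul]; rfl
  · exact (by fun_prop : Continuous _).aestronglyMeasurable
  · refine Eventually.of_forall fun y ↦ ?_
    rw [norm_mul, norm_mul, norm_mul, norm_fourier_apply, norm_fourier_apply, one_mul, one_mul, norm_div, norm_pow,
      Complex.norm_real, Complex.norm_natCast, mul_pow]
    calc _ ≤ ‖z‖ ^ n / n.factorial * (M ^ n * ‖f‖) := by
          gcongr
          exact norm_kernelFun_apply_le u f x y n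
      _ = _ := by ring
  · exact Eventually.of_forall fun y ↦ (Real.summable_pow_div_factorial _).mul_right _
  · exact integrable_const _
  · refine Eventually.of_forall fun y ↦ ?_
    have h1 := NormedSpace.expSeries_div_hasSum_exp (z * (u x - u y : ℝ))
    rw [← Complex.exp_eq_exp_ℂ] at h1
    have h2 := h1.mul_right (fourier k x * (fourier (-k) y * (f y : ℂ)))
    refine h2.of_eq (fun n ↦ ?_) ?_
    · simp [kernelFun, mul_pow]
      ring_nf
    · rw [fourier_circleMap', fourier_circleMap']
      have : z * ((u x - u y : ℝ) : ℂ) = 2 * Real.pi * Complex.I * k * u x +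
          2 * Real.pi * Complex.I * (-k : ℤ) * u y := by
        simp only [z]; push_cast; ring
      rw [this, Complex.exp_add]
      ring_nf

/-- The Taylor series in `n` at frequency `k` costs `exp(4π‖u‖|k|)`, as `|u(x) - u(y)| ≤ 2‖u‖` in
supremum norm. The assumed decay of `c` pays for it and permits exchanging the sums over `k` and
`n`. -/
theorem hasSum_kernelSum (u : Hq q) (f : C(UnitAddCircle, ℝ)) (x : UnitAddCircle) {c : ℤ → ℂ}
    (hc : Summable fun k : ℤ ↦ ‖c k‖ * Real.exp (4 * Real.pi * ‖Hq.toC u‖ * |(k : ℝ)|)) :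
    HasSum (fun n : ℕ ↦ (n.factorial : ℂ)⁻¹ * ∑' k : ℤ, c k * (2 * Real.pi * Complex.I * k) ^ n *
        (fourier k x * fourierHat (kernelFun (fun _ : Fin n ↦ u) f x) k))
      (∑' k, c k * (fourier k (circleMap' (Hq.toC u) x) * pullbackCoeff (Hq.toC u) f k)) := by
  set M := 2 * ‖Hq.toC u‖
  let G : ℤ → ℕ → ℂ := fun k n ↦ c k * ((2 * Real.pi * Complex.I * k) ^ n / (n.factorial : ℂ) *
        (fourier k x * fourierHat (kernelFun (fun _ : Fin n ↦ u) f x) k))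
  let B : ℤ × ℕ → ℝ := fun y ↦ ‖c y.1‖ * ((2 * Real.pi * |(y.1 : ℝ)| * M) ^ y.2 / y.2.factorial * ‖f‖)
  have hB0 : ∀ y, 0 ≤ B y := fun y ↦ by
    have := Real.pi_pos
    simp only [B, M]; positivity
  have hexp : ∀ t : ℝ, ∑' n : ℕ, t ^ n / n.factorial = Real.exp t := fun t ↦ by
    rw [Real.exp_eq_exp_ℝ, NormedSpace.exp_eq_tsum_div]
  have hBk : ∀ k : ℤ, HasSum (fun n ↦ B (k, n)) (‖c k‖ * Real.exp (4 * Real.pi * ‖Hq.toC u‖ * |(k : ℝ)|) * ‖f‖) := by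
    intro k
    have h1 := (Real.summable_pow_div_factorial (2 * Real.pi * |(k : ℝ)| * M)).hasSum
    rw [hexp, show 2 * Real.pi * |(k : ℝ)| * M = 4 * Real.pi * ‖Hq.toC u‖ * |(k : ℝ)| by simp only [M]; ring] at h1
    rw [mul_assoc]
    have h2 := (h1.mul_right ‖f‖).mul_left ‖c k‖
    have e : (fun n ↦ B (k, n)) =
        fun n ↦ ‖c k‖ * ((4 * Real.pi * ‖Hq.toC u‖ * |(k : ℝ)|) ^ n / n.factorial * ‖f‖) := by
      funext n
      simp only [B, M]
      congr 4
      ring_nf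
    rw [e]
    exact h2
  have hB : Summable B := (summable_prod_of_nonneg hB0).mpr
    ⟨fun k ↦ (hBk k).summable, (hc.mul_right ‖f‖).congr fun k ↦ ((hBk k).tsum_eq).symm⟩
  have hG : Summable (Function.uncurry G) := by
    refine Summable.of_norm_bounded hB fun y ↦ ?_
    change ‖c y.1 * ((2 * Real.pi * Complex.I * y.1) ^ y.2 / (y.2.factorial : ℂ) *
        (fourier y.1 x * fourierHat (kernelFun (fun _ : Fin y.2 ↦ u) f x) y.1))‖ ≤ _
    have h1 : ‖fourierHat (kernelFun (fun _ : Fin y.2 ↦ u) f x) y.1‖ ≤ M ^ y.2 * ‖f‖ := by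
      refine (norm_coeff_le _ _).trans ?_
      rw [ContinuousMap.norm_le _ (by positivity)]
      exact fun t ↦ norm_kernelFun_apply_le u f x t y.2
    have h2 : ‖(2 * Real.pi * Complex.I * y.1 : ℂ)‖ = 2 * Real.pi * |(y.1 : ℝ)| := by
      simp [abs_of_pos Real.pi_pos]
    rw [norm_mul, norm_mul, norm_mul, norm_fourier_apply, one_mul, norm_div, norm_pow, h2, Complex.norm_natCast]
    calc _ ≤ ‖c y.1‖ * ((2 * Real.pi * |(y.1 : ℝ)|) ^ y.2 / y.2.factorial * (M ^ y.2 * ‖f‖)) := by gcongr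
      _ = B y := by simp only [B]; ring_nf
  have e1 : ∑' k, c k * (fourier k (circleMap' (Hq.toC u) x) * pullbackCoeff (Hq.toC u) f k) = ∑' n, ∑' k, G k n := by
    refine Eq.trans ?_ hG.tsum_comm.symm
    refine tsum_congr fun k ↦ ?_
    rw [← (hasSum_kernelFun u f x k).tsum_eq, ← tsum_mul_left]
  rw [e1]
  have h3 : Summable fun n ↦ ∑' k, G k n := hG.prod_symm.prod
  refine h3.hasSum.of_eq (fun n ↦ ?_) rfl
  rw [← tsum_mul_left]
  refine tsum_congr fun k ↦ ?_
  simp only [G, div_eq_mul_inv]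
  ring

/-- Here `w = v ∘ φ⁻¹`, so `v' = (w' ∘ φ) φ'`, and the Jacobian `φ'` is just what the change of
variables needs. This is why the expansion is run with `v'` and a symbol divided by `2πik`. -/
theorem pullbackCoeff_deriv (hq : 3 / 2 < q) {u v w : Hq q} (hw : ∀ x, w (u.toMap x) = v x) (k : ℤ) :
    pullbackCoeff (Hq.toC u) (v.derivC hq) k = 2 * Real.pi * Complex.I * k * fourierHat w k := by
  have h1 := (w.hasCircleDeriv hq).comp (u.hasCircleDeriv hq)
  have e1 : (Hq.toC w).comp (circleMap' (Hq.toC u)) = Hq.toC v := ContinuousMap.ext hw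
  rw [e1] at h1
  rw [(v.hasCircleDeriv hq).unique h1, ← coeff_hasDerivAt _ _ (w.hasCircleDeriv hq)]
  have h2 := integral_comp_circleMap' (u.hasCircleDeriv hq)
    (g := fun y ↦ fourier (-k) y * (w.derivC hq y : ℂ)) (by fun_prop)
  simp only [fourierHat, fourierCoeff, smul_eq_mul]
  rw [← h2]
  refine integral_congr_ae (Eventually.of_forall fun y ↦ ?_)
  simp
  ring

/-- The Gaussian beats every exponential. Completing the square bounds `(C + 2s)|k| - εk²` by `(C +
2s)²/(4ε)`; since the symbol itself costs only `exp((2s - 1)|k|)`, a factor `exp(-|k|)` is left for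
summation. -/
theorem summable_bSymbol_mul_exp {s ε : ℝ} (hs : 1 / 2 ≤ s) (hε : 0 < ε) (C : ℝ) :
    Summable fun k : ℤ ↦ ‖bSymbol s ε k‖ * Real.exp (C * |(k : ℝ)|) := by
  have h0 : Summable fun k : ℤ ↦ Real.exp (-|(k : ℝ)|) := by
    have h1 : Summable fun n : ℕ ↦ Real.exp (-(n : ℝ)) := Real.summable_exp_neg_nat
    refine Summable.of_nat_of_neg (h1.congr fun n ↦ by simp) (h1.congr fun n ↦ by simp)
  refine Summable.of_nonneg_of_le (fun k ↦ by positivity) (fun k ↦ ?_)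
    (h0.mul_left (Real.exp ((C + 2 * s) ^ 2 / (4 * ε))))
  have e : ‖bSymbol s ε k‖ = ‖bSymbol s 0 k‖ * Real.exp (-(ε * (k : ℝ) ^ 2)) := by
    simp only [bSymbol]
    rw [norm_mul, norm_mul _ ((Real.exp (-(0 * (k : ℝ) ^ 2)) : ℝ) : ℂ), Complex.norm_real, Complex.norm_real]
    simp
  have h2 : ‖bSymbol s 0 k‖ ≤ Real.exp ((2 * s - 1) * |(k : ℝ)|) := by
    refine (norm_bSymbol_le (by linarith) le_rfl k).trans ?_
    rw [mul_comm (2 * s - 1), Real.exp_mul]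
    refine Real.rpow_le_rpow (by positivity) ?_ (by linarith)
    linarith [Real.add_one_le_exp |(k : ℝ)|]
  rw [e, ← Real.exp_add]
  calc _ ≤ Real.exp ((2 * s - 1) * |(k : ℝ)|) * Real.exp (-(ε * (k : ℝ) ^ 2)) * Real.exp (C * |(k : ℝ)|) := by
        gcongr
    _ = Real.exp ((2 * s - 1) * |(k : ℝ)| + -(ε * (k : ℝ) ^ 2) + C * |(k : ℝ)|) := by
        rw [Real.exp_add, Real.exp_add]
    _ ≤ _ := by
        refine Real.exp_le_exp.mpr ?_
        have h3 : (C + 2 * s) * |(k : ℝ)| - ε * (k : ℝ) ^ 2 ≤ (C + 2 * s) ^ 2 / (4 * ε) := by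
          rw [le_div_iff₀ (by positivity), ← sq_abs (k : ℝ)]
          nlinarith [sq_nonneg (2 * ε * |(k : ℝ)| - (C + 2 * s))]
        linarith

/-- The factorial from Cauchy's estimate cancels the `1/n!` of the Taylor series, leaving the terms
of a geometric series. -/
theorem symbolConst_mul_pow (s q U F : ℝ) (n : ℕ) :
    ((n.factorial : ℝ)⁻¹) * (symbolConst s n * multiConst q * (4 * 2 ^ (q - 1) * multiConst q) ^ n * U ^ n * F) =
      2 * (5 ^ s + 1) * multiConst q * F * (16 * Real.pi * (4 * 2 ^ (q - 1) * multiConst q) * U) ^ n := by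
  have : (n.factorial : ℝ) ≠ 0 := by positivity
  generalize 4 * 2 ^ (q - 1) * multiConst q = X
  rw [mul_pow (16 * Real.pi * X) U, mul_pow (16 * Real.pi) X, symbolConst]
  field_simp

/-- The expansion of the conjugated Fourier multiplier `R_φ Λ^{2s} R_φ⁻¹` near the identity. -/
theorem hasSum_conjugation {s : ℝ} (hs : 1 / 2 ≤ s) (hq : 3 / 2 + 2 * s < q) {u v w : Hq q}
    (hsmall : 16 * Real.pi * (4 * 2 ^ (q - 1) * multiConst q) * ‖u‖ < 1)
    (hw : ∀ x, w (u.toMap x) = v x) {z : Hq (q - 2 * s)}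
    (hz : ∀ k, fourierHat z k = sobolevWeight s k * fourierHat w k) (x : UnitAddCircle) :
    HasSum (fun n : ℕ ↦ (n.factorial : ℂ)⁻¹ * multiSum (fun j : Fin n → ℤ ↦ fdiff n j (pSymbol s 0 n))
        (fun _ ↦ fourierHat u) (fourierHat (Hq.derivL (by linarith) v)) x)
      (z (u.toMap x) - v x) := by
  have hq' : 3 / 2 < q := by linarith
  set f : Hq (q - 1) := Hq.derivL hq' v
  have hff : Hq.toC f = v.derivC hq' := rfl
  have hb : 1 / 2 < q - 2 * s := by linarith
  have hbq : 2 * s - 1 + (q - 2 * s) = q - 1 := by ring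
  have hmc := multiConst_pos q
  set K := √(2 * ∑' k, sobolevWeight (-(q - 2 * s)) k) * (2 * (5 ^ s + 1) * multiConst q * ‖f‖)
  set r := 16 * Real.pi * (4 * 2 ^ (q - 1) * multiConst q) * ‖u‖
  have hr0 : 0 ≤ r := by have := Real.pi_pos; positivity
  set a : ℝ → ℕ → ℂ := fun ε n ↦ (n.factorial : ℂ)⁻¹ * multiSum (fun j : Fin n → ℤ ↦ fdiff n j (pSymbol s ε n))
        (fun _ ↦ fourierHat u) (fourierHat f) x
  -- A geometric majorant independent of `ε`, which both sums the series and justifies the limit `ε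
  -- → 0`.
  have ha : ∀ ε ∈ Set.Icc (0 : ℝ) 1, ∀ n, ‖a ε n‖ ≤ K * r ^ n := by
    intro ε hε n
    have h := norm_multiSum_le hq' hb hbq (symbolConst_nonneg s n) (symbolBound_fdiff hs hε n) (fun _ ↦ u) f x
    rw [Finset.prod_const, Finset.card_univ, Fintype.card_fin] at h
    simp only [a]
    rw [norm_mul, norm_inv, Complex.norm_natCast]
    refine (mul_le_mul_of_nonneg_left h (by positivity)).trans (le_of_eq ?_)
    rw [mul_left_comm, symbolConst_mul_pow]
    simp only [K, r]
    ring
  have hgeo : Summable fun n ↦ K * r ^ n := (summable_geometric_of_lt_one hr0 hsmall).mul_left K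
  have hfs : Summable fun k ↦ ‖fourierHat (v.derivC hq') k‖ := f.summable_norm_coeff (by linarith)
  set G : ℝ → ℂ := fun ε ↦ ∑' k, bSymbol s ε k *
    (fourier k (circleMap' (Hq.toC u) x) * pullbackCoeff (Hq.toC u) (v.derivC hq') k)
  -- Only with the cutoff present are the sums over `k` and over `n` known to commute.
  have hG : ∀ ε, 0 < ε → ∑' n, a ε n = G ε := by
    intro ε hε
    have h := hasSum_kernelSum u (v.derivC hq') x (summable_bSymbol_mul_exp hs hε _)
    refine Eq.trans (tsum_congr fun n ↦ ?_) h.tsum_eq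
    have hp : Summable fun k : ℤ ↦ ‖bSymbol s ε k * (2 * Real.pi * Complex.I * k) ^ n‖ := by
      refine Summable.of_nonneg_of_le (fun k ↦ norm_nonneg _) (fun k ↦ ?_)
        ((summable_bSymbol_mul_exp hs hε (2 * Real.pi)).mul_left (n.factorial : ℝ))
      have h2 : ‖(2 * Real.pi * Complex.I * k : ℂ)‖ = 2 * Real.pi * |(k : ℝ)| := by
        simp [abs_of_pos Real.pi_pos]
      rw [norm_mul, norm_pow, h2, mul_left_comm]
      gcongr
      have := Real.pow_div_factorial_le_exp (2 * Real.pi * |(k : ℝ)|) (by have := Real.pi_pos; positivity) n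
      rwa [div_le_iff₀' (by positivity)] at this
    have h3 := kernelSum_eq_multiSum (by linarith) hfs x (fun _ : Fin n ↦ u) hp
    simp only [a]
    rw [h3]
    rfl
  -- Without cutoff, the symbol times the coefficient of `w'` is the `k`-th coefficient of `Λ^{2s} w
  -- - w`; the subtracted `1` makes this hold also at `k = 0`. The bound dominates the limit of `G`.
  have hD : ∀ k, ‖bSymbol s 0 k‖ * ‖pullbackCoeff (Hq.toC u) (v.derivC hq') k‖ ≤
      2 * (sobolevWeight s k * ‖fourierHat w k‖) ∧
      bSymbol s 0 k * pullbackCoeff (Hq.toC u) (v.derivC hq') k =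
        fourierHat z k - fourierHat w k := by
    intro k
    have e : bSymbol s 0 k * pullbackCoeff (Hq.toC u) (v.derivC hq') k =
        fourierHat z k - fourierHat w k := by
      rw [pullbackCoeff_deriv hq' hw, hz, bSymbol]
      rcases eq_or_ne k 0 with rfl | hk
      · simp [sobolevWeight]
      · have hk' : (2 * Real.pi * Complex.I * k : ℂ) ≠ 0 := by simp [hk, Real.pi_ne_zero]
        simp only [zero_mul, neg_zero, Real.exp_zero]
        push_cast
        field_simp
    refine ⟨?_, e⟩
    rw [← norm_mul, e, hz]
    refine (norm_sub_le _ _).trans ?_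
    rw [norm_mul, Complex.norm_real, Real.norm_eq_abs, abs_of_pos (sobolevWeight_pos _ _)]
    nlinarith [one_le_sobolevWeight (by linarith : 0 ≤ s) k, norm_nonneg (fourierHat w k)]
  have hl : Tendsto G (𝓝[>] 0) (𝓝 (G 0)) := by
    refine tendsto_tsum_of_dominated_convergence
      (((w.summable_weight_mul (t := s) (by linarith)).1).mul_left 2) (fun k ↦ ?_) (Eventually.mono self_mem_nhdsWithin fun ε (hε : 0 < ε) k ↦ ?_)
    · refine Tendsto.mul_const _ ?_
      have : Continuous fun ε ↦ bSymbol s ε k := by unfold bSymbol; fun_prop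
      exact this.continuousAt.mono_left nhdsWithin_le_nhds
    · rw [norm_mul, norm_mul, norm_fourier_apply, one_mul]
      refine le_trans ?_ (hD k).1
      gcongr
      simp only [bSymbol]
      rw [norm_mul, norm_mul _ ((Real.exp (-(0 * (k : ℝ) ^ 2)) : ℝ) : ℂ)]
      gcongr
      rw [Complex.norm_real, Complex.norm_real, Real.norm_eq_abs, Real.norm_eq_abs, Real.abs_exp, Real.abs_exp]
      gcongr
  have hl2 : Tendsto (fun ε ↦ ∑' n, a ε n) (𝓝[>] 0) (𝓝 (∑' n, a 0 n)) := by
    have hev : ∀ᶠ ε : ℝ in 𝓝[>] 0, ε ∈ Set.Icc (0 : ℝ) 1 := by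
      filter_upwards [Ioo_mem_nhdsGT (zero_lt_one' ℝ)] with ε hε using ⟨hε.1.le, hε.2.le⟩
    refine tendsto_tsum_of_dominated_convergence hgeo (fun n ↦ ?_) (hev.mono fun ε hε n ↦ ha ε hε n)
    refine Tendsto.const_mul _ (tendsto_multiSum hq' hb hbq (symbolConst_nonneg s n)
      (hev.mono fun ε hε ↦ symbolBound_fdiff hs hε n) (fun j m ↦ tendsto_fdiff j (fun k ↦ ?_) m) (fun _ ↦ u) f x)
    have : Continuous fun ε ↦ pSymbol s ε n k := by unfold pSymbol bSymbol; fun_prop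
    exact this.continuousAt.mono_left nhdsWithin_le_nhds
  have hl3 : ∑' n, a 0 n = G 0 :=
    tendsto_nhds_unique (hl2.congr' (by filter_upwards [self_mem_nhdsWithin] with ε hε using hG ε hε)) hl
  have hG0 : G 0 = z (u.toMap x) - v x := by
    have h1 := (z.hasSum_coeff hb (u.toMap x)).sub (w.hasSum_coeff (by linarith) (u.toMap x))
    rw [← hw x, ← h1.tsum_eq]
    refine tsum_congr fun k ↦ ?_
    rw [Hq.circleMap'_toC, mul_left_comm, (hD k).2]
    ring
  have := (Summable.of_norm_bounded hgeo (ha 0 (by simp))).hasSum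
  rwa [hl3, hG0] at this

end Expansion
end

section
open scoped Manifold ContDiff
attribute [-instance] Hq.instModuleReal Hq.instAddCommGroup
open MeasureTheory Filter Topology
open scoped ENNReal NNReal

/-! ### Multipliers and compositions as isomorphisms -/

namespace Hq

variable {a b q σ t : ℝ}

/-- The Fourier multiplier `(1 + k²)^t`, as a linear map. -/
noncomputable def besselₗ (hb : 1 / 2 < b) (h : a = b + 2 * t) : Hq a →ₗ[ℝ] Hq b :=
  have hK : ∀ k, sobolevWeight (b / 2) k * |sobolevWeight t k| ≤ 1 * sobolevWeight (a / 2) k := fun k ↦ by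
    rw [abs_of_pos (sobolevWeight_pos _ _), ← sobolevWeight_add, one_mul, h]
    exact le_of_eq (by congr 1; ring)
  have hc := fun u : Hq a ↦ exists_multiplier hb (sobolevWeight t) (sobolevWeight_neg_int t) hK u
  { toFun := fun u ↦ (hc u).choose
    map_add' := fun u v ↦ ext_coeff fun k ↦ by
      rw [fourierHat_add, (hc _).choose_spec, (hc _).choose_spec, (hc _).choose_spec, fourierHat_add, mul_add]
    map_smul' := fun c u ↦ ext_coeff fun k ↦ by
      rw [RingHom.id_apply, fourierHat_smul, (hc _).choose_spec, (hc _).choose_spec, fourierHat_smul, mul_smul_comm] }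

theorem fourierHat_besselₗ (hb : 1 / 2 < b) (h : a = b + 2 * t) (u : Hq a) (k : ℤ) :
    fourierHat (besselₗ hb h u) k = sobolevWeight t k * fourierHat u k :=
  (exists_multiplier hb (sobolevWeight t) (sobolevWeight_neg_int t) (K := 1) (fun k ↦ by
    rw [abs_of_pos (sobolevWeight_pos _ _), ← sobolevWeight_add, one_mul, h]
    exact le_of_eq (by congr 1; ring)) u).choose_spec k

theorem norm_besselₗ (hb : 1 / 2 < b) (h : a = b + 2 * t) (u : Hq a) : ‖besselₗ hb h u‖ = ‖u‖ := by
  subst h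
  refine (sq_eq_sq₀ (norm_nonneg _) (norm_nonneg _)).mp ?_
  rw [norm_sq_eq, norm_sq_eq]
  refine tsum_congr fun k ↦ ?_
  rw [fourierHat_besselₗ, norm_mul, Complex.norm_real, Real.norm_eq_abs, abs_of_pos (sobolevWeight_pos _ _),
    mul_pow, ← mul_assoc, sq, ← mul_assoc, ← sobolevWeight_add, ← sobolevWeight_add]
  congr 2; ring

/-- The Fourier multiplier `Λ^{2t}`, with symbol `(1 + k²)^t`. -/
noncomputable def bessel (ha : 1 / 2 < a) (hb : 1 / 2 < b) (h : a = b + 2 * t) : Hq a ≃L[ℝ] Hq b :=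
  (LinearEquiv.ofLinearMap (besselₗ hb h) (besselₗ ha (t := -t) (by rw [h]; ring))
    (LinearMap.ext fun u ↦ ext_coeff fun k ↦ by
      have : sobolevWeight t k * sobolevWeight (-t) k = 1 := by
        rw [← sobolevWeight_add, add_neg_cancel]; simp [sobolevWeight]
      rw [LinearMap.comp_apply, fourierHat_besselₗ, fourierHat_besselₗ, ← mul_assoc, ← Complex.ofReal_mul, this]
      simp)
    (LinearMap.ext fun u ↦ ext_coeff fun k ↦ by
      have : sobolevWeight (-t) k * sobolevWeight t k = 1 := by
        rw [← sobolevWeight_add, neg_add_cancel]; simp [sobolevWeight]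
      rw [LinearMap.comp_apply, fourierHat_besselₗ, fourierHat_besselₗ, ← mul_assoc, ← Complex.ofReal_mul, this]
      simp)).toContinuousLinearEquivOfBounds 1 1
    (fun u ↦ by rw [one_mul]; exact (norm_besselₗ hb h u).le)
    (fun u ↦ by rw [one_mul]; exact (norm_besselₗ ha (t := -t) (by rw [h]; ring) u).le)

theorem fourierHat_bessel (ha : 1 / 2 < a) (hb : 1 / 2 < b) (h : a = b + 2 * t) (u : Hq a) (k : ℤ) :
    fourierHat (bessel ha hb h u) k = sobolevWeight t k * fourierHat u k := fourierHat_besselₗ hb h u k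

theorem isDisplacement_zero : (0 : Hq q).IsDisplacement := by intro x; simp [Hq.deriv, map_zero]

/-- The composition operator `v ↦ v ∘ φ`, `φ = id + u`. -/
noncomputable def compₗ (hq : 5 / 2 < q) (hσ : 1 / 2 < σ) (hσq : σ ≤ q) {u : Hq q} (hu : u.IsDisplacement) :
    Hq σ →ₗ[ℝ] Hq σ where
  toFun v := mk ((toC v).comp (circleMap' (toC u)))
    (comp_mem hq hu ⌈σ⌉₊ hσ hσq (by have := Nat.le_ceil σ; linarith) v.2)
  map_add' _ _ := rfl
  map_smul' _ _ := rfl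

noncomputable def compL (hq : 5 / 2 < q) (hσ : 1 / 2 < σ) (hσq : σ ≤ q) {u : Hq q} (hu : u.IsDisplacement) :
    Hq σ →L[ℝ] Hq σ where
  toLinearMap := compₗ hq hσ hσq hu
  cont := by
    have := completeSpace hσ
    exact continuous_of_eval hσ _ fun x ↦ continuous_eval' hσ (u.toMap x)

theorem compL_apply (hq : 5 / 2 < q) (hσ : 1 / 2 < σ) (hσq : σ ≤ q) {u : Hq q} (hu : u.IsDisplacement)
    (v : Hq σ) (x : UnitAddCircle) : compL hq hσ hσq hu v x = v (u.toMap x) := rfl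

theorem exists_inverse (hq : 5 / 2 < q) {u : Hq q} (hu : u.IsDisplacement) :
    ∃ w : Hq q, w.IsDisplacement ∧ (∀ x, u.toMap (w.toMap x) = x) ∧ ∀ x, w.toMap (u.toMap x) = x := by
  have : Fact (3 / 2 < q) := ⟨by linarith⟩
  let e := (Dq.ofDisp u hu).toHomeo
  have he : ∀ x, e x = u.toMap x := Dq.toHomeo_ofDisp u hu
  obtain ⟨w, hw, h⟩ := exists_inverse_displacement hq hu ⟨e.symm, e.symm.continuous⟩ fun x ↦ by
    rw [← he]; exact e.apply_symm_apply x
  refine ⟨w, hw, fun x ↦ ?_, fun x ↦ ?_⟩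
  · rw [← h, ← he]; exact e.apply_symm_apply x
  · rw [← h, ← he]; exact e.symm_apply_apply x

/-- The displacement of the inverse diffeomorphism. -/
noncomputable def inv (hq : 5 / 2 < q) {u : Hq q} (hu : u.IsDisplacement) : Hq q := (exists_inverse hq hu).choose

theorem isDisplacement_inv (hq : 5 / 2 < q) {u : Hq q} (hu : u.IsDisplacement) : (inv hq hu).IsDisplacement :=
  (exists_inverse hq hu).choose_spec.1

theorem toMap_inv (hq : 5 / 2 < q) {u : Hq q} (hu : u.IsDisplacement) (x : UnitAddCircle) :
    u.toMap ((inv hq hu).toMap x) = x := (exists_inverse hq hu).choose_spec.2.1 x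

theorem inv_toMap (hq : 5 / 2 < q) {u : Hq q} (hu : u.IsDisplacement) (x : UnitAddCircle) :
    (inv hq hu).toMap (u.toMap x) = x := (exists_inverse hq hu).choose_spec.2.2 x

/-- The composition operator `v ↦ v ∘ φ`, `φ = id + u`, as an isomorphism. -/
noncomputable def compEquiv (hq : 5 / 2 < q) (hσ : 1 / 2 < σ) (hσq : σ ≤ q) {u : Hq q} (hu : u.IsDisplacement) :
    Hq σ ≃L[ℝ] Hq σ :=
  ContinuousLinearEquiv.equivOfInverse (compL hq hσ hσq hu) (compL hq hσ hσq (isDisplacement_inv hq hu))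
    (fun v ↦ ext fun x ↦ by rw [compL_apply, compL_apply, toMap_inv])
    (fun v ↦ ext fun x ↦ by rw [compL_apply, compL_apply, inv_toMap])

theorem compEquiv_apply (hq : 5 / 2 < q) (hσ : 1 / 2 < σ) (hσq : σ ≤ q) {u : Hq q} (hu : u.IsDisplacement)
    (v : Hq σ) (x : UnitAddCircle) : compEquiv hq hσ hσq hu v x = v (u.toMap x) := rfl

theorem compEquiv_symm_apply (hq : 5 / 2 < q) (hσ : 1 / 2 < σ) (hσq : σ ≤ q) {u : Hq q} (hu : u.IsDisplacement)
    (v : Hq σ) (x : UnitAddCircle) : (compEquiv hq hσ hσq hu).symm v (u.toMap x) = v x := by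
  rw [← compEquiv_apply hq hσ hσq hu, ContinuousLinearEquiv.apply_symm_apply]

end Hq

/-! ### Smooth dependence of `R_φ Λ^{2s} R_φ⁻¹` on `φ` -/

section Conjugation

variable {s q : ℝ}

/-- The standing assumptions on the order `2s` and the Sobolev exponent `q`. -/
structure AdmissibleExponents (s q : ℝ) : Prop where
  half_le : 1 / 2 ≤ s
  lt : 3 / 2 + 2 * s < q

namespace AdmissibleExponents

theorem five_half_lt (H : AdmissibleExponents s q) : 5 / 2 < q := by linarith [H.half_le, H.lt]
theorem three_half_lt (H : AdmissibleExponents s q) : 3 / 2 < q := by linarith [H.half_le, H.lt]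
theorem half_lt (H : AdmissibleExponents s q) : 1 / 2 < q := by linarith [H.half_le, H.lt]
theorem half_lt_sub (H : AdmissibleExponents s q) : 1 / 2 < q - 2 * s := by linarith [H.lt]
theorem sub_le (H : AdmissibleExponents s q) : q - 2 * s ≤ q := by linarith [H.half_le]
theorem sub_le_sub_one (H : AdmissibleExponents s q) : q - 2 * s ≤ q - 1 := by linarith [H.half_le]

end AdmissibleExponents

/-- The conjugated inertia operator `R_φ Λ^{2s} R_φ⁻¹`, `φ = id + u`, as an isomorphism. -/
noncomputable def inertiaEquiv (H : AdmissibleExponents s q) {u : Hq q} (hu : u.IsDisplacement) :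
    Hq q ≃L[ℝ] Hq (q - 2 * s) :=
  ((Hq.compEquiv H.five_half_lt H.half_lt le_rfl hu).symm.trans
    (Hq.bessel (t := s) H.half_lt H.half_lt_sub (by ring))).trans
    (Hq.compEquiv H.five_half_lt H.half_lt_sub H.sub_le hu)

open Classical in
/-- The conjugated inertia operator `R_φ Λ^{2s} R_φ⁻¹`, `φ = id + u`. -/
noncomputable def inertia (H : AdmissibleExponents s q) (u : Hq q) : Hq q →L[ℝ] Hq (q - 2 * s) :=
  if hu : u.IsDisplacement then inertiaEquiv H hu else 0

theorem inertia_eq (H : AdmissibleExponents s q) {u : Hq q} (hu : u.IsDisplacement) :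
    inertia H u = inertiaEquiv H hu := dif_pos hu

theorem inertia_apply (H : AdmissibleExponents s q) {u : Hq q} (hu : u.IsDisplacement) {v w : Hq q}
    (hw : ∀ x, w (u.toMap x) = v x) (x : UnitAddCircle) :
    inertia H u v x = Hq.bessel (t := s) H.half_lt H.half_lt_sub (by ring) w (u.toMap x) := by
  have e : (Hq.compEquiv H.five_half_lt H.half_lt le_rfl hu).symm v = w := by
    rw [ContinuousLinearEquiv.symm_apply_eq]
    exact Hq.ext fun x ↦ (hw x).symm
  rw [inertia_eq H hu, ← e]
  rfl

/-- The coefficients are the operators of `exists_multiOp` divided by `n!` and precomposed with the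
derivative. Their norms grow geometrically, so the radius is positive. The sum is identified by
evaluating at each `x` and comparing with `hasSum_conjugation`; the inclusion accounts for the `1`
subtracted from the symbol. -/
theorem exists_expansion (H : AdmissibleExponents s q) :
    ∃ p : FormalMultilinearSeries ℝ (Hq q) (Hq q →L[ℝ] Hq (q - 2 * s)), 0 < p.radius ∧
      ∀ᶠ u in 𝓝 (0 : Hq q), inertia H u = Hq.incl H.half_lt_sub H.sub_le + p.sum u := by
  have hq := H.three_half_lt
  have hs := H.half_le
  have hbq : 2 * s - 1 + (q - 2 * s) = q - 1 := by ring
  have hpi := Real.pi_pos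
  have hmc := multiConst_pos q
  choose T hT hTn using fun n ↦ exists_multiOp hq H.half_lt_sub hbq (symbolConst_nonneg s n)
    (symbolBound_fdiff hs (ε := 0) (by simp) n) (symbolReal_fdiff s 0 n)
  let D := Hq.derivL hq
  let M : ∀ n, ContinuousMultilinearMap ℝ (fun _ : Fin n ↦ Hq q) (Hq q →L[ℝ] Hq (q - 2 * s)) := fun n ↦
    ContinuousLinearMap.compContinuousMultilinearMap
      ((ContinuousLinearMap.compL ℝ (Hq q) (Hq (q - 1)) (Hq (q - 2 * s))).flip D) (T n)
  let p : FormalMultilinearSeries ℝ (Hq q) (Hq q →L[ℝ] Hq (q - 2 * s)) := fun n ↦ ((n.factorial : ℝ)⁻¹) • M n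
  have hp : ∀ n u v, p n (fun _ ↦ u) v = ((n.factorial : ℝ)⁻¹) • T n (fun _ ↦ u) (D v) := fun n u v ↦ rfl
  set X := 4 * 2 ^ (q - 1) * multiConst q
  have hX : 0 < X := by positivity
  set K := 2 * (5 ^ s + 1) * multiConst q
  let L := ‖(ContinuousLinearMap.compL ℝ (Hq q) (Hq (q - 1)) (Hq (q - 2 * s))).flip D‖
  have hpn : ∀ n, ‖p n‖ ≤ L * (K * (16 * Real.pi * X) ^ n) := by
    intro n
    have h1 := symbolConst_mul_pow s q 1 1 n
    have h2 := ContinuousLinearMap.norm_compContinuousMultilinearMap_le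
      ((ContinuousLinearMap.compL ℝ (Hq q) (Hq (q - 1)) (Hq (q - 2 * s))).flip D) (T n)
    have h3 : ‖p n‖ ≤ (n.factorial : ℝ)⁻¹ * (L * ‖T n‖) := by
      refine (norm_smul_le ((n.factorial : ℝ)⁻¹) (M n)).trans ?_
      rw [norm_inv, Real.norm_natCast]
      gcongr
    refine h3.trans ?_
    rw [mul_left_comm]
    have hL : 0 ≤ L := norm_nonneg _
    refine mul_le_mul_of_nonneg_left ((mul_le_mul_of_nonneg_left (hTn n) (by positivity)).trans (le_of_eq ?_)) hL
    simpa using h1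
  have hR : 0 < 16 * Real.pi * X := by positivity
  have hrad : 0 < p.radius := by
    refine lt_of_lt_of_le ?_ (p.le_radius_of_bound (L * K) (r := Real.toNNReal (16 * Real.pi * X)⁻¹) fun n ↦ ?_)
    · exact ENNReal.coe_pos.mpr (Real.toNNReal_pos.mpr (inv_pos.mpr hR))
    · rw [Real.coe_toNNReal _ (inv_pos.mpr hR).le]
      refine (mul_le_mul_of_nonneg_right (hpn n) (by positivity)).trans (le_of_eq ?_)
      rw [mul_assoc, mul_assoc, ← mul_pow, mul_inv_cancel₀ hR.ne', one_pow, mul_one]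
  refine ⟨p, hrad, ?_⟩
  have := Hq.completeSpace H.half_lt_sub
  have hball : ∀ᶠ u in 𝓝 (0 : Hq q), u ∈ Metric.eball (0 : Hq q) p.radius := Metric.eball_mem_nhds _ hrad
  have hsm : ∀ᶠ u in 𝓝 (0 : Hq q), 16 * Real.pi * X * ‖u‖ < 1 := by
    have hc : Continuous fun u : Hq q ↦ 16 * Real.pi * X * ‖u‖ := by fun_prop
    exact hc.continuousAt.eventually (gt_mem_nhds (by simp))
  filter_upwards [hball, hsm, (Hq.isOpen_isDisplacement hq).mem_nhds Hq.isDisplacement_zero] with u h1 h2 hu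
  refine ContinuousLinearMap.ext fun v ↦ Hq.ext fun x ↦ ?_
  set w := (Hq.compEquiv H.five_half_lt H.half_lt le_rfl hu).symm v
  have hw : ∀ x, w (u.toMap x) = v x := Hq.compEquiv_symm_apply H.five_half_lt H.half_lt le_rfl hu v
  rw [inertia_apply H hu hw]
  have h3 := hasSum_conjugation hs H.lt h2 hw
    (Hq.fourierHat_bessel (t := s) H.half_lt H.half_lt_sub (by ring) w) x
  have h4 := (p.hasFPowerSeriesOnBall hrad).hasSum h1
  rw [zero_add] at h4
  let ev : (Hq q →L[ℝ] Hq (q - 2 * s)) →+ ℝ :=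
    { toFun := fun A ↦ A v x, map_zero' := rfl, map_add' := fun _ _ ↦ rfl }
  have hev : Continuous ev := (Hq.continuous_eval' H.half_lt_sub x).comp
    (ContinuousLinearMap.apply ℝ (Hq (q - 2 * s)) v).continuous
  have h5 := h4.map ev hev
  have h6 := Complex.hasSum_ofReal.mpr h5
  have e : ∀ n, ((ev ∘ fun n ↦ p n fun _ ↦ u) n : ℂ) = (n.factorial : ℂ)⁻¹ *
      multiSum (fun j : Fin n → ℤ ↦ fdiff n j (pSymbol s 0 n)) (fun _ ↦ fourierHat u) (fourierHat (D v)) x := by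
    intro n
    have : (ev ∘ fun n ↦ p n fun _ ↦ u) n = (n.factorial : ℝ)⁻¹ * (T n (fun _ ↦ u) (D v)) x := rfl
    rw [this, Complex.ofReal_mul, eval_eq_multiSum hq H.half_lt_sub hbq (symbolConst_nonneg s n)
      (symbolBound_fdiff hs (ε := 0) (by simp) n) (fun _ ↦ u) (D v) (hT n (fun _ ↦ u) (D v)) x]
    push_cast
    rfl
  have h7 := h6.unique (h3.of_eq e rfl)
  have h8 : (p.sum u) v x = Hq.bessel (t := s) H.half_lt H.half_lt_sub (by ring) w (u.toMap x) - v x := by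
    exact_mod_cast h7
  change _ = v x + (p.sum u) v x
  rw [h8]; ring

/-- The order `⊤` is the analytic class, inherited from the power series. -/
theorem contDiffAt_inertia_zero (H : AdmissibleExponents s q) : ContDiffAt ℝ ⊤ (inertia H) 0 := by
  obtain ⟨p, hp, he⟩ := exists_expansion H
  have := Hq.completeSpace H.half_lt_sub
  have h := (p.hasFPowerSeriesOnBall hp).analyticAt.contDiffAt (n := ⊤)
  exact (contDiffAt_const.add h).congr_of_eventuallyEq he

/-- Right translation by `φ₀ = id + u₀` reduces to the identity: `A_u = R_{φ₀} A_{W u} R_{φ₀}⁻¹`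
with `W u = (u - u₀) ∘ φ₀⁻¹`. As `φ₀` is fixed, `W` is continuous affine and the outer operators are
constant, so no regularity is lost. -/
theorem contDiffAt_inertia (H : AdmissibleExponents s q) {u₀ : Hq q} (hu₀ : u₀.IsDisplacement) :
    ContDiffAt ℝ ⊤ (inertia H) u₀ := by
  set C := Hq.compEquiv H.five_half_lt H.half_lt le_rfl hu₀
  set C' := Hq.compEquiv H.five_half_lt H.half_lt_sub H.sub_le hu₀
  let W : Hq q → Hq q := fun u ↦ C.symm (u - u₀)
  have hW : ContDiff ℝ ⊤ W := by fun_prop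
  have hW0 : W u₀ = 0 := by simp [W]
  have h1 : ContDiffAt ℝ ⊤ (fun u ↦ (C' : Hq (q - 2 * s) →L[ℝ] Hq (q - 2 * s)) ∘L
      ((inertia H (W u)) ∘L (C.symm : Hq q →L[ℝ] Hq q))) u₀ := by
    refine contDiffAt_const.clm_comp (ContDiffAt.clm_comp ?_ contDiffAt_const)
    have h0 : ContDiffAt ℝ ⊤ (inertia H) (W u₀) := by rw [hW0]; exact contDiffAt_inertia_zero H
    exact h0.comp u₀ hW.contDiffAt
  refine h1.congr_of_eventuallyEq ?_
  have hd : ∀ᶠ u in 𝓝 u₀, (W u).IsDisplacement := by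
    refine hW.continuous.continuousAt.eventually ((Hq.isOpen_isDisplacement H.three_half_lt).mem_nhds ?_)
    rw [hW0]; exact Hq.isDisplacement_zero
  filter_upwards [hd, (Hq.isOpen_isDisplacement H.three_half_lt).mem_nhds hu₀] with u hWu hu
  -- That is, `id + u = (id + W u) ∘ φ₀`.
  have hmap : ∀ x, (W u).toMap (u₀.toMap x) = u.toMap x := fun x ↦ by
    have h2 : W u (u₀.toMap x) = u x - u₀ x := Hq.compEquiv_symm_apply _ _ _ hu₀ (u - u₀) x
    rw [Hq.toMap, h2, Hq.toMap, Hq.toMap, add_assoc, ← AddCircle.coe_add]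
    congr 2; ring
  refine ContinuousLinearMap.ext fun v ↦ Hq.ext fun x ↦ ?_
  set w := (Hq.compEquiv H.five_half_lt H.half_lt le_rfl hu).symm v
  have hw : ∀ x, w (u.toMap x) = v x := Hq.compEquiv_symm_apply H.five_half_lt H.half_lt le_rfl hu v
  have hw2 : ∀ y, w ((W u).toMap y) = C.symm v y := fun y ↦ by
    obtain ⟨x, rfl⟩ := Hq.surjective_toMap u₀ y
    rw [hmap, hw]
    exact (Hq.compEquiv_symm_apply _ _ _ hu₀ v x).symm
  rw [inertia_apply H hu hw]
  change _ = inertia H (W u) (C.symm v) (u₀.toMap x)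
  rw [inertia_apply H hWu hw2, hmap]

theorem inertia_sub_const (H : AdmissibleExponents s q) (u : Hq q) (n : ℤ) :
    inertia H (u - Hq.const (n : ℝ)) = inertia H u := by
  have : Fact (3 / 2 < q) := ⟨H.three_half_lt⟩
  by_cases hu : u.IsDisplacement
  · have hu' := Dq.isDisplacement_sub_const hu (n : ℝ)
    refine ContinuousLinearMap.ext fun v ↦ Hq.ext fun x ↦ ?_
    set w := (Hq.compEquiv H.five_half_lt H.half_lt le_rfl hu).symm v
    have hw : ∀ x, w (u.toMap x) = v x := Hq.compEquiv_symm_apply H.five_half_lt H.half_lt le_rfl hu v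
    have e := Dq.toMap_sub_int u n
    rw [inertia_apply H hu hw, inertia_apply H hu' (w := w) (fun x ↦ by rw [e, hw]), e]
  · have hu' : ¬ (u - Hq.const (n : ℝ)).IsDisplacement := fun h ↦ hu (by
      have := Dq.isDisplacement_sub_const h (-(n : ℝ))
      convert this using 1
      refine Hq.ext fun x ↦ ?_
      change _ = u x - n - (-n)
      ring)
    rw [inertia, inertia, dif_neg hu, dif_neg hu']

end Conjugation
end

section
open scoped Manifold ContDiff
attribute [-instance] Hq.instModuleReal Hq.instAddCommGroup
open MeasureTheory Filter Topology
open scoped ENNReal NNReal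

namespace Hq

variable {b q σ : ℝ}

/-- The mean value of a function. -/
noncomputable def integralL (hb : 1 / 2 < b) : Hq b →L[ℝ] ℝ :=
  LinearMap.mkContinuous
    { toFun := fun v ↦ ∫ x, v x ∂AddCircle.haarAddCircle
      map_add' := fun u v ↦ integral_add (continuous_integrable u.continuous) (continuous_integrable v.continuous)
      map_smul' := fun c u ↦ integral_const_mul c _ } (√(∑' k, sobolevWeight (-b) k)) fun v ↦ by
    refine (norm_integral_le_of_norm_le_const (Eventually.of_forall fun x ↦ v.abs_apply_le hb x)).trans ?_
    simp

end Hq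

/-! ### The metric in displacement coordinates -/

section Metric

variable {s q : ℝ} (H : AdmissibleExponents s q)

/-- The inertia operator `Λ^{2s}`. -/
noncomputable def lambdaL : Hq q ≃L[ℝ] Hq (q - 2 * s) :=
  Hq.bessel (t := s) H.half_lt H.half_lt_sub (by ring)

/-- The Fourier form of the inner product, from which symmetry follows by `k ↦ -k` and positivity by
`ĝ(-k) = conj ĝ(k)`. -/
theorem ofReal_integral_lambdaL_mul (f g : Hq q) :
    ((∫ x, lambdaL H f x * g x ∂AddCircle.haarAddCircle : ℝ) : ℂ) =
      ∑' k, sobolevWeight s k * fourierHat f k * fourierHat g (-k) := by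
  have h := integral_fourierSeries_mul ((lambdaL H f).summable_norm_coeff H.half_lt_sub)
    (g := fun x ↦ (g x : ℂ)) (Complex.continuous_ofReal.comp g.continuous)
  simp only [((lambdaL H f).hasSum_coeff H.half_lt_sub _).tsum_eq] at h
  rw [← integral_complex_ofReal]
  push_cast
  rw [h]
  refine tsum_congr fun k ↦ ?_
  rw [lambdaL, Hq.fourierHat_bessel]
  rfl

theorem integral_lambdaL_mul_comm (f g : Hq q) :
    ∫ x, lambdaL H f x * g x ∂AddCircle.haarAddCircle = ∫ x, lambdaL H g x * f x ∂AddCircle.haarAddCircle := by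
  have h : ((∫ x, lambdaL H f x * g x ∂AddCircle.haarAddCircle : ℝ) : ℂ) =
      (∫ x, lambdaL H g x * f x ∂AddCircle.haarAddCircle : ℝ) := by
    rw [ofReal_integral_lambdaL_mul, ofReal_integral_lambdaL_mul, ← (Equiv.neg ℤ).tsum_eq]
    refine tsum_congr fun k ↦ ?_
    rw [Equiv.neg_apply, neg_neg, sobolevWeight_neg_int]
    ring
  exact_mod_cast h

theorem integral_lambdaL_mul_self_pos {f : Hq q} (hf : f ≠ 0) :
    0 < ∫ x, lambdaL H f x * f x ∂AddCircle.haarAddCircle := by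
  have hs : Summable fun k ↦ sobolevWeight s k * ‖fourierHat f k‖ ^ 2 :=
    Hq.mem_of_mem (by linarith [H.half_le, H.lt]) f.2
  have h : ((∫ x, lambdaL H f x * f x ∂AddCircle.haarAddCircle : ℝ) : ℂ) =
      (∑' k, sobolevWeight s k * ‖fourierHat f k‖ ^ 2 : ℝ) := by
    rw [ofReal_integral_lambdaL_mul, Complex.ofReal_tsum]
    refine tsum_congr fun k ↦ ?_
    rw [fourierHat_neg, mul_assoc, Complex.mul_conj, Complex.normSq_eq_norm_sq]
    push_cast; rfl
  rw [Complex.ofReal_inj.mp h]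
  obtain ⟨k, hk⟩ : ∃ k, fourierHat f k ≠ 0 := by
    by_contra! h0
    exact hf (Hq.ext_coeff fun k ↦ by rw [h0]; exact (coeff_zero k).symm)
  exact hs.tsum_pos (fun k ↦ mul_nonneg (sobolevWeight_pos _ _).le (by positivity)) k
    (mul_pos (sobolevWeight_pos _ _) (by positivity))

theorem exists_comp_eq (H : AdmissibleExponents s q) {y : Hq q} (hy : y.IsDisplacement) (v : Hq q) : ∃ w : Hq q, ∀ x, w (y.toMap x) = v x :=
  ⟨_, Hq.compEquiv_symm_apply H.five_half_lt H.half_lt le_rfl hy v⟩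

/-- The Jacobian `1 + u_x`. -/
noncomputable def jacobian (u : Hq q) : Hq (q - 1) := Hq.const 1 + Hq.derivL H.three_half_lt u

theorem contDiff_jacobian : ContDiff ℝ ⊤ (jacobian H) :=
  contDiff_const.add (Hq.derivL H.three_half_lt).contDiff

theorem integral_jacobian_mul_comp (y : Hq q) {g : UnitAddCircle → ℝ} (hg : Continuous g) :
    ∫ x, jacobian H y x * g (y.toMap x) ∂AddCircle.haarAddCircle = ∫ x, g x ∂AddCircle.haarAddCircle :=
  integral_comp_circleMap' (y.hasCircleDeriv H.three_half_lt) hg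

/-- The pairing `∫ f w`. -/
noncomputable def pairingL : Hq (q - 2 * s) →L[ℝ] Hq q →L[ℝ] ℝ :=
  (ContinuousLinearMap.compL ℝ (Hq q) (Hq (q - 2 * s)) ℝ (Hq.integralL H.half_lt_sub)) ∘L
    (Hq.mulL H.half_lt_sub H.sub_le).flip

theorem pairingL_apply (f : Hq (q - 2 * s)) (w : Hq q) :
    pairingL H f w = ∫ x, w x * f x ∂AddCircle.haarAddCircle := rfl

/-- Multiplication `H^{q-1} × H^{q-2s} → H^{q-2s}`. -/
noncomputable def multL : Hq (q - 1) →L[ℝ] Hq (q - 2 * s) →L[ℝ] Hq (q - 2 * s) :=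
  Hq.mulL H.half_lt_sub H.sub_le_sub_one

theorem multL_apply (m : Hq (q - 1)) (f : Hq (q - 2 * s)) (x : UnitAddCircle) :
    multL H m f x = m x * f x := rfl

/-- The trilinear form `∫ m f w`. -/
noncomputable def tripleL : Hq (q - 1) →L[ℝ] Hq (q - 2 * s) →L[ℝ] Hq q →L[ℝ] ℝ :=
  (ContinuousLinearMap.compL ℝ (Hq (q - 2 * s)) (Hq (q - 2 * s)) (Hq q →L[ℝ] ℝ) (pairingL H)) ∘L multL H

theorem tripleL_apply (m : Hq (q - 1)) (f : Hq (q - 2 * s)) (w : Hq q) :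
    tripleL H m f w = pairingL H (multL H m f) w := rfl

/-- The local expression of the metric. -/
noncomputable def metricForm (y : Hq q) : Hq q →L[ℝ] Hq q →L[ℝ] ℝ :=
  (tripleL H (jacobian H y)) ∘L inertia H y

theorem metricForm_apply (y u v : Hq q) :
    metricForm H y u v = tripleL H (jacobian H y) (inertia H y u) v := rfl

theorem metricForm_eq_integral (y u v : Hq q) :
    metricForm H y u v = ∫ x, v x * (jacobian H y x * inertia H y u x) ∂AddCircle.haarAddCircle := rfl

theorem metricForm_eq {y : Hq q} (hy : y.IsDisplacement) {u v u' v' : Hq q}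
    (hu : ∀ x, u' (y.toMap x) = u x) (hv : ∀ x, v' (y.toMap x) = v x) :
    metricForm H y u v = ∫ x, lambdaL H u' x * v' x ∂AddCircle.haarAddCircle := by
  rw [metricForm_eq_integral, ← integral_jacobian_mul_comp H y (g := fun x ↦ lambdaL H u' x * v' x)
    ((lambdaL H u').continuous.mul v'.continuous)]
  refine integral_congr_ae (Eventually.of_forall fun x ↦ ?_)
  simp only
  rw [inertia_apply H hy hu, ← hv]
  change _ * (_ * lambdaL H u' (y.toMap x)) = _
  ring

theorem metricForm_comm {y : Hq q} (hy : y.IsDisplacement) (u v : Hq q) :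
    metricForm H y u v = metricForm H y v u := by
  obtain ⟨u', hu⟩ := exists_comp_eq H hy u
  obtain ⟨v', hv⟩ := exists_comp_eq H hy v
  rw [metricForm_eq H hy hu hv, metricForm_eq H hy hv hu, integral_lambdaL_mul_comm]

theorem metricForm_self_pos {y : Hq q} (hy : y.IsDisplacement) {u : Hq q} (hu0 : u ≠ 0) :
    0 < metricForm H y u u := by
  obtain ⟨u', hu⟩ := exists_comp_eq H hy u
  rw [metricForm_eq H hy hu hu]
  refine integral_lambdaL_mul_self_pos H fun h0 ↦ hu0 (Hq.ext fun x ↦ ?_)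
  rw [← hu, h0]; rfl

theorem ofReal_metricForm {y : Hq q} (hy : y.IsDisplacement) (φ : UnitAddCircle ≃ₜ UnitAddCircle)
    (hφ : ∀ x, φ x = y.toMap x) (u v : Hq q) :
    (metricForm H y u v : ℂ) = rightInvariantHs s φ u v := by
  obtain ⟨u', hu⟩ := exists_comp_eq H hy u
  obtain ⟨v', hv⟩ := exists_comp_eq H hy v
  have e1 : (fun x ↦ u (φ.symm x)) = u' := funext fun x ↦ by rw [← hu, ← hφ, φ.apply_symm_apply]
  have e2 : ∀ x, v (φ.symm x) = v' x := fun x ↦ by rw [← hv, ← hφ, φ.apply_symm_apply]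
  rw [metricForm_eq H hy hu hv, ← integral_complex_ofReal, rightInvariantHs, AddCircle.integral_haarAddCircle]
  simp only [e1, e2, inv_one, one_smul]
  refine integral_congr_ae (Eventually.of_forall fun x ↦ ?_)
  simp only
  rw [Complex.ofReal_mul, ← ((lambdaL H u').hasSum_coeff H.half_lt_sub x).tsum_eq, lambdaOp]
  congr 1
  refine tsum_congr fun k ↦ ?_
  rw [lambdaL, Hq.fourierHat_bessel]

/-- The inverse diffeomorphism has disappeared from the formula: the Jacobian is affine in `y`, the
pairing is bounded trilinear, and only `inertia` carries a nontrivial dependence. -/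
theorem contDiffAt_metricForm {y : Hq q} (hy : y.IsDisplacement) : ContDiffAt ℝ ⊤ (metricForm H) y := by
  have h0 := contDiff_jacobian H
  have h1 : ContDiffAt ℝ ⊤ (fun y ↦ tripleL H (jacobian H y)) y := by fun_prop
  exact h1.clm_comp (contDiffAt_inertia H hy)

theorem jacobian_sub_const (y : Hq q) (c : ℝ) : jacobian H (y - Hq.const c) = jacobian H y := by
  have : Hq.derivL H.three_half_lt (Hq.const c : Hq q) = 0 := by
    refine Hq.ext fun x ↦ ?_
    induction x using QuotientAddGroup.induction_on with | H x => ?_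
    change Hq.deriv (Hq.const c : Hq q) x = 0
    exact ((hasDerivAt_const x c).congr_of_eventuallyEq (Eventually.of_forall fun _ ↦ rfl)).deriv
  rw [jacobian, map_sub, this, sub_zero, jacobian]

theorem metricForm_sub_const (y : Hq q) (n : ℤ) : metricForm H (y - Hq.const (n : ℝ)) = metricForm H y := by
  rw [metricForm, inertia_sub_const, jacobian_sub_const, metricForm]

end Metric
end

section
open scoped Manifold ContDiff
attribute [-instance] Hq.instModuleReal Hq.instAddCommGroup
open MeasureTheory Filter Topology
open scoped ENNReal NNReal

/-! ### Variation of the metric without differentiating the direction -/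

section Variation

theorem HasCircleDeriv.norm_sub_le {f f₁ : C(UnitAddCircle, ℝ)} (hf : HasCircleDeriv f f₁) (a b : ℝ) :
    |f (a : UnitAddCircle) - f (b : UnitAddCircle)| ≤ ‖f₁‖ * |a - b| :=
  convex_univ.norm_image_sub_le_of_norm_hasDerivWithin_le (f := fun x : ℝ ↦ f (x : UnitAddCircle))
    (fun x _ ↦ (hf x).hasDerivWithinAt) (fun x _ ↦ f₁.norm_coe_le_norm x) (Set.mem_univ b) (Set.mem_univ a)

/-- The derivative of `∫ K_t (f ∘ φ₀ - f ∘ φ_t)` at `t = 0`, where `φ_t = id + y + t w`. -/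
theorem tendsto_variation {f f₁ y w : C(UnitAddCircle, ℝ)} (hf : HasCircleDeriv f f₁)
    {K : ℝ → C(UnitAddCircle, ℝ)} (hK : ∀ x, Tendsto (fun t ↦ K t x) (𝓝 0) (𝓝 (K 0 x))) {C : ℝ}
    (hC : ∀ᶠ t in 𝓝 0, ∀ x, |K t x| ≤ C) :
    Tendsto (fun t : ℝ ↦ t⁻¹ * ∫ x, K t x * (f (circleMap' y x) - f (circleMap' (y + t • w) x))
        ∂AddCircle.haarAddCircle) (𝓝[≠] 0)
      (𝓝 (∫ x, K 0 x * -(f₁ (circleMap' y x) * w x) ∂AddCircle.haarAddCircle)) := by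
  simp only [← integral_const_mul]
  refine tendsto_integral_filter_of_dominated_convergence (fun _ ↦ C * (‖f₁‖ * ‖w‖))
    (Eventually.of_forall fun t ↦ (by fun_prop : Continuous _).aestronglyMeasurable) ?_ (integrable_const _)
    (Eventually.of_forall fun x ↦ ?_)
  · filter_upwards [nhdsWithin_le_nhds hC, self_mem_nhdsWithin] with t ht ht0
    refine Eventually.of_forall fun x ↦ ?_
    have h1 : |f (circleMap' y x) - f (circleMap' (y + t • w) x)| ≤ ‖f₁‖ * (|t| * ‖w‖) := by
      induction x using QuotientAddGroup.induction_on with | H x => ?_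
      refine (hf.norm_sub_le (x + y (x : UnitAddCircle)) (x + (y + t • w) (x : UnitAddCircle))).trans ?_
      refine mul_le_mul_of_nonneg_left ?_ (norm_nonneg _)
      have e : x + y (x : UnitAddCircle) - (x + (y + t • w) (x : UnitAddCircle)) = -(t * w (x : UnitAddCircle)) := by
        simp
      rw [e, abs_neg, abs_mul]
      exact mul_le_mul_of_nonneg_left (w.norm_coe_le_norm _) (abs_nonneg _)
    have ht1 : 0 < |t| := abs_pos.mpr ht0
    have hC0 : 0 ≤ C := (abs_nonneg _).trans (ht x)
    rw [norm_mul, norm_mul, norm_inv, Real.norm_eq_abs, Real.norm_eq_abs, Real.norm_eq_abs]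
    calc |t|⁻¹ * (|K t x| * |f (circleMap' y x) - f (circleMap' (y + t • w) x)|)
        ≤ |t|⁻¹ * (C * (‖f₁‖ * (|t| * ‖w‖))) := by gcongr; exact ht x
      _ = _ := by field_simp
  · have h1 : HasDerivAt (fun t : ℝ ↦ f (circleMap' (y + t • w) x)) (f₁ (circleMap' y x) * w x) 0 := by
      induction x using QuotientAddGroup.induction_on with | H x => ?_
      have h2 : HasDerivAt (fun t : ℝ ↦ x + (y (x : UnitAddCircle) + t * w (x : UnitAddCircle)))
          (w (x : UnitAddCircle)) 0 := by
        simpa using (((hasDerivAt_id (0 : ℝ)).mul_const (w (x : UnitAddCircle))).const_add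
          (y (x : UnitAddCircle))).const_add x
      have h3 := HasDerivAt.comp (0 : ℝ) (h₂ := fun z : ℝ ↦ f (z : UnitAddCircle)) (hf _) h2
      exact h3.congr_deriv (by simp [circleMap'_apply])
    have h4 := (hasDerivAt_iff_tendsto_slope_zero.mp h1).neg.mul
      ((hK x).mono_left (nhdsWithin_le_nhds (s := {0}ᶜ)))
    refine (h4.congr fun t ↦ ?_).trans (le_of_eq ?_)
    · simp only [zero_add, zero_smul, add_zero, smul_eq_mul]
      ring
    · congr 1; ring

theorem Hq.exists_bound_of_continuousAt {b : ℝ} (hb : 1 / 2 < b) {Z : ℝ → Hq b} (hZ : ContinuousAt Z 0) :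
    (∀ x, Tendsto (fun t ↦ Z t x) (𝓝 0) (𝓝 (Z 0 x))) ∧ ∃ C, 0 ≤ C ∧ ∀ᶠ t in 𝓝 0, ∀ x, |Z t x| ≤ C := by
  refine ⟨fun x ↦ ((Hq.continuous_eval' hb x).tendsto _).comp hZ,
    √(∑' k, sobolevWeight (-b) k) * (‖Z 0‖ + 1), by positivity, ?_⟩
  have h := hZ.norm.eventually (gt_mem_nhds (lt_add_one ‖Z 0‖))
  filter_upwards [h] with t ht x
  exact ((Z t).abs_apply_le hb x).trans (by gcongr)

variable {s q : ℝ} (H : AdmissibleExponents s q)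

theorem metricForm_comp {y : Hq q} (hy : y.IsDisplacement) (u f : Hq q) {u' : Hq q}
    (hu : ∀ x, u' (y.toMap x) = u x) :
    ∫ x, jacobian H y x * inertia H y u x * f (y.toMap x) ∂AddCircle.haarAddCircle =
      ∫ x, lambdaL H u' x * f x ∂AddCircle.haarAddCircle := by
  rw [← integral_jacobian_mul_comp H y (g := fun x ↦ lambdaL H u' x * f x)
    ((lambdaL H u').continuous.mul f.continuous)]
  refine integral_congr_ae (Eventually.of_forall fun x ↦ ?_)
  simp only
  rw [inertia_apply H hy hu]
  change _ * lambdaL H u' (y.toMap x) * _ = _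
  ring

theorem hasDerivAt_line (y w : Hq q) : HasDerivAt (fun t : ℝ ↦ y + t • w) w 0 := by
  simpa using ((hasDerivAt_id (0 : ℝ)).smul_const w).const_add y

theorem deriv_comp_mul_jacobian {y v v' : Hq q} (hv : ∀ x, v' (y.toMap x) = v x) (x : UnitAddCircle) :
    v'.derivC H.three_half_lt (y.toMap x) * jacobian H y x = Hq.derivL H.three_half_lt v x := by
  have h1 := (v'.hasCircleDeriv H.three_half_lt).comp (y.hasCircleDeriv H.three_half_lt)
  rw [show (Hq.toC v').comp (circleMap' (Hq.toC y)) = Hq.toC v from ContinuousMap.ext hv] at h1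
  exact congrArg (fun f : C(UnitAddCircle, ℝ) ↦ f x) (h1.unique (v.hasCircleDeriv H.three_half_lt))

/-- The derivative of the metric in the direction `w`, in a form in which `w` is not differentiated. -/
theorem fderiv_metricForm {y : Hq q} (hy : y.IsDisplacement) (u v w : Hq q) :
    fderiv ℝ (metricForm H) y w u v =
      -(tripleL H (Hq.derivL H.three_half_lt v) (inertia H y u) w +
        tripleL H (Hq.derivL H.three_half_lt u) (inertia H y v) w) := by
  obtain ⟨u', hu⟩ := exists_comp_eq H hy u
  obtain ⟨v', hv⟩ := exists_comp_eq H hy v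
  have hline := hasDerivAt_line y w
  have hc : ContinuousAt (fun t : ℝ ↦ y + t • w) 0 := hline.continuousAt
  have e0 : y + (0 : ℝ) • w = y := by simp
  have hd : HasDerivAt (fun t : ℝ ↦ metricForm H (y + t • w) u v) (fderiv ℝ (metricForm H) y w u v) 0 := by
    have h1 : HasFDerivAt (metricForm H) (fderiv ℝ (metricForm H) y) y :=
      ((contDiffAt_metricForm H hy).differentiableAt (by simp)).hasFDerivAt
    have h2 : HasDerivAt (fun t : ℝ ↦ metricForm H (y + t • w)) (fderiv ℝ (metricForm H) y w) 0 :=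
      HasFDerivAt.hasLineDerivAt (𝕜 := ℝ) (E := Hq q) (F := Hq q →L[ℝ] Hq q →L[ℝ] ℝ) h1 w
    exact (h2.clm_apply (hasDerivAt_const (0 : ℝ) u)).clm_apply (hasDerivAt_const (0 : ℝ) v) |>.congr_deriv (by simp)
  let Z : ℝ → Hq (q - 2 * s) := fun t ↦ multL H (jacobian H (y + t • w)) (inertia H (y + t • w) u)
  have hjc : ContinuousAt (fun t : ℝ ↦ jacobian H (y + t • w)) 0 :=
    (contDiff_jacobian H).continuous.continuousAt.comp hc
  have hic : ContinuousAt (fun t : ℝ ↦ inertia H (y + t • w)) 0 := by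
    have : ContinuousAt (inertia H) (y + (0 : ℝ) • w) := by rw [e0]; exact (contDiffAt_inertia H hy).continuousAt
    exact ContinuousAt.comp (f := fun t : ℝ ↦ y + t • w) this hc
  have hZ : ContinuousAt Z 0 :=
    ((multL H).continuous.continuousAt.comp hjc).clm_apply (hic.clm_apply continuousAt_const)
  obtain ⟨hZ1, C1, -, hC1⟩ := Hq.exists_bound_of_continuousAt H.half_lt_sub hZ
  obtain ⟨hJ1, C2, hC20, hC2⟩ := Hq.exists_bound_of_continuousAt (by linarith [H.three_half_lt]) hjc
  let g : C(UnitAddCircle, ℝ) := Hq.toC (lambdaL H v')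
  let K2 : ℝ → C(UnitAddCircle, ℝ) := fun t ↦
    Hq.toC (jacobian H (y + t • w)) * g.comp (circleMap' (Hq.toC y + t • Hq.toC w))
  have hK2 : ∀ x, Tendsto (fun t ↦ K2 t x) (𝓝 0) (𝓝 (K2 0 x)) := fun x ↦ by
    refine (hJ1 x).mul ?_
    have h1 : Continuous fun t : ℝ ↦ g (circleMap' (Hq.toC y + t • Hq.toC w) x) := by
      have h2 : ∀ t : ℝ, circleMap' (Hq.toC y + t • Hq.toC w) x = x + ((y x + t * w x : ℝ) : UnitAddCircle) :=
        fun t ↦ rfl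
      simp only [h2]
      have := AddCircle.continuous_mk' (1 : ℝ)
      fun_prop
    exact h1.tendsto 0
  have hC2' : ∀ᶠ t in 𝓝 0, ∀ x, |K2 t x| ≤ C2 * ‖g‖ := by
    filter_upwards [hC2] with t ht x
    change |jacobian H (y + t • w) x * g (circleMap' (Hq.toC y + t • Hq.toC w) x)| ≤ _
    rw [abs_mul]
    exact mul_le_mul (ht x) (g.norm_coe_le_norm _) (abs_nonneg _) hC20
  -- With `u_t = u ∘ φ_t⁻¹`, the difference `g_t(u, v) - g_0(u, v)` is split at the intermediate
  -- quantity `∫ (Λ u_t) v'`, using the symmetry of `Λ^{2s}`. One half varies only `v' ∘ φ_t`, the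
  -- other only `u' ∘ φ_t`, so the derivative falls on `v'` and `u'` and never on `w` or on the
  -- momentum.
  have l1 := tendsto_variation (y := Hq.toC y) (w := Hq.toC w) (v'.hasCircleDeriv H.three_half_lt)
    (K := fun t ↦ Hq.toC (Z t)) hZ1 hC1
  have l2 := tendsto_variation (y := Hq.toC y) (w := Hq.toC w) (u'.hasCircleDeriv H.three_half_lt) hK2 hC2'
  have l3 := hasDerivAt_iff_tendsto_slope_zero.mp hd
  have l4 := l1.add l2
  have hev : ∀ᶠ t : ℝ in 𝓝 0, (y + t • w).IsDisplacement := by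
    have : Fact (3 / 2 < q) := ⟨H.three_half_lt⟩
    exact Dq.eventually_isDisplacement y w hy
  have huniq := tendsto_nhds_unique l3 (l4.congr' ?_)
  · rw [huniq, tripleL_apply, tripleL_apply, pairingL_apply, pairingL_apply, neg_add, ← integral_neg, ← integral_neg]
    congr 1
    · refine integral_congr_ae (Eventually.of_forall fun x ↦ ?_)
      simp only [Z, e0, multL_apply, Hq.circleMap'_toC]
      rw [← deriv_comp_mul_jacobian H hv]
      ring
    · refine integral_congr_ae (Eventually.of_forall fun x ↦ ?_)
      simp only [multL_apply]
      rw [← deriv_comp_mul_jacobian H hu, inertia_apply H hy hv]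
      simp only [K2, ContinuousMap.mul_apply, ContinuousMap.comp_apply, zero_smul, add_zero, Hq.circleMap'_toC]
      change jacobian H y x * lambdaL H v' (y.toMap x) * _ = -(_ * (_ * lambdaL H v' (y.toMap x)))
      ring
  · filter_upwards [nhdsWithin_le_nhds hev] with t ht
    rw [zero_add, e0, smul_eq_mul, ← mul_add]
    congr 1
    obtain ⟨ut, hut⟩ := exists_comp_eq H ht u
    have hcm : ∀ x, circleMap' (Hq.toC y + t • Hq.toC w) x = (y + t • w).toMap x := fun x ↦ rfl
    simp only [Hq.circleMap'_toC, hcm]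
    -- Here `v = v' ∘ φ₀`, while transporting `v' ∘ φ_t` by `φ_t` gives the integral of `(Λ u_t)
    -- v'`.
    have i1 : ∫ x, Z t x * (v' (y.toMap x) - v' ((y + t • w).toMap x)) ∂AddCircle.haarAddCircle =
        metricForm H (y + t • w) u v - ∫ x, lambdaL H ut x * v' x ∂AddCircle.haarAddCircle := by
      rw [← metricForm_comp H ht u v' hut, metricForm_eq_integral, ← integral_sub]
      · refine integral_congr_ae (Eventually.of_forall fun x ↦ ?_)
        simp only [hv, Z, multL_apply]
        ring
      · exact continuous_integrable (v.continuous.mul ((Hq.continuous _).mul (Hq.continuous _)))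
      · exact continuous_integrable (((Hq.continuous _).mul (Hq.continuous _)).mul
          (v'.continuous.comp (Hq.continuous_toMap _)))
    -- Similarly `u' ∘ φ₀ = u = u_t ∘ φ_t`, so both terms transport by `φ_t`.
    have i2 : ∫ x, K2 t x * (u' (y.toMap x) - u' ((y + t • w).toMap x)) ∂AddCircle.haarAddCircle =
        (∫ x, lambdaL H v' x * ut x ∂AddCircle.haarAddCircle) - metricForm H y u v := by
      rw [metricForm_eq H hy hu hv, integral_lambdaL_mul_comm H u' v',
        ← integral_jacobian_mul_comp H (y + t • w) (g := fun x ↦ lambdaL H v' x * ut x)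
          ((lambdaL H v').continuous.mul ut.continuous),
        ← integral_jacobian_mul_comp H (y + t • w) (g := fun x ↦ lambdaL H v' x * u' x)
          ((lambdaL H v').continuous.mul u'.continuous), ← integral_sub]
      · refine integral_congr_ae (Eventually.of_forall fun x ↦ ?_)
        simp only [hu, hut]
        change jacobian H (y + t • w) x * lambdaL H v' ((y + t • w).toMap x) * _ = _
        ring
      · exact continuous_integrable ((Hq.continuous _).mul
          (((lambdaL H v').continuous.mul ut.continuous).comp (Hq.continuous_toMap _)))
      · exact continuous_integrable ((Hq.continuous _).mul
          (((lambdaL H v').continuous.mul u'.continuous).comp (Hq.continuous_toMap _)))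
    rw [i1, i2, integral_lambdaL_mul_comm H ut v']
    ring

end Variation
end

section
open scoped Manifold ContDiff
attribute [-instance] Hq.instModuleReal Hq.instAddCommGroup
open MeasureTheory Filter Topology
open scoped ENNReal NNReal

/-! ### The Christoffel map and its smoothness -/

section Christoffel

variable {s q : ℝ} (H : AdmissibleExponents s q)

/-- The Jacobian is positive and lies in `H^{q-1}` with `q - 1 > 3/2`, so its reciprocal is in the
same space and multiplies `H^{q-2s}`. -/
theorem exists_multL_jacobian_equiv {y : Hq q} (hy : y.IsDisplacement) :
    ∃ e : Hq (q - 2 * s) ≃L[ℝ] Hq (q - 2 * s),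
      (e : Hq (q - 2 * s) →L[ℝ] Hq (q - 2 * s)) = multL H (jacobian H y) := by
  have hpos : ∀ x, 0 < jacobian H y x := hy.pos H.three_half_lt
  let g : C(UnitAddCircle, ℝ) := ⟨fun x ↦ (jacobian H y x)⁻¹,
    (Hq.continuous _).inv₀ fun x ↦ (hpos x).ne'⟩
  let m : Hq (q - 1) := Hq.mk g (Hq.inv_mem (by linarith [H.five_half_lt]) (jacobian H y).2 hpos fun x ↦ rfl)
  have hm : ∀ x, m x = (jacobian H y x)⁻¹ := fun x ↦ rfl
  refine ⟨ContinuousLinearEquiv.equivOfInverse (multL H (jacobian H y)) (multL H m)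
    (fun v ↦ Hq.ext fun x ↦ ?_) (fun v ↦ Hq.ext fun x ↦ ?_), rfl⟩
  · rw [multL_apply, multL_apply, hm, inv_mul_cancel_left₀ (hpos x).ne']
  · rw [multL_apply, multL_apply, hm, mul_inv_cancel_left₀ (hpos x).ne']

/-- The quadratic transport term `u_x A_φ v`. -/
noncomputable def transportL (y : Hq q) : Hq q →L[ℝ] Hq q →L[ℝ] Hq (q - 2 * s) :=
  ((ContinuousLinearMap.compL ℝ (Hq q) (Hq (q - 2 * s)) (Hq (q - 2 * s))).flip (inertia H y)) ∘L
    ((multL H) ∘L (Hq.derivL H.three_half_lt))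

/-- The momentum form `A_φ Γ_φ` of the Christoffel map. -/
noncomputable def christoffelMomentum (y : Hq q) : Hq q →L[ℝ] Hq q →L[ℝ] Hq (q - 2 * s) :=
  (2 : ℝ)⁻¹ • (fderiv ℝ (inertia H) y + (fderiv ℝ (inertia H) y).flip) +
    (ContinuousLinearMap.compL ℝ (Hq q) (Hq (q - 2 * s)) (Hq (q - 2 * s))
      (ContinuousLinearMap.inverse (multL H (jacobian H y)))) ∘L (transportL H y + (transportL H y).flip)

theorem christoffelMomentum_apply (y u v : Hq q) :
    christoffelMomentum H y u v = (2 : ℝ)⁻¹ • (fderiv ℝ (inertia H) y u v + fderiv ℝ (inertia H) y v u) +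
      ContinuousLinearMap.inverse (multL H (jacobian H y))
        (multL H (Hq.derivL H.three_half_lt u) (inertia H y v) +
          multL H (Hq.derivL H.three_half_lt v) (inertia H y u)) := rfl

/-- The Christoffel map of the metric, in the displacement coordinates. -/
noncomputable def christoffel (y : Hq q) : Hq q →L[ℝ] Hq q →L[ℝ] Hq q :=
  (ContinuousLinearMap.compL ℝ (Hq q) (Hq (q - 2 * s)) (Hq q) (ContinuousLinearMap.inverse (inertia H y))) ∘L
    christoffelMomentum H y

theorem christoffel_apply (y u v : Hq q) : christoffel H y u v =
    ContinuousLinearMap.inverse (inertia H y) (christoffelMomentum H y u v) := rfl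

/-- The plain product rule. It serves for the two Koszul terms in which the test vector sits in a
slot of the form; where the test vector is the direction of differentiation, `fderiv_metricForm` is
used. -/
theorem fderiv_metricForm_apply {y : Hq q} (hy : y.IsDisplacement) (u v w : Hq q) :
    fderiv ℝ (metricForm H) y w u v = tripleL H (Hq.derivL H.three_half_lt w) (inertia H y u) v +
      tripleL H (jacobian H y) (fderiv ℝ (inertia H) y w u) v := by
  have h1 : HasFDerivAt (fun y ↦ tripleL H (jacobian H y)) ((tripleL H) ∘L (Hq.derivL H.three_half_lt)) y := by
    have h2 : HasFDerivAt (jacobian H) (Hq.derivL H.three_half_lt) y :=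
      (Hq.derivL H.three_half_lt).hasFDerivAt.const_add _
    exact HasFDerivAt.comp (𝕜 := ℝ) (E := Hq q) (F := Hq (q - 1)) (G := Hq (q - 2 * s) →L[ℝ] Hq q →L[ℝ] ℝ) y
      (ContinuousLinearMap.hasFDerivAt (E := Hq (q - 1)) (F := Hq (q - 2 * s) →L[ℝ] Hq q →L[ℝ] ℝ) (tripleL H)) h2
  have h3 : HasFDerivAt (inertia H) (fderiv ℝ (inertia H) y) y :=
    ((contDiffAt_inertia H hy).differentiableAt (by simp)).hasFDerivAt
  have h4 : HasFDerivAt (metricForm H) _ y := h1.clm_comp h3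
  rw [h4.fderiv]
  change tripleL H (jacobian H y) (fderiv ℝ (inertia H) y w u) v +
    tripleL H (Hq.derivL H.three_half_lt w) (inertia H y u) v = _
  rw [add_comm]

/-- The product rule contributes `u_x A v + v_x A u` and the variation formula contributes it once
more. The transport term therefore enters `christoffelMomentum` without the factor `½` carried by
the derivatives of `A`. -/
theorem metricForm_christoffel {y : Hq q} (hy : y.IsDisplacement) (u v w : Hq q) :
    2 * metricForm H y (christoffel H y u v) w =
      fderiv ℝ (metricForm H) y u v w + fderiv ℝ (metricForm H) y v u w - fderiv ℝ (metricForm H) y w u v := by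
  obtain ⟨e, he⟩ := exists_multL_jacobian_equiv H hy
  have h1 : inertia H y (christoffel H y u v) = christoffelMomentum H y u v := by
    rw [christoffel_apply, inertia_eq H hy, ContinuousLinearMap.inverse_equiv]
    exact (inertiaEquiv H hy).apply_symm_apply _
  have h2 : ∀ X, multL H (jacobian H y) (ContinuousLinearMap.inverse (multL H (jacobian H y)) X) = X := fun X ↦ by
    rw [← he, ContinuousLinearMap.inverse_equiv]
    exact e.apply_symm_apply X
  rw [metricForm_apply, h1, tripleL_apply, christoffelMomentum_apply, map_add, h2, fderiv_metricForm H hy u v w,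
    fderiv_metricForm_apply H hy v w u, fderiv_metricForm_apply H hy u w v]
  simp only [tripleL_apply, map_add, map_smul, add_apply, smul_apply,
    smul_eq_mul]
  ring

/-- Both `A` and multiplication by the Jacobian are isomorphisms at `y`, and inversion of operators
is analytic there because the spaces are complete. The remaining operations are bounded multilinear.
-/
theorem contDiffAt_christoffel {y : Hq q} (hy : y.IsDisplacement) (v : Hq q) :
    ContDiffAt ℝ ⊤ (fun p : Hq q × Hq q ↦ christoffel H p.1 p.2 p.2) (y, v) := by
  have := Hq.completeSpace H.half_lt
  have := Hq.completeSpace H.half_lt_sub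
  have hA := contDiffAt_inertia H hy
  have f1 : ContDiffAt ℝ ⊤ (fun p : Hq q × Hq q ↦ p.1) (y, v) := contDiffAt_fst
  have f2 : ContDiffAt ℝ ⊤ (fun p : Hq q × Hq q ↦ p.2) (y, v) := contDiffAt_snd
  have a1 : ContDiffAt ℝ ⊤ (fun p : Hq q × Hq q ↦ inertia H p.1) (y, v) :=
    ContDiffAt.comp (y, v) (f := fun p : Hq q × Hq q ↦ p.1) hA f1
  have a2 : ContDiffAt ℝ ⊤ (fun p : Hq q × Hq q ↦ fderiv ℝ (inertia H) p.1) (y, v) :=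
    ContDiffAt.comp (y, v) (f := fun p : Hq q × Hq q ↦ p.1)
      (hA.fderiv_right (m := ⊤) (by simp)) f1
  have a3 : ContDiffAt ℝ ⊤ (fun p : Hq q × Hq q ↦ ContinuousLinearMap.inverse (inertia H p.1)) (y, v) := by
    have h1 : ContDiffAt ℝ ⊤ ContinuousLinearMap.inverse (inertia H y) := by
      rw [inertia_eq H hy]; exact contDiffAt_map_inverse _
    exact ContDiffAt.comp (y, v) (f := fun p : Hq q × Hq q ↦ inertia H p.1) h1 a1
  have a4 : ContDiffAt ℝ ⊤ (fun p : Hq q × Hq q ↦ multL H (jacobian H p.1)) (y, v) := by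
    have h0 := contDiff_jacobian H
    have h1 : ContDiffAt ℝ ⊤ (fun y ↦ multL H (jacobian H y)) y := by fun_prop
    exact ContDiffAt.comp (y, v) (f := fun p : Hq q × Hq q ↦ p.1) h1 f1
  have a5 : ContDiffAt ℝ ⊤ (fun p : Hq q × Hq q ↦
      ContinuousLinearMap.inverse (multL H (jacobian H p.1))) (y, v) := by
    obtain ⟨e, he⟩ := exists_multL_jacobian_equiv H hy
    have h1 : ContDiffAt ℝ ⊤ ContinuousLinearMap.inverse (multL H (jacobian H y)) := by
      rw [← he]; exact contDiffAt_map_inverse _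
    exact ContDiffAt.comp (y, v) (f := fun p : Hq q × Hq q ↦ multL H (jacobian H p.1)) h1 a4
  have a6 : ContDiffAt ℝ ⊤ (fun p : Hq q × Hq q ↦
      multL H (Hq.derivL H.three_half_lt p.2) (inertia H p.1 p.2)) (y, v) := by
    have h1 : ContDiffAt ℝ ⊤ (fun p : Hq q × Hq q ↦ multL H (Hq.derivL H.three_half_lt p.2)) (y, v) := by fun_prop
    exact h1.clm_apply (a1.clm_apply f2)
  have a7 : ContDiffAt ℝ ⊤ (fun p : Hq q × Hq q ↦ fderiv ℝ (inertia H) p.1 p.2 p.2) (y, v) :=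
    (a2.clm_apply f2).clm_apply f2
  have a8 : ContDiffAt ℝ ⊤ (fun p : Hq q × Hq q ↦ christoffelMomentum H p.1 p.2 p.2) (y, v) :=
    (contDiffAt_const.smul (a7.add a7)).add (a5.clm_apply (a6.add a6))
  exact a3.clm_apply a8

theorem christoffel_sub_const (y : Hq q) (n : ℤ) : christoffel H (y - Hq.const (n : ℝ)) = christoffel H y := by
  have h : fderiv ℝ (inertia H) (y - Hq.const (n : ℝ)) = fderiv ℝ (inertia H) y := by
    rw [← fderiv_comp_sub]
    congr 1
    exact funext fun y ↦ inertia_sub_const H y n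
  rw [christoffel, christoffelMomentum, transportL, h, inertia_sub_const, jacobian_sub_const, christoffel,
    christoffelMomentum, transportL]

end Christoffel
end

section
open scoped Manifold ContDiff
open Filter Topology

/-! ### Manifolds whose chart changes are translations -/

section TranslationAtlas

variable {E : Type*} [NormedAddCommGroup E] [NormedSpace ℝ E] {K : Type*} [TopologicalSpace K]
  (I : ModelWithCorners ℝ E K) (M : Type*) [TopologicalSpace M] [ChartedSpace K M]

/-- All changes of preferred charts are locally translations. -/
def HasTranslationAtlas : Prop := ∀ x y z : M, z ∈ (chartAt K x).source → z ∈ (chartAt K y).source →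
  ∃ c : E, ∀ᶠ v in 𝓝 (extChartAt I x z), extChartAt I y ((extChartAt I x).symm v) = v - c

variable {I M} [IsManifold I 1 M]

/-- The derivative of a translation is the identity, so tangent vectors have the same components in
all preferred charts. -/
theorem HasTranslationAtlas.tangentCoordChange_eq (h : HasTranslationAtlas I M)
    (hI : Set.range I = Set.univ) {x y z : M}
    (hx : z ∈ (chartAt K x).source) (hy : z ∈ (chartAt K y).source) :
    tangentCoordChange I x y z = ContinuousLinearMap.id ℝ E := by
  obtain ⟨c, hc⟩ := h x y z hx hy
  have hc' : extChartAt I y ∘ (extChartAt I x).symm =ᶠ[𝓝 (extChartAt I x z)] fun v ↦ v - c := hc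
  rw [tangentCoordChange_def, hI, fderivWithin_univ, hc'.fderiv_eq, fderiv_sub_const, fderiv_fun_id]

theorem HasTranslationAtlas.trivializationAt_apply (h : HasTranslationAtlas I M)
    (hI : Set.range I = Set.univ) {x : M} {p : TangentBundle I M} (hp : p.1 ∈ (chartAt K x).source) :
    trivializationAt E (TangentSpace I) x p = (p.1, p.2) := by
  have h1 := DFunLike.congr_fun (h.tangentCoordChange_eq hI (mem_chart_source K p.1) hp) p.2
  exact Prod.ext rfl h1

theorem HasTranslationAtlas.trivializationAt_symm (h : HasTranslationAtlas I M)
    (hI : Set.range I = Set.univ) {x y : M} (hy : y ∈ (chartAt K x).source) (v : E) :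
    (trivializationAt E (TangentSpace I) x).symm y v = v := by
  have hy' : y ∈ (trivializationAt E (TangentSpace I) x).baseSet := hy
  have h1 := (trivializationAt E (TangentSpace I : M → Type _) x).apply_mk_symm hy' v
  rw [h.trivializationAt_apply hI (p := ⟨y, _⟩) hy] at h1
  exact congrArg Prod.snd h1

theorem HasTranslationAtlas.mfderiv_extChartAt (h : HasTranslationAtlas I M)
    (hI : Set.range I = Set.univ) {x y : M} (hy : y ∈ (chartAt K x).source) :
    mfderiv I 𝓘(ℝ, E) (extChartAt I x) y = ContinuousLinearMap.id ℝ E := by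
  rw [← TangentBundle.continuousLinearMapAt_trivializationAt hy,
    TangentBundle.continuousLinearMapAt_trivializationAt_eq_core hy]
  exact h.tangentCoordChange_eq hI (mem_chart_source K y) hy

theorem HasTranslationAtlas.mfderiv_extChartAt_symm (h : HasTranslationAtlas I M)
    (hI : Set.range I = Set.univ) {x y : M} (hy : y ∈ (chartAt K x).source) :
    mfderivWithin 𝓘(ℝ, E) I (extChartAt I x).symm (Set.range I) (extChartAt I x y) = ContinuousLinearMap.id ℝ E := by
  rw [← TangentBundle.symmL_trivializationAt hy,
    TangentBundle.symmL_trivializationAt_eq_core hy]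
  exact h.tangentCoordChange_eq hI hy (mem_chart_source K y)

theorem HasTranslationAtlas.extChartAt_tangentBundle (h : HasTranslationAtlas I M)
    (hI : Set.range I = Set.univ) {p p' : TangentBundle I M} (hp : p.1 ∈ (chartAt K p'.1).source) :
    extChartAt I.tangent p' p = (extChartAt I p'.1 p.1, p.2) := by
  have h1 := DFunLike.congr_fun (h.tangentCoordChange_eq hI (mem_chart_source K p.1) hp) p.2
  exact Prod.ext rfl h1

/-- The charts of `TM` change by `(c, 0)`. The property therefore passes to `TM`, and vector fields
on `TM` are also read off by components. -/
theorem HasTranslationAtlas.tangentBundle (h : HasTranslationAtlas I M)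
    (hI : Set.range I = Set.univ) : HasTranslationAtlas I.tangent (TangentBundle I M) := by
  intro x y z hx hy
  have hx1 := (TangentBundle.mem_chart_source_iff z x).1 hx
  have hy1 := (TangentBundle.mem_chart_source_iff z y).1 hy
  obtain ⟨c, hc⟩ := h x.1 y.1 z.1 hx1 hy1
  refine ⟨(c, 0), ?_⟩
  have hI' : Set.range I.tangent = Set.univ := by
    rw [ModelWithCorners.tangent, ModelWithCorners.range_prod, hI]
    simp
  have hzs : z ∈ (extChartAt I.tangent x).source := by rwa [extChartAt_source]
  have h1 := extChartAt_target_mem_nhdsWithin' (I := I.tangent) hzs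
  rw [hI', nhdsWithin_univ] at h1
  have h2 : ∀ᶠ v in 𝓝 (extChartAt I.tangent x z),
      ((extChartAt I.tangent x).symm v).1 ∈ (chartAt K y.1).source := by
    have hcont := continuousAt_extChartAt_symm' (I := I.tangent) hzs
    refine (hcont.eventually ?_).mono fun v hv ↦ (TangentBundle.mem_chart_source_iff _ y).1 hv
    rw [(extChartAt I.tangent x).left_inv hzs]
    exact (chartAt (ModelProd K E) y).open_source.mem_nhds hy
  have h3 : ∀ᶠ v in 𝓝 (extChartAt I.tangent x z),
      extChartAt I y.1 ((extChartAt I x.1).symm v.1) = v.1 - c := by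
    rw [h.extChartAt_tangentBundle hI hx1]
    exact (continuous_fst.tendsto (extChartAt I x.1 z.1, z.2)).eventually hc
  filter_upwards [h1, h2, h3] with v hv1 hv2 hv3
  have hv : ((extChartAt I.tangent x).symm v).1 ∈ (chartAt K x.1).source := by
    have := (extChartAt I.tangent x).map_target hv1
    rw [extChartAt_source] at this
    exact (TangentBundle.mem_chart_source_iff _ x).1 this
  have e := (extChartAt I.tangent x).right_inv hv1
  rw [h.extChartAt_tangentBundle hI hv] at e
  rw [h.extChartAt_tangentBundle hI hv2]
  have e1 := congrArg Prod.fst e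
  have e2 := congrArg Prod.snd e
  simp only at e1 e2
  rw [← e1, (extChartAt I x.1).left_inv (by rwa [extChartAt_source]), e1] at hv3
  exact Prod.ext hv3 (by rw [e2]; simp)


/-- A vector field on a manifold with a translation atlas is smooth if its components are. -/
theorem HasTranslationAtlas.contMDiff_section [IsManifold I ∞ M] (h : HasTranslationAtlas I M)
    (hI : Set.range I = Set.univ) {V : (x : M) → TangentSpace I x}
    (hV : ContMDiff I 𝓘(ℝ, E) ∞ (fun x ↦ (V x : E))) :
    ContMDiff I I.tangent ∞ (fun x ↦ (⟨x, V x⟩ : TangentBundle I M)) := by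
  intro x
  rw [Bundle.contMDiffAt_section]
  refine (hV x).congr_of_eventuallyEq ?_
  filter_upwards [chart_source_mem_nhds K x] with y hy
  rw [h.trivializationAt_apply hI hy]

/-- A field of bilinear forms on a manifold with a translation atlas is smooth if its components are. -/
theorem HasTranslationAtlas.contMDiff_bilin [IsManifold I ∞ M] (h : HasTranslationAtlas I M)
    (hI : Set.range I = Set.univ)
    {G : (x : M) → TangentSpace I x →L[ℝ] TangentSpace I x →L[ℝ] ℝ}
    (hG : ContMDiff I 𝓘(ℝ, E →L[ℝ] E →L[ℝ] ℝ) ∞ (fun x ↦ id (α := E →L[ℝ] E →L[ℝ] ℝ) (G x))) :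
    ContMDiff I (I.prod 𝓘(ℝ, E →L[ℝ] E →L[ℝ] ℝ)) ∞
      (fun x : M ↦ Bundle.TotalSpace.mk' (E →L[ℝ] E →L[ℝ] ℝ)
        (E := fun x : M ↦ TangentSpace I x →L[ℝ] TangentSpace I x →L[ℝ] ℝ) x (G x)) := by
  intro x
  rw [Bundle.contMDiffAt_section]
  refine (hG x).congr_of_eventuallyEq ?_
  filter_upwards [chart_source_mem_nhds K x] with y hy
  ext v w
  rw [hom_trivializationAt_apply]
  refine (inCoordinates_apply_eq₂ (E₃ := fun _ : M ↦ ℝ) hy hy (Set.mem_univ _)).trans ?_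
  rw [h.trivializationAt_symm hI hy, h.trivializationAt_symm hI hy]
  simp
  rfl

end TranslationAtlas
end

section
open scoped Manifold ContDiff
attribute [-instance] Hq.instModuleReal Hq.instAddCommGroup
open Filter Topology

/-! ### Descent from displacements to `D^q` and `T D^q` -/

namespace Dq

variable {q : ℝ} [Fact (3 / 2 < q)]

theorem extChartAt_eq (φ ψ : Dq q) :
    extChartAt 𝓘(ℝ, Hq q) φ ψ = ψ.disp - Hq.const ((⌊ψ.disp 0 - (φ.disp 0 - 1 / 2)⌋ : ℤ) : ℝ) := rfl

theorem chartAt_symm_eq (φ : Dq q) (u : Hq q) : (chartAt (Hq q) φ).symm u = ofDisp' u := rfl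

theorem isDisplacement_of_mem_target {φ : Dq q} {u : Hq q} (hu : u ∈ (chartAt (Hq q) φ).target) :
    u.IsDisplacement := And.left hu

/-- The displacement recovered from a diffeomorphism is an arbitrary choice, but it has the same
normalization as the original one. -/
theorem disp_ofDisp' {u : Hq q} (hu : u.IsDisplacement) :
    ∃ n : ℤ, (ofDisp' u : Dq q).disp = u - Hq.const (n : ℝ) := by
  have h := normalize_disp_ofDisp 0 u hu
  rw [ofDisp'_eq hu]
  refine ⟨⌊u 0 - 0⌋ - ⌊(ofDisp u hu).disp 0 - 0⌋, Hq.ext fun x ↦ ?_⟩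
  have hx := congrArg (fun w : Hq q ↦ w x) h
  simp only [normalize, Hq.sub_apply, Hq.const_apply] at hx
  rw [Hq.sub_apply, Hq.const_apply]
  push_cast
  linarith

variable (q) in
theorem hasTranslationAtlas : HasTranslationAtlas 𝓘(ℝ, Hq q) (Dq q) := by
  intro x y z hx hy
  have h : chartAt (Hq q) x z ∈ ((chart (x.disp 0 - 1 / 2)).symm.trans
      (chart (y.disp 0 - 1 / 2)) : PartialEquiv (Hq q) (Hq q)).source := by
    refine ⟨(chartAt (Hq q) x).map_source hx, ?_⟩
    change (chartAt (Hq q) x).symm (chartAt (Hq q) x z) ∈ (chartAt (Hq q) y).source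
    rwa [(chartAt (Hq q) x).left_inv hx]
  exact ⟨_, trans_eventuallyEq _ _ h⟩

/-- A smooth function of the displacement that is invariant under integer translations is smooth on `D^q`. -/
theorem contMDiff_disp {F : Type*} [NormedAddCommGroup F] [NormedSpace ℝ F] {f : Hq q → F}
    (hf : ∀ y : Hq q, y.IsDisplacement → ContDiffAt ℝ ⊤ f y)
    (hper : ∀ (y : Hq q) (n : ℤ), f (y - Hq.const (n : ℝ)) = f y) :
    ContMDiff 𝓘(ℝ, Hq q) 𝓘(ℝ, F) ∞ (fun φ : Dq q ↦ f φ.disp) := by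
  intro φ
  have h1 : ContMDiffAt 𝓘(ℝ, Hq q) 𝓘(ℝ, Hq q) ∞ (extChartAt 𝓘(ℝ, Hq q) φ) φ := contMDiffAt_extChartAt
  have h2 : ContDiffAt ℝ ∞ f (extChartAt 𝓘(ℝ, Hq q) φ φ) :=
    (hf _ (isDisplacement_sub_const φ.isDisplacement_disp _)).of_le le_top
  -- Nothing is known about the dependence of `disp` on the point. Invariance of `f` allows it to be
  -- replaced by the chart at `φ`, from which it differs by an integer.
  refine (h2.contMDiffAt.comp φ h1).congr_of_eventuallyEq (Eventually.of_forall fun ψ ↦ ?_)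
  change _ = f (extChartAt 𝓘(ℝ, Hq q) φ ψ)
  rw [extChartAt_eq, hper]

/-- A smooth function of the displacement and a tangent vector that is invariant under integer
translations is smooth on `T D^q`. -/
theorem contMDiff_disp_snd {F : Type*} [NormedAddCommGroup F] [NormedSpace ℝ F] {f : Hq q × Hq q → F}
    (hf : ∀ y v : Hq q, y.IsDisplacement → ContDiffAt ℝ ⊤ f (y, v))
    (hper : ∀ (y v : Hq q) (n : ℤ), f (y - Hq.const (n : ℝ), v) = f (y, v)) :
    ContMDiff 𝓘(ℝ, Hq q).tangent 𝓘(ℝ, F) ∞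
      (fun p : TangentBundle 𝓘(ℝ, Hq q) (Dq q) ↦ f (p.1.disp, p.2)) := by
  intro p
  have h1 : ContMDiffAt 𝓘(ℝ, Hq q).tangent 𝓘(ℝ, Hq q × Hq q) ∞
    (extChartAt 𝓘(ℝ, Hq q).tangent p) p := contMDiffAt_extChartAt
  have hat := hasTranslationAtlas q
  have hI : Set.range 𝓘(ℝ, Hq q) = Set.univ := ModelWithCorners.range_eq_univ _
  have h2 : ContDiffAt ℝ ∞ f (extChartAt 𝓘(ℝ, Hq q).tangent p p) := by
    rw [hat.extChartAt_tangentBundle hI (_root_.mem_chart_source _ p.1)]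
    exact (hf _ _ (isDisplacement_sub_const p.1.isDisplacement_disp _)).of_le le_top
  refine (h2.contMDiffAt.comp p h1).congr_of_eventuallyEq ?_
  filter_upwards [chart_source_mem_nhds (ModelProd (Hq q) (Hq q)) p] with r hr
  change _ = f (extChartAt 𝓘(ℝ, Hq q).tangent p r)
  rw [hat.extChartAt_tangentBundle hI ((TangentBundle.mem_chart_source_iff r p).1 hr), extChartAt_eq]
  exact (hper _ _ _).symm

end Dq

/-! ### The metric and the spray on `D^q` -/

section Spray

variable {s q : ℝ} [Fact (3 / 2 < q)] (H : AdmissibleExponents s q)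

/-- The right-invariant `H^s` metric on `D^q`. -/
noncomputable def sobolevMetric : WeakRiemannianMetric (Hq q) (Dq q) where
  inner φ := id (α := Hq q →L[ℝ] Hq q →L[ℝ] ℝ) (metricForm H φ.disp)
  symm φ v w := metricForm_comm H φ.isDisplacement_disp v w
  pos φ _ hv := metricForm_self_pos H φ.isDisplacement_disp hv
  contMDiff := (Dq.hasTranslationAtlas q).contMDiff_bilin (ModelWithCorners.range_eq_univ _)
    (Dq.contMDiff_disp (f := metricForm H) (fun _ hy ↦ contDiffAt_metricForm H hy) (metricForm_sub_const H))

/-- The inverse chart has identity derivative, and the displacement chosen at its value differs from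
`y` by an integer, which `metricForm` ignores. -/
theorem inChart_sobolevMetric (φ : Dq q) {y : Hq q} (hy : y ∈ (chartAt (Hq q) φ).target) :
    (sobolevMetric H).inChart φ y = metricForm H y := by
  have hs : (chartAt (Hq q) φ).symm y ∈ (chartAt (Hq q) φ).source := (chartAt (Hq q) φ).map_target hy
  have h := (Dq.hasTranslationAtlas q).mfderiv_extChartAt_symm (ModelWithCorners.range_eq_univ _) hs
  have e : extChartAt 𝓘(ℝ, Hq q) φ ((chartAt (Hq q) φ).symm y) = y := (chartAt (Hq q) φ).right_inv hy
  rw [e, ModelWithCorners.range_eq_univ, mfderivWithin_univ] at h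
  have h' : mfderiv 𝓘(ℝ, Hq q) 𝓘(ℝ, Hq q) (chartAt (Hq q) φ).symm y = ContinuousLinearMap.id ℝ (Hq q) := h
  obtain ⟨n, hn⟩ := Dq.disp_ofDisp' (Dq.isDisplacement_of_mem_target hy)
  have hg : metricForm H ((chartAt (Hq q) φ).symm y).disp = metricForm H y := by
    rw [Dq.chartAt_symm_eq, hn, metricForm_sub_const]
  ext v w
  change metricForm H ((chartAt (Hq q) φ).symm y).disp
    (mfderiv 𝓘(ℝ, Hq q) 𝓘(ℝ, Hq q) (chartAt (Hq q) φ).symm y v)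
    (mfderiv 𝓘(ℝ, Hq q) 𝓘(ℝ, Hq q) (chartAt (Hq q) φ).symm y w) = _
  rw [hg, h']
  rfl

/-- The geodesic spray of the right-invariant `H^s` metric. -/
noncomputable def sobolevSpray (p : TangentBundle 𝓘(ℝ, Hq q) (Dq q)) :
    TangentSpace 𝓘(ℝ, Hq q).tangent p :=
  id (α := Hq q × Hq q) (p.2, -christoffel H p.1.disp p.2 p.2)

theorem isSmoothVectorField_sobolevSpray : IsSmoothVectorField (sobolevSpray H) := by
  have hI : Set.range 𝓘(ℝ, Hq q) = Set.univ := ModelWithCorners.range_eq_univ _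
  have hI' : Set.range 𝓘(ℝ, Hq q).tangent = Set.univ := ModelWithCorners.range_eq_univ _
  refine ((Dq.hasTranslationAtlas q).tangentBundle hI).contMDiff_section hI' ?_
  refine Dq.contMDiff_disp_snd (f := fun p : Hq q × Hq q ↦ (p.2, -christoffel H p.1 p.2 p.2)) ?_ ?_
  · intro y v hy
    exact contDiffAt_snd.prodMk (contDiffAt_christoffel H hy v).neg
  · intro y v n
    simp only [christoffel_sub_const]

theorem isGeodesicSpray_sobolevSpray : (sobolevMetric H).IsGeodesicSpray (sobolevSpray H) := by
  intro φ y hy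
  have hI : Set.range 𝓘(ℝ, Hq q) = Set.univ := ModelWithCorners.range_eq_univ _
  have hI' : Set.range 𝓘(ℝ, Hq q).tangent = Set.univ := ModelWithCorners.range_eq_univ _
  -- Equality near `y`, and not only at `y`, since the Koszul formula differentiates the local
  -- expression.
  have hev : (sobolevMetric H).inChart φ =ᶠ[𝓝 y] metricForm H := by
    filter_upwards [(chartAt (Hq q) φ).open_target.mem_nhds hy] with z hz
    exact inChart_sobolevMetric H φ hz
  refine ⟨christoffel H y, fun u v w ↦ ?_, fun p v hp hpv ↦ ?_⟩
  · have h := metricForm_christoffel H (Dq.isDisplacement_of_mem_target hy) u v w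
    rw [inChart_sobolevMetric H φ hy]
    have hd : fderiv ℝ ((sobolevMetric H).inChart φ) y = fderiv ℝ (metricForm H) y :=
      Filter.EventuallyEq.fderiv_eq (E := Hq q) (F := Hq q →L[ℝ] Hq q →L[ℝ] ℝ) hev
    rw [← hd] at h
    exact h
  · have hat := (Dq.hasTranslationAtlas q).tangentBundle hI
    have hm := hat.mfderiv_extChartAt hI' (x := (⟨φ, 0⟩ : TangentBundle 𝓘(ℝ, Hq q) (Dq q))) (y := p)
      ((TangentBundle.mem_chart_source_iff _ _).2 hp)
    rw [(Dq.hasTranslationAtlas q).extChartAt_tangentBundle hI (p' := ⟨φ, 0⟩) hp, Dq.extChartAt_eq] at hpv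
    have e1 := congrArg Prod.fst hpv
    have e2 := congrArg Prod.snd hpv
    simp only at e1 e2
    have hm' : mfderiv 𝓘(ℝ, Hq q).tangent 𝓘(ℝ, Hq q × Hq q)
      (extChartAt 𝓘(ℝ, Hq q).tangent (⟨φ, 0⟩ : TangentBundle 𝓘(ℝ, Hq q) (Dq q))) p (sobolevSpray H p)
        = sobolevSpray H p := DFunLike.congr_fun hm _
    refine hm'.trans ?_
    change (p.2, -christoffel H p.1.disp p.2 p.2) = _
    rw [e2, ← e1, christoffel_sub_const]
    rfl

end Spray

theorem Dq.isHqDiffeo_symm {q : ℝ} (hq : 5 / 2 < q) (φ : Dq q) : IsHqDiffeo q φ.toHomeo.symm :=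
  Hq.exists_inverse_displacement hq φ.isDisplacement_disp ⟨φ.toHomeo.symm, φ.toHomeo.symm.continuous⟩
    fun x ↦ by rw [Dq.toMap_disp]; exact φ.toHomeo.apply_symm_apply x
end

theorem mainTheorem5 (s q : ℝ) (hs : 1 / 2 ≤ s) (hq : 3 / 2 + 2 * s < q) [Fact (3 / 2 < q)] :
    (∀ φ : Dq q, IsHqDiffeo q φ.toHomeo.symm) ∧
    ∃ g : WeakRiemannianMetric (Hq q) (Dq q),
      (∀ (φ : DiffS1) (η ξ : SmoothFn),
        ((g.inner (φ.toDq q) ((φ.toDq q).tangentVector (η.toHq q))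
          ((φ.toDq q).tangentVector (ξ.toHq q)) : ℝ) : ℂ) = rightInvariantHs s φ.toHomeo η ξ) ∧
      (∀ (φ : Dq q) (η ξ : Hq q),
        ((g.inner φ (φ.tangentVector η) (φ.tangentVector ξ) : ℝ) : ℂ) =
          rightInvariantHs s φ.toHomeo η ξ) ∧
      ∃ F : (p : TangentBundle 𝓘(ℝ, Hq q) (Dq q)) → TangentSpace 𝓘(ℝ, Hq q).tangent p,
        IsSmoothVectorField F ∧ g.IsGeodesicSpray F := by
  have H : AdmissibleExponents s q := ⟨hs, hq⟩
  have hφ (φ : Dq q) (x : UnitAddCircle) : φ.toHomeo x = φ.disp.toMap x := (φ.toMap_disp x).symm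
  refine ⟨fun φ ↦ φ.isHqDiffeo_symm H.five_half_lt, sobolevMetric H, fun φ η ξ ↦ ?_, fun φ η ξ ↦ ?_,
    sobolevSpray H, isSmoothVectorField_sobolevSpray H, isGeodesicSpray_sobolevSpray H⟩
  · exact ofReal_metricForm H (φ.toDq q).isDisplacement_disp φ.toHomeo (hφ (φ.toDq q)) _ _
  · exact ofReal_metricForm H φ.isDisplacement_disp φ.toHomeo (hφ φ) _ _
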